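/- **Setup.** Let $Q_\theta(s,a)\in\mathbb R$, $\theta\in\mathbb R^d$, be a parameterized Q-function, $\pi$ a deterministic policy, $\gamma$ a real discount factor, and $\mathcal D=\{(s_i,a_i,r_i,s_i')\}_{i=1}^n$ a dataset. Write $Q_i(\theta)=Q_\theta(s_i,a_i)$, $Q_i'(\theta)=Q_\theta(s_i',\pi(s_i'))$, $e_i=Q_i-(r_i+\gamma Q_i')$ and $g(\theta)=\sum_i e_i(\theta)\nabla Q_i(\theta)$. Noisy semi-gradient TD with learning rate $\eta$ is $$\theta_{k+1}=\theta_k-\eta\, g(\theta_k)+\eta\,\varepsilon_k,\qquad \varepsilon_k\sim\mathcal N(0,M)\ \text{i.i.d.},\quad M\succeq 0 .$$ Let $\theta^*$ be a TD fixed point, $e_i(\theta^*)=0$ for all $i$, and let $G=Dg(\theta^*)\in\mathbb R^{d\times d}$ be the pseudo-Hessian. **Assumptions.** (a) All $Q_i,Q_i'$ are $C^3$, with $\mathscr L_2$-Lipschitz second and $\mathscr L_3$-Lipschitz third derivatives on $\mathbb R^d$. (b) $\operatorname{rank}G=n$, and $G$, $\sum_i\nabla Q_i(\theta^*)\nabla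 Q_i(\theta^*)^\top$ and $M$ have the same ($n$-dimensional) column space. (c) For constants $\omega,C_0$, the pairs $(\sum_i\nabla Q_i(\theta^*)\nabla Q_i(\theta^*)^\top,G)$ and $(M,G)$ are $(\omega,C_0)$-aligned. Here $(A,B)$ with $A\succeq 0$ is $(\omega,C_0)$-aligned if there are eigendecompositions $A=U_A\Lambda_AU_A^\top$ ($U_A$ orthogonal, eigenvalues in decreasing order) and $B=U_B\Lambda_BU_B^H$ ($U_B$ unitary, eigenvalues in decreasing order of modulus) such that, for all $i$, the $i$-th columns satisfy $|U_B(i)^HU_A(i)|\le\omega$ and $\Lambda_A(i)\le C_0|\Lambda_B(i)|$. **Regularizer.** For a learning rate $\eta$ let $\Sigma^*_M$ be a fixed point of the discrete Lyapunov equation $\Sigma^*_M=(I-\eta G)\Sigma^*_M(I-\eta G)^\top+\eta^2M$, and let $$R_{\mathrm{TD}}(\theta)=\frac{\eta}{2}\sum_i\nabla Q_i(\theta)^\top\Sigma^*_M\nabla Q_i(\theta)-\eta\gamma\sum_i\operatorname{tr}\bigl([[\nabla Q_i'(\theta)^\top]]^\top\Sigma^*_M\nabla Q_i(\theta)\bigr),$$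 where the second term is the scalar $\nabla Q_i'^\top\Sigma^*_M\nabla Q_i$ and $[[\cdot]]$ is the stop-gradient: the bracketed factor is held at its value at $\theta^*$ when $R_{\mathrm{TD}}$ is differentiated at $\theta^*$. **Stability.** Let $H$ be a set of learning rates. $\theta^*$ is called *stable (attractive)* for learning rates in $H$ if * for all $T,r,\delta>0$ there are $\rho,\eta_0>0$ such that for every $\eta\in H$ with $0<\eta<\eta_0$ and every $\theta_0$ with $\|\theta_0-\theta^*\|\le\rho$, with probability at least $1-\delta$ the iterates satisfy $\|\theta_k-\theta^*\|<r$ for all $k\le T/\eta^2$; and * for all $T,\delta>0$ there are $K,\eta_0>0$ such that for every $\eta\in H$ with $0<\eta<\eta_0$ and every $k\le T/\eta^2$, the iterates started at $\theta_0=\theta^*$ satisfy $\|\theta_k-\theta^*\|<K\sqrt\eta$ with probability at least $1-\delta$. **Theorem.** Under these assumptions, $\theta^*$ is stable (attractive) for learning rates in $H$ if 1. every eigenvalue $\lambda$ of $G$ satisfies $\operatorname{Re}\lambda\ge 0$, and $\operatorname{Re}\lambda>0$ if $|\operatorname{Im}\lambda|>0$; and 2. for every $\eta\in H$ and every $v\in\operatorname{Null}(G)$,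 $\theta^*$ is a stationary point of $R_{\mathrm{TD}}$ along $v$, i.e. $v^\top\nabla R_{\mathrm{TD}}(\theta^*)=0$. -/

import Mathlib

open MeasureTheory ProbabilityTheory Matrix

noncomputable section

/-- The parameter space `ℝ^d` with its Euclidean norm. -/
abbrev Param (d : ℕ) : Type := EuclideanSpace ℝ (Fin d)

/-- A transition `(s, a, r, s')`. -/
structure Transition (S A : Type*) where
  state : S
  action : A
  reward : ℝ
  next : S

section TD

variable {d n : ℕ} {S A : Type*}

/-- `Q_i(θ) = Q_θ(s_i, a_i)`. -/
def qCur (Q : Param d → S → A → ℝ) (D : Fin n → Transition S A) (i : Fin n)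
    (θ : Param d) : ℝ :=
  Q θ (D i).state (D i).action

/-- `Q'_i(θ) = Q_θ(s'_i, a'_i)` with `a'_i = π(s'_i)` for the deterministic policy `π`. -/
def qNext (Q : Param d → S → A → ℝ) (π : S → A) (D : Fin n → Transition S A) (i : Fin n)
    (θ : Param d) : ℝ :=
  Q θ (D i).next (π (D i).next)

/-- The signed TD error `e_i(θ) = Q_i(θ) - (r_i + γ Q'_i(θ))`. -/
def tdError (Q : Param d → S → A → ℝ) (π : S → A) (γ : ℝ) (D : Fin n → Transition S A)
    (i : Fin n) (θ : Param d) : ℝ :=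
  qCur Q D i θ - ((D i).reward + γ * qNext Q π D i θ)

/-- The TD semi-gradient `g(θ) = ∑ i, ∇Q_i(θ) e_i(θ)`. -/
def semiGradient (Q : Param d → S → A → ℝ) (π : S → A) (γ : ℝ) (D : Fin n → Transition S A)
    (θ : Param d) : Param d :=
  ∑ i, tdError Q π γ D i θ • gradient (qCur Q D i) θ

/-- The pseudo-Hessian `G(θ)`: the Jacobian matrix of the semi-gradient `g` at `θ`. -/
def pseudoHessian (Q : Param d → S → A → ℝ) (π : S → A) (γ : ℝ) (D : Fin n → Transition S A)
    (θ : Param d) : Matrix (Fin d) (Fin d) ℝ :=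
  Matrix.of fun i j => fderiv ℝ (semiGradient Q π γ D) θ (EuclideanSpace.single j 1) i

/-- The matrix `∑ i, ∇Q_i(θ) ∇Q_i(θ)ᵀ`. -/
def gradGram (Q : Param d → S → A → ℝ) (D : Fin n → Transition S A) (θ : Param d) :
    Matrix (Fin d) (Fin d) ℝ :=
  ∑ i, vecMulVec (WithLp.ofLp (gradient (qCur Q D i) θ))
    (WithLp.ofLp (gradient (qCur Q D i) θ))

/-- `uᵀ B v` for vectors `u`, `v` and a square matrix `B`. -/
def bilin (B : Matrix (Fin d) (Fin d) ℝ) (u v : Param d) : ℝ :=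
  WithLp.ofLp u ⬝ᵥ (B *ᵥ WithLp.ofLp v)

/-- The induced implicit regularizer, as a function of `θ`, with covariance matrix `C`.
The factor under the stop-gradient is evaluated at the separate argument `θbar`, which is held
fixed when differentiating in `θ`. -/
def tdRegularizer (Q : Param d → S → A → ℝ) (π : S → A) (γ : ℝ) (D : Fin n → Transition S A)
    (η : ℝ) (C : Matrix (Fin d) (Fin d) ℝ) (θbar θ : Param d) : ℝ :=
  η * (1 / 2) * ∑ i, bilin C (gradient (qCur Q D i) θ) (gradient (qCur Q D i) θ)
    - η * γ * ∑ i, bilin C (gradient (qNext Q π D i) θbar) (gradient (qCur Q D i) θ)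

/-- `C` is a fixed point of the discrete Lyapunov equation
`C = (I - ηG) C (I - ηG)ᵀ + η² M`. -/
def IsLyapunovFixedPoint (η : ℝ) (G M C : Matrix (Fin d) (Fin d) ℝ) : Prop :=
  C = (1 - η • G) * C * (1 - η • G)ᵀ + η ^ 2 • M

/-- `(ω, C₀)`-alignment of a pair `(P, B)`: for some eigendecompositions `P = U_P Λ_P U_Pᵀ`
(orthogonal, eigenvalues decreasing) and `B = U_B Λ_B U_Bᴴ` (unitary, eigenvalues decreasing in
modulus), the columns satisfy `|U_B(i)ᴴ U_P(i)| ≤ ω` and `Λ_P(i) ≤ C₀ |Λ_B(i)|`. -/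
def IsAligned (ω C₀ : ℝ) (P B : Matrix (Fin d) (Fin d) ℝ) : Prop :=
  ∃ (UP : Matrix (Fin d) (Fin d) ℝ) (UB : Matrix (Fin d) (Fin d) ℂ)
    (p : Fin d → ℝ) (b : Fin d → ℂ),
    UP ∈ Matrix.orthogonalGroup (Fin d) ℝ ∧ UB ∈ Matrix.unitaryGroup (Fin d) ℂ ∧
    P = UP * Matrix.diagonal p * UPᵀ ∧
    B.map Complex.ofReal = UB * Matrix.diagonal b * UBᴴ ∧
    Antitone p ∧ Antitone (fun i => ‖b i‖) ∧
    (∀ i, ‖∑ j, star (UB j i) * (UP j i : ℂ)‖ ≤ ω) ∧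
    ∀ i, p i ≤ C₀ * ‖b i‖

/-- The noisy TD iteration `θ_{k+1} = θ_k - η g(θ_k) + η ε_k` started at `θ₀`. -/
def noisyTD (Q : Param d → S → A → ℝ) (π : S → A) (γ : ℝ) (D : Fin n → Transition S A)
    (η : ℝ) (θ₀ : Param d) (ε : ℕ → Param d) : ℕ → Param d
  | 0 => θ₀
  | k + 1 => noisyTD Q π γ D η θ₀ ε k
      - η • semiGradient Q π γ D (noisyTD Q π γ D η θ₀ ε k) + η • ε k

/-- `θstar` is a stable (attractive) point of the noisy TD iteration for small learning rates in
`H`, on the time scale `1/η²` on which the noise acts to first order along the directions that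
the linearized iteration does not contract:

* iterates started near `θstar` stay near `θstar`, with high probability, for `T/η²` steps;
* iterates started at `θstar` fluctuate around it, like the reference process
  `ζ_{k+1} = (I - ηG) ζ_k + η ε_k`, only on the scale `√η` at every time `k ≤ T/η²`. -/
def IsStableTD (Q : Param d → S → A → ℝ) (π : S → A) (γ : ℝ) (D : Fin n → Transition S A)
    {Ω : Type*} [MeasurableSpace Ω] (μ : Measure Ω) (ε : ℕ → Ω → Param d) (H : Set ℝ)
    (θstar : Param d) : Prop :=
  (∀ T r δ : ℝ, 0 < T → 0 < r → 0 < δ → ∃ ρ η₀ : ℝ, 0 < ρ ∧ 0 < η₀ ∧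
    ∀ η ∈ H, 0 < η → η < η₀ → ∀ θ₀ : Param d, ‖θ₀ - θstar‖ ≤ ρ →
      μ {w | ∃ k : ℕ, (k : ℝ) ≤ T / η ^ 2 ∧
        r ≤ ‖noisyTD Q π γ D η θ₀ (fun j => ε j w) k - θstar‖} ≤ ENNReal.ofReal δ) ∧
  (∀ T δ : ℝ, 0 < T → 0 < δ → ∃ K η₀ : ℝ, 0 < K ∧ 0 < η₀ ∧
    ∀ η ∈ H, 0 < η → η < η₀ → ∀ k : ℕ, (k : ℝ) ≤ T / η ^ 2 →
      μ {w | K * √η ≤ ‖noisyTD Q π γ D η θstar (fun j => ε j w) k - θstar‖}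
        ≤ ENNReal.ofReal δ)

end TD

end

/-!
Write `x = θ - θstar`.  Near the fixed point the semi-gradient vanishes on the manifold where all
TD errors vanish, whose tangent space is the kernel of the pseudo-Hessian `G`.  The alignment
hypothesis contains a unitary diagonalization of `G`, so `G` is normal, and the condition on its
spectrum then says `⟪x, G x⟫ ≥ c ‖G x‖²` (`normal_matrix_quadratic_forms`).  Hence `G` is coercive
off its kernel (`exists_kernel_projection`): the directions in the range of `G` are contracted at
rate `η`, those of the kernel are not contracted at all, and the noise acts on the former only.

The proof separates these directions nonlinearly.  With `P` the orthogonal projection onto the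
kernel, there are a fast coordinate `y`, which is `∑ i, e i(θ) ∇Q_i(θstar)` near the origin, and a
slow coordinate `z = P x - c(x) y + k(y, y)` (`SlowFastForm`, `exists_slowFastForm`).  The operator
`c(x)` makes the drift of `z` vanish up to second order in `y`, and the bilinear map `k`, the
solution of a Sylvester equation with right side `D = c'(0)`, removes the leading quadratic term.
What remains in one step of `z` is a drift `O(η ‖x‖ ‖y‖²)`, a centred noise term `O(η ‖x‖)`,
the second-order noise term `η² (k(G ε, G ε) - D(ε, G ε))`, and a remainder
`O(η² ‖x‖ + η³)` (`norm_slow_increment_le`).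

The other terms can at most amplify an existing distance from the fixed point by a constant factor in
`1 / η²` steps, or are negligible; the mean of the second-order noise term could push the iterates
away, and this is where the regularizer enters.  If `X` is `1 / η` times a
stationary covariance of the linearized dynamics, the Lyapunov equation turns the mean of this term
into `-∑ j, D (X b_j) (G G b_j)` up to `O(η)` (`sum_noiseForm_eq`, `norm_sum_noiseForm_le`), and
that sum is `P ∑ i, ∇²Q_i X (∇Q_i - γ ∇Q'_i)`, a multiple of the component of the gradient of the
regularizer in the kernel (`exists_slowFastForm_sum_smul`, `projection_sum_hessian_eq_zero`).  Symmetry of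
the covariance, which a solution of the Lyapunov equation need not have, is only needed on the range
of `G`, where it is automatic (`lyapunov_symm_on_ker`).

The function `‖z‖² + β ‖z‖² ‖y‖² + α ‖y‖⁴ + η` therefore grows in expectation by at most a factor
`1 + O(η²)` per step (`SlowFastForm.lyapunov_drift`): the fast coordinate is of size `√η`, and the
terms in `y` absorb the quadratic fluctuations.  Iterating over `T / η²` steps, for the
process frozen when it leaves a small ball, and applying Markov's inequality gives both stability
assertions (`SlowFastForm.stability`).
-/


open scoped InnerProductSpace

/-! ### Quadratic forms of normal matrices -/

theorem mem_spectrum_of_unitary_diagonalization {d : ℕ} {B U : Matrix (Fin d) (Fin d) ℂ}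
    {b : Fin d → ℂ} (hU : U ∈ Matrix.unitaryGroup (Fin d) ℂ)
    (hB : B = U * Matrix.diagonal b * Uᴴ) (i : Fin d) : b i ∈ spectrum ℂ B := by
  have h : spectrum ℂ B = spectrum ℂ (Matrix.diagonal b) := by
    rw [hB]
    exact Unitary.spectrum_star_right_conjugate (U := ⟨U, hU⟩)
  rw [h, spectrum.mem_iff, Matrix.algebraMap_eq_diagonal, Matrix.diagonal_sub,
    Matrix.isUnit_diagonal]
  intro hu
  have := (Pi.isUnit_iff.1 hu) i
  simp at this

/-- A real matrix with a unitary diagonalization is normal, and the condition that its nonzero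
eigenvalues have positive real part (with `0` as the only other eigenvalue) becomes a bound of
`G x` by the quadratic form of `G`. -/
theorem normal_matrix_quadratic_forms {d : ℕ} {G : Matrix (Fin d) (Fin d) ℝ}
    {U : Matrix (Fin d) (Fin d) ℂ} {b : Fin d → ℂ} (hU : U ∈ Matrix.unitaryGroup (Fin d) ℂ)
    (hG : G.map Complex.ofReal = U * Matrix.diagonal b * Uᴴ)
    (h1 : ∀ z ∈ spectrum ℂ (G.map Complex.ofReal), 0 ≤ z.re ∧ (0 < |z.im| → 0 < z.re)) :
    (∃ c > 0, ∀ x : Fin d → ℝ, c * ((G *ᵥ x) ⬝ᵥ (G *ᵥ x)) ≤ x ⬝ᵥ (G *ᵥ x)) ∧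
    ∀ x : Fin d → ℝ, (Gᵀ *ᵥ x) ⬝ᵥ (Gᵀ *ᵥ x) = (G *ᵥ x) ⬝ᵥ (G *ᵥ x) := by
  have hUU : Uᴴ * U = 1 := by
    have := (Matrix.mem_unitaryGroup_iff').1 hU
    simpa [Matrix.star_eq_conjTranspose] using this
  let xc : (Fin d → ℝ) → Fin d → ℂ := fun x i => (x i : ℂ)
  let y : (Fin d → ℝ) → Fin d → ℂ := fun x => Uᴴ *ᵥ xc x
  have hmap : ∀ (A : Matrix (Fin d) (Fin d) ℝ) x, xc (A *ᵥ x) = A.map Complex.ofReal *ᵥ xc x := by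
    intro A x; ext i; simp [xc, Matrix.mulVec, dotProduct]
  have hdot : ∀ u v : Fin d → ℝ, ((u ⬝ᵥ v : ℝ) : ℂ) = star (xc u) ⬝ᵥ xc v := by
    intro u v; simp [xc, dotProduct]
  have hiso : ∀ a c : Fin d → ℂ, star (U *ᵥ a) ⬝ᵥ (U *ᵥ c) = star a ⬝ᵥ c := by
    intro a c
    rw [Matrix.star_mulVec, Matrix.dotProduct_mulVec, Matrix.vecMul_vecMul, hUU, Matrix.vecMul_one]
  have hGx : ∀ x, xc (G *ᵥ x) = U *ᵥ (fun i => b i * y x i) := by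
    intro x
    rw [hmap, hG, ← Matrix.mulVec_mulVec, ← Matrix.mulVec_mulVec]
    congr 1; ext i; simp [Matrix.mulVec_diagonal, y]
  have hGt : ∀ x, xc (Gᵀ *ᵥ x) = U *ᵥ (fun i => star (b i) * y x i) := by
    intro x
    have : Gᵀ.map Complex.ofReal = (G.map Complex.ofReal)ᴴ := by
      ext i j; simp
    rw [hmap, this, hG, Matrix.conjTranspose_mul, Matrix.conjTranspose_mul,
      Matrix.conjTranspose_conjTranspose, Matrix.diagonal_conjTranspose, ← Matrix.mulVec_mulVec,
      ← Matrix.mulVec_mulVec]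
    congr 1; ext i; simp [Matrix.mulVec_diagonal, y]
  have hsq : ∀ (u : Fin d → ℝ) (a : Fin d → ℂ), xc u = U *ᵥ a → u ⬝ᵥ u = ∑ i, ‖a i‖ ^ 2 := by
    intro u a h
    have h2 := hdot u u
    rw [h, hiso] at h2
    have : star a ⬝ᵥ a = ((∑ i, ‖a i‖ ^ 2 : ℝ) : ℂ) := by
      simp [dotProduct, Complex.conj_mul']
    rw [this] at h2
    exact_mod_cast h2
  have hquad : ∀ x, x ⬝ᵥ (G *ᵥ x) = ∑ i, (b i).re * ‖y x i‖ ^ 2 := by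
    intro x
    have h2 := hdot x (G *ᵥ x)
    have hx : star (xc x) ⬝ᵥ xc (G *ᵥ x) = star (y x) ⬝ᵥ (fun i => b i * y x i) := by
      rw [hGx, Matrix.dotProduct_mulVec]
      congr 1
      simp [y, Matrix.star_mulVec]
    rw [hx] at h2
    have h3 := congrArg Complex.re h2
    rw [Complex.ofReal_re] at h3
    rw [h3, dotProduct, Complex.re_sum]
    refine Finset.sum_congr rfl fun i _ => ?_
    have : star (y x) i * (b i * y x i) = b i * ((‖y x i‖ ^ 2 : ℝ) : ℂ) := by
      have := Complex.conj_mul' (y x i)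
      simp only [Pi.star_apply, RCLike.star_def]
      push_cast
      rw [← this]; ring
    rw [this, Complex.re_mul_ofReal]
  have hb : ∀ i, 0 ≤ (b i).re ∧ (0 < |(b i).im| → 0 < (b i).re) := fun i =>
    h1 _ (mem_spectrum_of_unitary_diagonalization hU hG i)
  refine ⟨?_, ?_⟩
  · have hS : ∀ i, 0 ≤ ‖b i‖ ^ 2 / (b i).re := fun i => div_nonneg (sq_nonneg _) (hb i).1
    have hS' : (0 : ℝ) < 1 + ∑ i, ‖b i‖ ^ 2 / (b i).re := by
      have := Finset.sum_nonneg fun i (_ : i ∈ Finset.univ) => hS i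
      linarith
    refine ⟨1 / (1 + ∑ i, ‖b i‖ ^ 2 / (b i).re), by positivity, fun x => ?_⟩
    rw [hsq _ _ (hGx x), hquad, Finset.mul_sum]
    refine Finset.sum_le_sum fun i _ => ?_
    rw [norm_mul, mul_pow, ← mul_assoc]
    refine mul_le_mul_of_nonneg_right ?_ (sq_nonneg _)
    rw [div_mul_eq_mul_div, one_mul, div_le_iff₀ hS']
    rcases (hb i).1.eq_or_lt with h0 | h0
    · have him : (b i).im = 0 := by
        by_contra hne
        have := (hb i).2 (abs_pos.2 hne)
        linarith
      have : b i = 0 := Complex.ext h0.symm him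
      simp [this]
    · have h4 : ‖b i‖ ^ 2 / (b i).re ≤ ∑ i, ‖b i‖ ^ 2 / (b i).re :=
        Finset.single_le_sum (fun j _ => hS j) (Finset.mem_univ i)
      have h5 : ‖b i‖ ^ 2 = (b i).re * (‖b i‖ ^ 2 / (b i).re) := by field_simp
      rw [h5]
      exact mul_le_mul_of_nonneg_left (by linarith) h0.le
  · intro x
    rw [hsq _ _ (hGx x), hsq _ _ (hGt x)]
    simp

/-! ### Sylvester and Lyapunov equations -/

section Sylvester

variable {E : Type*} [NormedAddCommGroup E] [InnerProductSpace ℝ E]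

theorem norm_sub_smul_sq_le {A : E →L[ℝ] E} {κ s : ℝ} (hs : 0 ≤ s) {v : E}
    (hv : κ * ‖v‖ ^ 2 ≤ ⟪v, A v⟫_ℝ) :
    ‖v - s • A v‖ ^ 2 ≤ (1 - 2 * s * κ + s ^ 2 * ‖A‖ ^ 2) * ‖v‖ ^ 2 := by
  rw [norm_sub_sq_real, inner_smul_right, norm_smul, mul_pow, Real.norm_eq_abs, sq_abs]
  have h1 : ‖A v‖ ^ 2 ≤ ‖A‖ ^ 2 * ‖v‖ ^ 2 := by
    rw [← mul_pow]; gcongr; exact A.le_opNorm v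
  nlinarith [mul_le_mul_of_nonneg_left hv hs, mul_le_mul_of_nonneg_left h1 (sq_nonneg s)]

/-- The Sylvester equation for bilinear maps is solvable when the coefficient is coercive: a
solution of the homogeneous equation satisfies
`k a b = k ((1 - s A) a) ((1 - s A) b) - s² k (A a) (A b)`, which for small `s` is a strict
contraction in norm. -/
theorem exists_bilinear_sylvester [FiniteDimensional ℝ E] {A : E →L[ℝ] E} {κ : ℝ} (hκ : 0 < κ)
    (hA : ∀ v, κ * ‖v‖ ^ 2 ≤ ⟪v, A v⟫_ℝ) (D : E →L[ℝ] E →L[ℝ] E) :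
    ∃ k : E →L[ℝ] E →L[ℝ] E, ∀ a b, k a (A b) + k (A a) b = D a b := by
  let S : (E →L[ℝ] E →L[ℝ] E) →ₗ[ℝ] (E →L[ℝ] E →L[ℝ] E) :=
    { toFun := fun k => k.bilinearComp (ContinuousLinearMap.id ℝ E) A
        + k.bilinearComp A (ContinuousLinearMap.id ℝ E)
      map_add' := by intro k l; ext a b; simp; abel
      map_smul' := by intro r k; ext a b; simp }
  have hS : ∀ k a b, S k a b = k a (A b) + k (A a) b := by intro k a b; simp [S]
  have hinj : Function.Injective S := by
    rw [injective_iff_map_eq_zero]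
    intro k hk
    have hk' : ∀ a b, k a (A b) + k (A a) b = 0 := by intro a b; rw [← hS, hk]; simp
    set N := ‖A‖ ^ 2 with hN
    have hN0 : 0 ≤ N := sq_nonneg _
    set s := κ / (2 * N + 1 + κ ^ 2) with hs
    have hs0 : 0 < s := by positivity
    have hsN : s * (2 * N + 1 + κ ^ 2) = κ := by rw [hs]; field_simp
    set q := 1 - 2 * s * κ + s ^ 2 * N with hq
    have hq1 : q + s ^ 2 * N < 1 := by
      have : s * (2 * N) < 2 * κ := by nlinarith [sq_nonneg κ]
      nlinarith
    have hqv : ∀ v, ‖v - s • A v‖ ^ 2 ≤ q * ‖v‖ ^ 2 := fun v => norm_sub_smul_sq_le hs0.le (hA v)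
    have hbound : ∀ a b, ‖k a b‖ ≤ (q + s ^ 2 * N) * ‖k‖ * (‖a‖ * ‖b‖) := by
      intro a b
      have hid : k a b = k (a - s • A a) (b - s • A b) - s ^ 2 • k (A a) (A b) := by
        have := hk' a b
        have h3 : k (a - s • A a) (b - s • A b) = k a b - s • (k a (A b) + k (A a) b)
            + s ^ 2 • k (A a) (A b) := by
          simp only [map_sub, map_smul, _root_.sub_apply,
            _root_.smul_apply, smul_sub, smul_add, smul_smul, pow_two]
          abel
        rw [h3, this]; simp
      have h4 : ‖k (a - s • A a) (b - s • A b)‖ ≤ ‖k‖ * (q * (‖a‖ * ‖b‖)) := by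
        refine (k.le_opNorm₂ _ _).trans ?_
        rw [mul_assoc]
        refine mul_le_mul_of_nonneg_left ?_ (norm_nonneg k)
        by_cases ha : ‖a‖ = 0
        · have : a = 0 := norm_eq_zero.1 ha
          simp [this]
        have hq0 : 0 ≤ q := by
          have := (sq_nonneg _).trans (hqv a)
          exact nonneg_of_mul_nonneg_left this (by positivity)
        refine (abs_le_of_sq_le_sq' (b := q * (‖a‖ * ‖b‖)) ?_ (by positivity)).2
        have := mul_le_mul (hqv a) (hqv b) (sq_nonneg _) (by positivity)
        calc (‖a - s • A a‖ * ‖b - s • A b‖) ^ 2 = ‖a - s • A a‖ ^ 2 * ‖b - s • A b‖ ^ 2 := by ring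
          _ ≤ _ := this
          _ = _ := by ring
      have h5 : ‖s ^ 2 • k (A a) (A b)‖ ≤ s ^ 2 * (‖k‖ * (N * (‖a‖ * ‖b‖))) := by
        rw [norm_smul, Real.norm_of_nonneg (sq_nonneg s)]
        refine mul_le_mul_of_nonneg_left ?_ (sq_nonneg s)
        refine (k.le_opNorm₂ _ _).trans ?_
        calc ‖k‖ * ‖A a‖ * ‖A b‖ ≤ ‖k‖ * (‖A‖ * ‖a‖) * (‖A‖ * ‖b‖) := by
              gcongr <;> exact A.le_opNorm _
          _ = _ := by rw [hN]; ring
      rw [hid]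
      refine (norm_sub_le _ _).trans ((add_le_add h4 h5).trans_eq (by ring))
    have hk0 : 0 ≤ ‖k‖ := norm_nonneg k
    by_contra hne
    have hpos : 0 < ‖k‖ := hk0.lt_of_ne' fun h => hne (k.opNorm_zero_iff.1 h)
    -- replace the factor by its positive part, so that it is a legitimate norm bound
    have hle : ‖k‖ ≤ max (q + s ^ 2 * N) 0 * ‖k‖ := by
      refine k.opNorm_le_bound₂ (by positivity) fun a b => ?_
      refine (hbound a b).trans ?_
      rw [mul_assoc _ ‖a‖]
      gcongr
      exact le_max_left _ _
    have : max (q + s ^ 2 * N) 0 < 1 := max_lt hq1 one_pos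
    nlinarith
  obtain ⟨k, hk⟩ := (LinearMap.injective_iff_surjective.1 hinj) D
  exact ⟨k, fun a b => by rw [← hS, hk]⟩

/-- Discrete Lyapunov equations with a coercive generator have solutions bounded uniformly in the
step size. -/
theorem norm_le_of_discrete_lyapunov [CompleteSpace E] {G P Z S : E →L[ℝ] E} {κ η : ℝ}
    (hη : 0 < η) (hηG : η * ‖G‖ ^ 2 ≤ κ) (hηκ : η * κ ≤ 1)
    (hPn : ∀ x, ‖x - P x‖ ≤ ‖x‖) (hGP : ∀ x, G (P x) = 0)
    (hG : ∀ v, κ * ‖v - P v‖ ^ 2 ≤ ⟪v - P v, G (v - P v)⟫_ℝ)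
    (hPZ : P * Z = 0) (hZP : Z * star P = 0)
    (hZ : Z = (1 - η • G) * Z * star (1 - η • G) + η • S) :
    κ * ‖Z‖ ≤ ‖S‖ := by
  set T : E →L[ℝ] E := (1 - η • G) - P with hT
  have hGP' : G * P = 0 := by ext x; simp [hGP]
  have hZ' : Z = T * Z * star T + η • S := by
    have h1 : (1 - η • G) * Z = T * Z := by rw [hT, sub_mul _ P, hPZ, sub_zero]
    have h2 : Z * star (1 - η • G) = Z * star T := by
      rw [hT, star_sub _ P, mul_sub, hZP, sub_zero]
    rw [← h1, mul_assoc, ← h2, ← mul_assoc]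
    exact hZ
  have hq0 : ∀ x, ‖T x‖ ^ 2 ≤ (1 - η * κ) * ‖x - P x‖ ^ 2 := by
    intro x
    have hTx : T x = (x - P x) - η • G (x - P x) := by
      simp [hT, hGP]; abel
    have h := norm_sub_smul_sq_le hη.le (hG x)
    rw [hTx]
    refine h.trans ?_
    gcongr
    nlinarith
  have hTn : ‖T‖ ^ 2 ≤ max (1 - η * κ) 0 := by
    have : ‖T‖ ≤ √(max (1 - η * κ) 0) := by
      refine T.opNorm_le_bound (Real.sqrt_nonneg _) fun x => ?_
      refine abs_le_of_sq_le_sq' ?_ (by positivity) |>.2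
      rw [mul_pow, Real.sq_sqrt (le_max_right _ _)]
      refine (hq0 x).trans ?_
      exact mul_le_mul (le_max_left _ _) (by gcongr; exact hPn x) (by positivity) (le_max_right _ _)
    calc ‖T‖ ^ 2 ≤ (√(max (1 - η * κ) 0)) ^ 2 := by gcongr
      _ = _ := Real.sq_sqrt (le_max_right _ _)
  have hle : ‖Z‖ ≤ ‖T‖ ^ 2 * ‖Z‖ + η * ‖S‖ := by
    calc ‖Z‖ = ‖T * Z * star T + η • S‖ := by rw [← hZ']
      _ ≤ ‖T * Z * star T‖ + ‖η • S‖ := norm_add_le _ _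
      _ ≤ ‖T‖ * ‖Z‖ * ‖star T‖ + η * ‖S‖ := by
          gcongr
          · exact (norm_mul_le _ _).trans (by gcongr; exact norm_mul_le _ _)
          · rw [norm_smul, Real.norm_of_nonneg hη.le]
      _ = _ := by
          rw [ContinuousLinearMap.star_eq_adjoint, LinearIsometryEquiv.norm_map]; ring
  have hZ0 := norm_nonneg Z
  have hS0 := norm_nonneg S
  rw [max_eq_left (by linarith)] at hTn
  have : ‖Z‖ ≤ (1 - η * κ) * ‖Z‖ + η * ‖S‖ := hle.trans (by gcongr)
  have h3 : η * (κ * ‖Z‖) ≤ η * ‖S‖ := by nlinarith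
  exact le_of_mul_le_mul_left h3 hη

end Sylvester

/-! ### Slow-fast coordinates and their one-step expansion -/

section SlowFast

variable {E : Type*} [NormedAddCommGroup E] [InnerProductSpace ℝ E]

/-- Slow-fast coordinates for a vector field `g` near its zero `0`, linear part `G`, and a
projection `P` onto the directions not contracted by `G`.  The fast coordinate `y` vanishes exactly
on the zero set of `g`, and `x ↦ P x - c x (y x)` is conserved by the drift `-g` up to terms
quadratic in `y` (field `slow`).  The bilinear map `k` solves a Sylvester equation whose right side
is the derivative `D` of `c` at `0`.  The coordinates are defined globally, but are related to `g`
only on the ball of radius `r`; the constant `C` bounds everything in sight. -/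
structure SlowFastForm (P G : E →L[ℝ] E) (D k : E →L[ℝ] E →L[ℝ] E) (g y : E → E)
    (c : E → E →L[ℝ] E) (r C : ℝ) : Prop where
  one_le : 1 ≤ C
  r_pos : 0 < r
  r_le : r ≤ 1
  norm_P : ‖P‖ ≤ C
  norm_G : ‖G‖ ≤ C
  norm_D : ‖D‖ ≤ C
  norm_k : ‖k‖ ≤ C
  cont_y : Continuous y
  cont_c : Continuous c
  cont_g : Continuous g
  y_taylor : ∀ x h, ‖y (x + h) - y x - fderiv ℝ y x h‖ ≤ C * ‖h‖ ^ 2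
  c_taylor : ∀ x h, ‖c (x + h) - c x - fderiv ℝ c x h‖ ≤ C * ‖h‖ ^ 2
  fderiv_y : ∀ x, ‖fderiv ℝ y x - G‖ ≤ C * ‖x‖
  fderiv_c : ∀ x, ‖fderiv ℝ c x - D‖ ≤ C * ‖x‖
  c_small : ∀ x, ‖c x‖ ≤ C * ‖x‖
  c_bdd : ∀ x, ‖c x‖ ≤ C
  y_small : ∀ x, ‖y x‖ ≤ C * ‖x‖
  lower : ∀ x, ‖x‖ ≤ C * (‖P x‖ + ‖y x‖)
  P_y : ∀ x, P (y x) = 0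
  g_near : ∀ x, ‖x‖ < r → ‖g x - y x‖ ≤ C * ‖x‖ * ‖y x‖
  slow : ∀ x, ‖x‖ < r → c x (fderiv ℝ y x (g x)) = P (g x)
  sylvester : ∀ a b, P a = 0 → P b = 0 → k a (G b) + k (G a) b = D a b

/-- The slow coordinate: the quadratic term `k (y x) (y x)` removes the part of the slow drift that
is quadratic in the fast coordinate. -/
noncomputable def slowCoord (P : E →L[ℝ] E) (k : E →L[ℝ] E →L[ℝ] E) (y : E → E)
    (c : E → E →L[ℝ] E) (x : E) : E :=
  P x - c x (y x) + k (y x) (y x)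

/-- The coefficient of the noise in the increment of the slow coordinate. -/
noncomputable def slowNoise (k : E →L[ℝ] E →L[ℝ] E) (y : E → E) (c : E → E →L[ℝ] E)
    (x : E) : E →L[ℝ] E :=
  k (y x) ∘L fderiv ℝ y x + k.flip (y x) ∘L fderiv ℝ y x - c x ∘L fderiv ℝ y x
    - (fderiv ℝ c x).flip (y x)

/-- The second-order effect of the noise on the slow coordinate, a quadratic form in the noise. -/
noncomputable def noiseForm (G : E →L[ℝ] E) (D k : E →L[ℝ] E →L[ℝ] E) : E →L[ℝ] E →L[ℝ] E :=
  k.bilinearComp G G - D.bilinearComp (ContinuousLinearMap.id ℝ E) G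

theorem norm_apply₂_le {F : E →L[ℝ] E →L[ℝ] E} {a b : E} {K α β : ℝ} (hK : ‖F‖ ≤ K)
    (ha : ‖a‖ ≤ α) (hb : ‖b‖ ≤ β) : ‖F a b‖ ≤ K * α * β := by
  have hα := (norm_nonneg _).trans ha
  have hK0 := (norm_nonneg F).trans hK
  exact (F.le_opNorm₂ a b).trans (by gcongr)

theorem norm_apply_le {A : E →L[ℝ] E} {a : E} {K α : ℝ} (hK : ‖A‖ ≤ K) (ha : ‖a‖ ≤ α) :
    ‖A a‖ ≤ K * α := by
  have hK0 := (norm_nonneg A).trans hK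
  exact (A.le_opNorm a).trans (by gcongr)

namespace SlowFastForm

variable {P G : E →L[ℝ] E} {D k : E →L[ℝ] E →L[ℝ] E} {g y : E → E}
  {c : E → E →L[ℝ] E} {r C : ℝ}

theorem norm_fderiv_y (H : SlowFastForm P G D k g y c r C) {x : E} (hx : ‖x‖ < r) :
    ‖fderiv ℝ y x‖ ≤ 2 * C := by
  have h1 := H.fderiv_y x
  have h2 := H.norm_G
  have h3 : C * ‖x‖ ≤ C * 1 := by
    have := H.one_le; have := H.r_le; gcongr; linarith
  calc ‖fderiv ℝ y x‖ = ‖(fderiv ℝ y x - G) + G‖ := by rw [sub_add_cancel]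
    _ ≤ _ := norm_add_le _ _
    _ ≤ _ := by linarith

theorem norm_fderiv_c (H : SlowFastForm P G D k g y c r C) {x : E} (hx : ‖x‖ < r) :
    ‖fderiv ℝ c x‖ ≤ 2 * C := by
  have h1 := H.fderiv_c x
  have h2 := H.norm_D
  have h3 : C * ‖x‖ ≤ C * 1 := by
    have := H.one_le; have := H.r_le; gcongr; linarith
  calc ‖fderiv ℝ c x‖ = ‖(fderiv ℝ c x - D) + D‖ := by rw [sub_add_cancel]
    _ ≤ ‖fderiv ℝ c x - D‖ + ‖D‖ := ContinuousLinearMap.opNorm_add_le _ _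
    _ ≤ _ := by linarith

theorem norm_g (H : SlowFastForm P G D k g y c r C) {x : E} (hx : ‖x‖ < r) :
    ‖g x‖ ≤ 2 * C * ‖y x‖ := by
  have h1 := H.g_near x hx
  have h3 : C * ‖x‖ * ‖y x‖ ≤ C * 1 * ‖y x‖ := by
    have := H.one_le; have := H.r_le; gcongr; linarith
  have h4 := H.one_le
  have h5 := norm_nonneg (y x)
  calc ‖g x‖ = ‖(g x - y x) + y x‖ := by rw [sub_add_cancel]
    _ ≤ _ := norm_add_le _ _
    _ ≤ _ := by nlinarith

theorem norm_step (H : SlowFastForm P G D k g y c r C) {x : E} (hx : ‖x‖ < r) (e : E) :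
    ‖e - g x‖ ≤ 2 * C ^ 2 * (1 + ‖e‖) := by
  have h1 := H.norm_g hx
  have h2 := H.y_small x
  have h3 := H.one_le
  have h4 := H.r_le
  have h5 : ‖y x‖ ≤ C := h2.trans (by nlinarith [norm_nonneg x])
  have h6 : ‖g x‖ ≤ 2 * C * C := h1.trans (by gcongr)
  have h7 : ‖e‖ ≤ 2 * C ^ 2 * ‖e‖ := by
    have : 1 ≤ 2 * C ^ 2 := by nlinarith
    exact le_mul_of_one_le_left (norm_nonneg e) this
  calc ‖e - g x‖ ≤ ‖e‖ + ‖g x‖ := norm_sub_le _ _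
    _ ≤ _ := by nlinarith

/-- First-order expansion of the fast coordinate along one step. -/
theorem y_step (H : SlowFastForm P G D k g y c r C) {x : E} (hx : ‖x‖ < r) (e : E) {η : ℝ} :
    ‖y (x + η • (e - g x)) - y x - η • fderiv ℝ y x (e - g x)‖
      ≤ 4 * C ^ 5 * (η ^ 2 * (1 + ‖e‖) ^ 2) := by
  have h := H.y_taylor x (η • (e - g x))
  rw [map_smul, norm_smul, mul_pow, Real.norm_eq_abs, sq_abs] at h
  refine h.trans ?_
  have h1 := H.norm_step hx e
  have := H.one_le
  calc C * (η ^ 2 * ‖e - g x‖ ^ 2) ≤ C * (η ^ 2 * (2 * C ^ 2 * (1 + ‖e‖)) ^ 2) := by gcongr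
    _ = _ := by ring

theorem y_increment (H : SlowFastForm P G D k g y c r C) {x : E} (hx : ‖x‖ < r) (e : E) {η : ℝ}
    (hη : 0 < η) (hη1 : η ≤ 1) :
    ‖y (x + η • (e - g x)) - y x‖ ≤ 8 * C ^ 5 * (η * (1 + ‖e‖) ^ 2) := by
  have h := H.y_step hx e (η := η)
  have hC := H.one_le
  have hw : 1 ≤ 1 + ‖e‖ := by linarith [norm_nonneg e]
  have h2 : ‖η • fderiv ℝ y x (e - g x)‖ ≤ 4 * C ^ 5 * (η * (1 + ‖e‖) ^ 2) := by
    rw [norm_smul, Real.norm_of_nonneg hη.le]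
    have h3 := norm_apply_le (H.norm_fderiv_y hx) (H.norm_step hx e)
    calc η * ‖fderiv ℝ y x (e - g x)‖ ≤ η * (2 * C * (2 * C ^ 2 * (1 + ‖e‖))) := by gcongr
      _ = 4 * C ^ 3 * (η * (1 + ‖e‖) ^ 1) := by ring
      _ ≤ _ := by gcongr <;> norm_num
  have h4 : 4 * C ^ 5 * (η ^ 2 * (1 + ‖e‖) ^ 2) ≤ 4 * C ^ 5 * (η * (1 + ‖e‖) ^ 2) := by
    gcongr; nlinarith
  calc _ = ‖(y (x + η • (e - g x)) - y x - η • fderiv ℝ y x (e - g x))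
        + η • fderiv ℝ y x (e - g x)‖ := by rw [sub_add_cancel]
    _ ≤ _ := norm_add_le _ _
    _ ≤ _ := by linarith

/-- Exact algebra of the increment of the slow coordinate: `u` is the increment of `y`, `R` its
second-order remainder and `R'` that of `c`. -/
theorem slow_increment_eq (H : SlowFastForm P G D k g y c r C) {x : E} (hx : ‖x‖ < r) {e : E}
    (he : P e = 0) (η : ℝ) {u R : E} {R' : E →L[ℝ] E}
    (hu : u = y (x + η • (e - g x)) - y x) (hR : R = u - η • fderiv ℝ y x (e - g x))
    (hR' : R' = c (x + η • (e - g x)) - c x - fderiv ℝ c x (η • (e - g x))) :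
    slowCoord P k y c (x + η • (e - g x)) - slowCoord P k y c x
        - η • slowNoise k y c x e - η ^ 2 • noiseForm G D k e e
      = -(c x R)
        + η • (((fderiv ℝ c x - D) (g x) (y x) + D (g x - y x) (y x))
            - (k (y x) (fderiv ℝ y x (g x) - G (y x)) + k (fderiv ℝ y x (g x) - G (y x)) (y x)))
        - η • (fderiv ℝ c x (e - g x) R)
        - η ^ 2 • ((fderiv ℝ c x - D) (e - g x) (fderiv ℝ y x (e - g x))
            - D (g x) (fderiv ℝ y x (e - g x)) + D e (fderiv ℝ y x (e - g x) - G e))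
        - R' (y (x + η • (e - g x)))
        + (k (y x) R + k R (y x))
        + (k (u - η • G e) u + k (η • G e) (u - η • G e)) := by
  have hs := H.slow x hx
  have hk := H.sylvester (y x) (y x) (H.P_y x) (H.P_y x)
  set B := fderiv ℝ y x
  set A := fderiv ℝ c x
  have hy' : y (x + η • (e - g x)) = y x + u := by rw [hu]; abel
  have hc' : c (x + η • (e - g x)) = c x + η • A (e - g x) + R' := by
    rw [hR', map_smul]; abel
  have hu' : u = η • B (e - g x) + R := by rw [hR]; abel
  have hD : D (y x) (y x) = k (y x) (G (y x)) + k (G (y x)) (y x) := hk.symm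
  simp only [slowCoord, slowNoise, noiseForm, hy', hc']
  simp only [map_add, map_sub, map_smul, _root_.add_apply, _root_.sub_apply, _root_.smul_apply,
    ContinuousLinearMap.comp_apply, ContinuousLinearMap.flip_apply,
    ContinuousLinearMap.bilinearComp_apply, ContinuousLinearMap.id_apply, he, hD, ← hs]
  rw [hu']
  simp only [map_add, map_sub, map_smul, _root_.add_apply, _root_.sub_apply, _root_.smul_apply]
  module

set_option maxHeartbeats 1000000 in
/-- One step of the slow coordinate, up to its centred noise term and its second-order noise term.
The first error term is a drift, the others are higher-order effects of the noise. -/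
theorem norm_slow_increment_le (H : SlowFastForm P G D k g y c r C) {x : E} (hx : ‖x‖ < r) {e : E}
    (he : P e = 0) {η : ℝ} (hη : 0 < η) (hη1 : η ≤ 1) :
    ‖slowCoord P k y c (x + η • (e - g x)) - slowCoord P k y c x
        - η • slowNoise k y c x e - η ^ 2 • noiseForm G D k e e‖
      ≤ 400 * C ^ 12 * ((η * ‖x‖ * ‖y x‖ ^ 2 + η ^ 2 * ‖x‖ + η ^ 3) * (1 + ‖e‖) ^ 4) := by
  have hC := H.one_le
  have hC0 : 0 ≤ C := by linarith
  rw [H.slow_increment_eq hx he η rfl rfl rfl]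
  have hB := H.norm_fderiv_y hx
  have hA := H.norm_fderiv_c hx
  have hBG := H.fderiv_y x
  have hAD := H.fderiv_c x
  have hg := H.norm_g hx
  have hgy := H.g_near x hx
  have hh := H.norm_step hx e
  have hR := H.y_step hx e (η := η)
  have hu := H.y_increment hx e hη hη1
  have hy := H.y_small x
  have hR' := H.c_taylor x (η • (e - g x))
  have hcx := H.c_small x
  have hnD := H.norm_D
  have hnk := H.norm_k
  have hnG := H.norm_G
  set B := fderiv ℝ y x
  set A := fderiv ℝ c x
  set y' := y (x + η • (e - g x)) with hy'
  set R := y' - y x - η • B (e - g x)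
  set R' := c (x + η • (e - g x)) - c x - A (η • (e - g x))
  set h := e - g x with hh'
  set w := 1 + ‖e‖ with hw
  set s := ‖x‖ with hs
  set b := ‖y x‖ with hb
  have hs0 : 0 ≤ s := norm_nonneg _
  have hb0 : 0 ≤ b := norm_nonneg _
  have hw1 : 1 ≤ w := by have := norm_nonneg e; linarith
  have hs1 : s ≤ 1 := hx.le.trans H.r_le
  have hew : ‖e‖ ≤ w := by linarith
  have hgs : ‖g x‖ ≤ 2 * C ^ 2 * s := hg.trans (by nlinarith)
  have hR'n : ‖R'‖ ≤ 4 * C ^ 5 * (η ^ 2 * w ^ 2) := by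
    refine hR'.trans ?_
    rw [norm_smul, Real.norm_of_nonneg hη.le]
    calc C * (η * ‖h‖) ^ 2 ≤ C * (η * (2 * C ^ 2 * w)) ^ 2 := by gcongr
      _ = _ := by ring
  have hy'n : ‖y'‖ ≤ C * s + 8 * C ^ 5 * (η * w ^ 2) := by
    calc ‖y'‖ = ‖(y' - y x) + y x‖ := by rw [sub_add_cancel]
      _ ≤ _ := norm_add_le _ _
      _ ≤ _ := by linarith
  have hBh : ‖B h‖ ≤ 2 * C * (2 * C ^ 2 * w) := norm_apply_le hB hh
  have hBg : ‖B (g x) - G (y x)‖ ≤ 3 * C ^ 2 * (s * b) := by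
    have e1 : B (g x) - G (y x) = (B - G) (g x) + G (g x - y x) := by
      simp
    rw [e1]
    refine (norm_add_le _ _).trans ?_
    refine (add_le_add (norm_apply_le hBG hg) (norm_apply_le hnG hgy)).trans_eq ?_
    ring
  have hBe : ‖B h - G e‖ ≤ 4 * C ^ 3 * (s * w) := by
    have e1 : B h - G e = (B - G) h - G (g x) := by
      simp [hh']; abel
    rw [e1]
    refine (norm_sub_le _ _).trans ?_
    refine (add_le_add (norm_apply_le hBG hh) (norm_apply_le hnG hgs)).trans ?_
    have : 2 * C ^ 3 * s * 1 ≤ 2 * C ^ 3 * s * w := by gcongr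
    nlinarith
  have huG : ‖y' - y x - η • G e‖ ≤ 8 * C ^ 5 * (η * s * w ^ 2 + η ^ 2 * w ^ 2) := by
    have e1 : y' - y x - η • G e = R + η • (B h - G e) := by
      simp only [R]; module
    rw [e1]
    refine (norm_add_le _ _).trans ?_
    rw [norm_smul, Real.norm_of_nonneg hη.le]
    have h1 : η * ‖B h - G e‖ ≤ 8 * C ^ 5 * (η * s * w ^ 2) := by
      calc η * ‖B h - G e‖ ≤ η * (4 * C ^ 3 * (s * w)) := by gcongr
        _ = 4 * C ^ 3 * (η * s * w ^ 1) := by ring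
        _ ≤ _ := by gcongr <;> norm_num
    have h2 : ‖R‖ ≤ 8 * C ^ 5 * (η ^ 2 * w ^ 2) := hR.trans (by gcongr; norm_num)
    linarith
  have hGe : ‖η • G e‖ ≤ η * (C * w) := by
    rw [norm_smul, Real.norm_of_nonneg hη.le]
    gcongr; exact norm_apply_le hnG hew
  set Q := (η * s * b ^ 2 + η ^ 2 * s + η ^ 3) * w ^ 4 with hQ
  have q1 : η * s * b ^ 2 ≤ Q := by
    calc η * s * b ^ 2 = (η * s * b ^ 2 + 0 + 0) * 1 := by ring
      _ ≤ Q := by rw [hQ]; gcongr <;> first | positivity | exact one_le_pow₀ hw1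
  have q2 : ∀ j ≤ 4, η ^ 2 * s * w ^ j ≤ Q := by
    intro j hj
    calc η ^ 2 * s * w ^ j = (0 + η ^ 2 * s + 0) * w ^ j := by ring
      _ ≤ Q := by rw [hQ]; gcongr <;> positivity
  have q3 : ∀ j ≤ 4, η ^ 3 * w ^ j ≤ Q := by
    intro j hj
    calc η ^ 3 * w ^ j = (0 + 0 + η ^ 3) * w ^ j := by ring
      _ ≤ Q := by rw [hQ]; gcongr <;> positivity
  have hQ0 : 0 ≤ Q := by positivity
  have hpow : ∀ {m j : ℕ}, m ≤ j → C ^ m ≤ C ^ j := fun h => pow_le_pow_right₀ hC h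
  have t1 : ‖-(c x R)‖ ≤ 4 * C ^ 12 * Q := by
    rw [norm_neg]
    calc ‖c x R‖ ≤ C * s * (4 * C ^ 5 * (η ^ 2 * w ^ 2)) := norm_apply_le hcx hR
      _ = 4 * C ^ 6 * (η ^ 2 * s * w ^ 2) := by ring
      _ ≤ _ := by gcongr; exacts [by norm_num, q2 2 (by norm_num)]
  have t2 : ‖η • (((A - D) (g x) (y x) + D (g x - y x) (y x))
      - (k (y x) (B (g x) - G (y x)) + k (B (g x) - G (y x)) (y x)))‖ ≤ 9 * C ^ 12 * Q := by
    rw [norm_smul, Real.norm_of_nonneg hη.le]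
    have e1 := norm_apply₂_le hAD hg (le_refl b)
    have e2 := norm_apply₂_le hnD hgy (le_refl b)
    have e3 := norm_apply₂_le hnk (le_refl b) hBg
    have e4 := norm_apply₂_le hnk hBg (le_refl b)
    calc _ ≤ η * (((C * s * (2 * C * b) * b) + C * (C * s * b) * b)
          + (C * b * (3 * C ^ 2 * (s * b)) + C * (3 * C ^ 2 * (s * b)) * b)) := by
            gcongr
            refine (norm_sub_le _ _).trans (add_le_add ?_ ?_)
            · exact (norm_add_le _ _).trans (add_le_add e1 e2)
            · exact (norm_add_le _ _).trans (add_le_add e3 e4)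
      _ = 3 * C ^ 2 * (η * s * b ^ 2) + 6 * C ^ 3 * (η * s * b ^ 2) := by ring
      _ ≤ 3 * C ^ 12 * Q + 6 * C ^ 12 * Q := by
          gcongr <;> first | exact hC | norm_num
      _ = _ := by ring
  have t3 : ‖η • (A h R)‖ ≤ 16 * C ^ 12 * Q := by
    rw [norm_smul, Real.norm_of_nonneg hη.le]
    calc _ ≤ η * (2 * C * (2 * C ^ 2 * w) * (4 * C ^ 5 * (η ^ 2 * w ^ 2))) := by
            gcongr; exact norm_apply₂_le hA hh hR
      _ = 16 * C ^ 8 * (η ^ 3 * w ^ 3) := by ring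
      _ ≤ _ := by gcongr; exacts [by norm_num, q3 3 (by norm_num)]
  have t4 : ‖η ^ 2 • ((A - D) h (B h) - D (g x) (B h) + D e (B h - G e))‖ ≤ 20 * C ^ 12 * Q := by
    rw [norm_smul, Real.norm_of_nonneg (sq_nonneg η)]
    have e1 := norm_apply₂_le hAD hh hBh
    have e2 := norm_apply₂_le hnD hgs hBh
    have e3 := norm_apply₂_le hnD hew hBe
    calc _ ≤ η ^ 2 * ((C * s * (2 * C ^ 2 * w) * (2 * C * (2 * C ^ 2 * w))
          + C * (2 * C ^ 2 * s) * (2 * C * (2 * C ^ 2 * w))) + C * w * (4 * C ^ 3 * (s * w))) := by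
            gcongr
            refine (norm_add_le _ _).trans (add_le_add ?_ e3)
            exact (norm_sub_le _ _).trans (add_le_add e1 e2)
      _ = 8 * C ^ 6 * (η ^ 2 * s * w ^ 2) + 8 * C ^ 6 * (η ^ 2 * s * w ^ 1)
          + 4 * C ^ 4 * (η ^ 2 * s * w ^ 2) := by ring
      _ ≤ 8 * C ^ 12 * Q + 8 * C ^ 12 * Q + 4 * C ^ 12 * Q := by
          have := q2 1 (by norm_num)
          have := q2 2 (by norm_num)
          gcongr 8 * ?_ * ?_ + 8 * ?_ * ?_ + 4 * ?_ * ?_ <;> apply hpow <;> norm_num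
      _ = _ := by ring
  have t5 : ‖R' y'‖ ≤ 36 * C ^ 12 * Q := by
    calc ‖R' y'‖ ≤ 4 * C ^ 5 * (η ^ 2 * w ^ 2) * (C * s + 8 * C ^ 5 * (η * w ^ 2)) :=
            norm_apply_le hR'n hy'n
      _ = 4 * C ^ 6 * (η ^ 2 * s * w ^ 2) + 32 * C ^ 10 * (η ^ 3 * w ^ 4) := by ring
      _ ≤ 4 * C ^ 12 * Q + 32 * C ^ 12 * Q := by
          have := q2 2 (by norm_num)
          have := q3 4 (by norm_num)
          gcongr 4 * ?_ * ?_ + 32 * ?_ * ?_ <;> apply hpow <;> norm_num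
      _ = _ := by ring
  have t6 : ‖k (y x) R + k R (y x)‖ ≤ 8 * C ^ 12 * Q := by
    have e1 := norm_apply₂_le hnk hy hR
    have e2 := norm_apply₂_le hnk hR hy
    refine ((norm_add_le _ _).trans (add_le_add e1 e2)).trans ?_
    calc _ = 8 * C ^ 7 * (η ^ 2 * s * w ^ 2) := by ring
      _ ≤ _ := by gcongr; exacts [by norm_num, q2 2 (by norm_num)]
  have t7 : ‖k (y' - y x - η • G e) (y' - y x) + k (η • G e) (y' - y x - η • G e)‖
      ≤ 144 * C ^ 12 * Q := by
    have e1 := norm_apply₂_le hnk huG hu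
    have e2 := norm_apply₂_le hnk hGe huG
    refine ((norm_add_le _ _).trans (add_le_add e1 e2)).trans ?_
    calc _ = 64 * C ^ 11 * (η ^ 2 * s * w ^ 4 + η ^ 3 * w ^ 4)
            + 8 * C ^ 7 * (η ^ 2 * s * w ^ 3 + η ^ 3 * w ^ 3) := by ring
      _ ≤ 64 * C ^ 12 * (Q + Q) + 8 * C ^ 12 * (Q + Q) := by
          have := q2 4 (by norm_num)
          have := q3 4 (by norm_num)
          have := q2 3 (by norm_num)
          have := q3 3 (by norm_num)
          gcongr 64 * ?_ * (?_ + ?_) + 8 * ?_ * (?_ + ?_) <;> apply hpow <;> norm_num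
      _ = _ := by ring
  have hfin : 0 ≤ C ^ 12 * Q := by positivity
  refine (norm_add_le _ _).trans ((add_le_add ((norm_add_le _ _).trans (add_le_add
    ((norm_sub_le _ _).trans (add_le_add ((norm_sub_le _ _).trans (add_le_add
    ((norm_sub_le _ _).trans (add_le_add ((norm_add_le _ _).trans (add_le_add t1 t2)) t3)) t4)) t5))
    t6)) t7).trans ?_)
  linarith

end SlowFastForm
end SlowFast

/-! ### One-step bounds for the squared coordinates -/

section SlowFast

variable {E : Type*} [NormedAddCommGroup E] [InnerProductSpace ℝ E]

namespace SlowFastForm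

variable {P G : E →L[ℝ] E} {D k : E →L[ℝ] E →L[ℝ] E} {g y : E → E}
  {c : E → E →L[ℝ] E} {r C : ℝ}

theorem norm_slowNoise_le (H : SlowFastForm P G D k g y c r C) {x : E} (hx : ‖x‖ < r) (e : E) :
    ‖slowNoise k y c x e‖ ≤ 8 * C ^ 3 * (‖x‖ * ‖e‖) := by
  have hC := H.one_le
  have hBe := norm_apply_le (H.norm_fderiv_y hx) (le_refl ‖e‖)
  have e1 := norm_apply₂_le H.norm_k (H.y_small x) hBe
  have e2 := norm_apply₂_le H.norm_k hBe (H.y_small x)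
  have e3 := norm_apply_le (H.c_small x) hBe
  have e4 := norm_apply₂_le (H.norm_fderiv_c hx) (le_refl ‖e‖) (H.y_small x)
  have : slowNoise k y c x e = k (y x) (fderiv ℝ y x e) + k (fderiv ℝ y x e) (y x)
      - c x (fderiv ℝ y x e) - fderiv ℝ c x e (y x) := by
    simp [slowNoise]
  rw [this]
  refine (norm_sub_le _ _).trans ((add_le_add ((norm_sub_le _ _).trans (add_le_add
    ((norm_add_le _ _).trans (add_le_add e1 e2)) e3)) e4).trans ?_)
  have hm : 0 ≤ ‖x‖ * ‖e‖ := by positivity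
  have h2 : C ^ 2 ≤ C ^ 3 := pow_le_pow_right₀ hC (by norm_num)
  calc _ = 4 * C ^ 3 * (‖x‖ * ‖e‖) + 4 * C ^ 2 * (‖x‖ * ‖e‖) := by ring
    _ ≤ 4 * C ^ 3 * (‖x‖ * ‖e‖) + 4 * C ^ 3 * (‖x‖ * ‖e‖) := by gcongr
    _ = _ := by ring

theorem norm_noiseForm_le (H : SlowFastForm P G D k g y c r C) (e : E) :
    ‖noiseForm G D k e e‖ ≤ 2 * C ^ 3 * (1 + ‖e‖) ^ 2 := by
  have hC := H.one_le
  have he := norm_nonneg e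
  have hGe := norm_apply_le H.norm_G (le_refl ‖e‖)
  have e1 := norm_apply₂_le H.norm_k hGe hGe
  have e2 := norm_apply₂_le H.norm_D (le_refl ‖e‖) hGe
  have : noiseForm G D k e e = k (G e) (G e) - D e (G e) := by simp [noiseForm]
  rw [this]
  refine (norm_sub_le _ _).trans ((add_le_add e1 e2).trans ?_)
  have h2 : C ^ 2 ≤ C ^ 3 := pow_le_pow_right₀ hC (by norm_num)
  have h3 : ‖e‖ ^ 2 ≤ (1 + ‖e‖) ^ 2 := by gcongr; linarith
  calc _ = C ^ 3 * ‖e‖ ^ 2 + C ^ 2 * ‖e‖ ^ 2 := by ring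
    _ ≤ C ^ 3 * (1 + ‖e‖) ^ 2 + C ^ 3 * (1 + ‖e‖) ^ 2 := by gcongr
    _ = _ := by ring

/-- The slow and fast coordinates together control the point, also far from the origin. -/
theorem norm_le_coords (H : SlowFastForm P G D k g y c r C) (x : E) :
    ‖x‖ ≤ 3 * C ^ 2 * (‖slowCoord P k y c x‖ + ‖y x‖ + ‖y x‖ ^ 2) := by
  have hC := H.one_le
  have hP : ‖P x‖ ≤ ‖slowCoord P k y c x‖ + C * ‖y x‖ + C * ‖y x‖ * ‖y x‖ := by
    have e1 : P x = slowCoord P k y c x + c x (y x) - k (y x) (y x) := by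
      simp only [slowCoord]; abel
    have e2 := norm_apply_le (H.c_bdd x) (le_refl ‖y x‖)
    have e3 := norm_apply₂_le H.norm_k (le_refl ‖y x‖) (le_refl ‖y x‖)
    calc ‖P x‖ = ‖slowCoord P k y c x + c x (y x) - k (y x) (y x)‖ := by rw [← e1]
      _ ≤ _ := (norm_sub_le _ _).trans (add_le_add ((norm_add_le _ _).trans
          (add_le_add le_rfl e2)) e3)
  refine (H.lower x).trans ?_
  have ha := norm_nonneg (slowCoord P k y c x)
  have hb := norm_nonneg (y x)
  have hC2 : C ≤ C ^ 2 := by nlinarith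
  calc C * (‖P x‖ + ‖y x‖)
      ≤ C * ((‖slowCoord P k y c x‖ + C * ‖y x‖ + C * ‖y x‖ * ‖y x‖) + ‖y x‖) := by gcongr
    _ = C * ‖slowCoord P k y c x‖ + C ^ 2 * ‖y x‖ + C * ‖y x‖ + C ^ 2 * ‖y x‖ ^ 2 := by ring
    _ ≤ C ^ 2 * ‖slowCoord P k y c x‖ + C ^ 2 * ‖y x‖ + C ^ 2 * ‖y x‖ + C ^ 2 * ‖y x‖ ^ 2 := by
        gcongr
    _ ≤ _ := by nlinarith [mul_nonneg (sq_nonneg C) ha, mul_nonneg (sq_nonneg C) hb,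
        mul_nonneg (sq_nonneg C) (sq_nonneg ‖y x‖)]

theorem norm_le_coords_near (H : SlowFastForm P G D k g y c r C) {x : E} (hx : ‖x‖ < r) :
    ‖x‖ ≤ 6 * C ^ 3 * (‖slowCoord P k y c x‖ + ‖y x‖) := by
  have hC := H.one_le
  have h := H.norm_le_coords x
  have ha := norm_nonneg (slowCoord P k y c x)
  have hb := norm_nonneg (y x)
  have hbC : ‖y x‖ ≤ C := (H.y_small x).trans (by nlinarith [H.r_le])
  have hb2 : ‖y x‖ ^ 2 ≤ C * ‖y x‖ := by nlinarith
  calc ‖x‖ ≤ 3 * C ^ 2 * (‖slowCoord P k y c x‖ + ‖y x‖ + ‖y x‖ ^ 2) := h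
    _ ≤ 3 * C ^ 2 * (C * ‖slowCoord P k y c x‖ + C * ‖y x‖ + C * ‖y x‖) := by
        gcongr <;> nlinarith
    _ ≤ _ := by
        have : 0 ≤ C ^ 3 * ‖slowCoord P k y c x‖ := by positivity
        nlinarith

/-- The drift contracts the fast coordinate. -/
theorem fast_contraction (H : SlowFastForm P G D k g y c r C) {κ : ℝ}
    (hκ : ∀ v, P v = 0 → κ * ‖v‖ ^ 2 ≤ ⟪v, G v⟫_ℝ) {x : E} (hx : ‖x‖ < r)
    (hxκ : 6 * C ^ 2 * ‖x‖ ≤ κ) : κ * ‖y x‖ ^ 2 ≤ 2 * ⟪y x, fderiv ℝ y x (g x)⟫_ℝ := by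
  have hC := H.one_le
  have h1 := hκ _ (H.P_y x)
  have h2 : fderiv ℝ y x (g x) = G (y x) + ((fderiv ℝ y x - G) (g x) + G (g x - y x)) := by
    simp
  have h3 : ‖(fderiv ℝ y x - G) (g x) + G (g x - y x)‖ ≤ 3 * C ^ 2 * ‖x‖ * ‖y x‖ := by
    refine ((norm_add_le _ _).trans (add_le_add (norm_apply_le (H.fderiv_y x) (H.norm_g hx))
      (norm_apply_le H.norm_G (H.g_near x hx)))).trans_eq ?_
    ring
  have h4 := neg_le_of_abs_le (abs_real_inner_le_norm (y x)
    ((fderiv ℝ y x - G) (g x) + G (g x - y x)))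
  rw [h2, inner_add_right]
  have h5 : ‖y x‖ * ‖(fderiv ℝ y x - G) (g x) + G (g x - y x)‖
      ≤ ‖y x‖ * (3 * C ^ 2 * ‖x‖ * ‖y x‖) := by gcongr
  have h6 : (6 * C ^ 2 * ‖x‖) * ‖y x‖ ^ 2 ≤ κ * ‖y x‖ ^ 2 := by gcongr
  nlinarith

/-- One step of `‖y‖²`: contraction at rate `κ η`, a centred noise term, and an error `O(η²)`. -/
theorem fast_sq_step (H : SlowFastForm P G D k g y c r C) {κ : ℝ}
    (hκ : ∀ v, P v = 0 → κ * ‖v‖ ^ 2 ≤ ⟪v, G v⟫_ℝ) {x : E} (hx : ‖x‖ < r)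
    (hxκ : 6 * C ^ 2 * ‖x‖ ≤ κ) (e : E) {η : ℝ} (hη : 0 < η) (hη1 : η ≤ 1) :
    ‖y (x + η • (e - g x))‖ ^ 2 ≤ ‖y x‖ ^ 2 - κ * η * ‖y x‖ ^ 2
        + η * (2 * ⟪y x, fderiv ℝ y x e⟫_ℝ) + 72 * C ^ 10 * η ^ 2 * (1 + ‖e‖) ^ 4 ∧
    |‖y (x + η • (e - g x))‖ ^ 2 - ‖y x‖ ^ 2|
      ≤ 80 * C ^ 10 * (η * ‖y x‖ + η ^ 2) * (1 + ‖e‖) ^ 4 := by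
  have hC := H.one_le
  have hcon := H.fast_contraction hκ hx hxκ
  have hR := H.y_step hx e (η := η)
  have hu := H.y_increment hx e hη hη1
  have hbC : ‖y x‖ ≤ C := (H.y_small x).trans (by nlinarith [H.r_le])
  set y' := y (x + η • (e - g x))
  set w := 1 + ‖e‖ with hw
  have hw1 : 1 ≤ w := by have := norm_nonneg e; linarith
  have hw24 : w ^ 2 ≤ w ^ 4 := pow_le_pow_right₀ hw1 (by norm_num)
  set B := fderiv ℝ y x
  have hsq : ‖y'‖ ^ 2 = ‖y x‖ ^ 2 + 2 * ⟪y x, y' - y x⟫_ℝ + ‖y' - y x‖ ^ 2 := by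
    have := norm_add_sq_real (y x) (y' - y x)
    rwa [add_sub_cancel] at this
  have hu2 : ‖y' - y x‖ ^ 2 ≤ 64 * C ^ 10 * η ^ 2 * w ^ 4 := by
    calc ‖y' - y x‖ ^ 2 ≤ (8 * C ^ 5 * (η * w ^ 2)) ^ 2 := by gcongr
      _ = _ := by ring
  constructor
  · have h1 : ⟪y x, y' - y x⟫_ℝ = η * ⟪y x, B e⟫_ℝ - η * ⟪y x, B (g x)⟫_ℝ
        + ⟪y x, y' - y x - η • B (e - g x)⟫_ℝ := by
      simp only [inner_sub_right, inner_smul_right, map_sub]; ring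
    have h2 : ⟪y x, y' - y x - η • B (e - g x)⟫_ℝ ≤ 4 * C ^ 10 * η ^ 2 * w ^ 4 := by
      refine (real_inner_le_norm _ _).trans ?_
      calc _ ≤ C * (4 * C ^ 5 * (η ^ 2 * w ^ 2)) := by gcongr
        _ = 4 * C ^ 6 * η ^ 2 * w ^ 2 := by ring
        _ ≤ _ := by gcongr; norm_num
    rw [hsq, h1]
    nlinarith [mul_le_mul_of_nonneg_left hcon hη.le]
  · have h1 : |⟪y x, y' - y x⟫_ℝ| ≤ 8 * C ^ 10 * (η * ‖y x‖) * w ^ 4 := by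
      refine (abs_real_inner_le_norm _ _).trans ?_
      calc _ ≤ ‖y x‖ * (8 * C ^ 5 * (η * w ^ 2)) := by gcongr
        _ = 8 * C ^ 5 * (η * ‖y x‖) * w ^ 2 := by ring
        _ ≤ _ := by gcongr; norm_num
    have h2 : ‖y'‖ ^ 2 - ‖y x‖ ^ 2 = 2 * ⟪y x, y' - y x⟫_ℝ + ‖y' - y x‖ ^ 2 := by
      rw [hsq]; ring
    rw [h2]
    refine (abs_add_le _ _).trans ?_
    rw [abs_mul, abs_two, abs_of_nonneg (sq_nonneg ‖y' - y x‖)]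
    have : 0 ≤ C ^ 10 * (η * ‖y x‖) * w ^ 4 := by positivity
    have : 0 ≤ C ^ 10 * η ^ 2 * w ^ 4 := by positivity
    nlinarith

set_option maxHeartbeats 1000000 in
/-- One step of `‖z‖²` for the slow coordinate `z`.  The norm of `x` is eliminated in favour of the
sizes `a` and `b` of the two coordinates. -/
theorem slow_sq_step (H : SlowFastForm P G D k g y c r C) :
    ∃ K ≥ 1, ∀ x, ‖x‖ < r → ∀ e, P e = 0 → ∀ η, 0 < η → η ≤ 1 → ∀ a b,
      a = ‖slowCoord P k y c x‖ → b = ‖y x‖ →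
      ‖slowCoord P k y c (x + η • (e - g x))‖ ^ 2 ≤ a ^ 2
        + η * (2 * ⟪slowCoord P k y c x, slowNoise k y c x e⟫_ℝ)
        + 2 * η ^ 2 * ⟪slowCoord P k y c x, noiseForm G D k e e⟫_ℝ
        + K * (η * (a ^ 2 * b ^ 2) + η * b ^ 4 + η ^ 2 * a ^ 2 + η ^ 2 * b ^ 2 + η ^ 3)
          * (1 + ‖e‖) ^ 8 ∧
      |‖slowCoord P k y c (x + η • (e - g x))‖ ^ 2 - a ^ 2|
        ≤ K * (η * (a + b + η) ^ 2) * (1 + ‖e‖) ^ 8 := by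
  have hC := H.one_le
  set A := 400 * C ^ 12 with hA
  have hC12 : 1 ≤ C ^ 12 := one_le_pow₀ hC
  have hA1 : 1 ≤ A := by linarith
  set M := 6 * C ^ 3 with hM
  have hM1 : 1 ≤ M := by have : 1 ≤ C ^ 3 := one_le_pow₀ hC; linarith
  set L := 3 * A * C ^ 2 with hL
  have hC2 : 1 ≤ C ^ 2 := one_le_pow₀ hC
  have hL1 : 1 ≤ L := by nlinarith
  refine ⟨6 * A * M + 4 * L ^ 2 * M ^ 2 + 2 * L * M, by nlinarith, ?_⟩
  intro x hx e he η hη hη1 a b ha hb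
  have hinc := H.norm_slow_increment_le hx he hη hη1
  have hN := H.norm_slowNoise_le hx e
  have hq := H.norm_noiseForm_le e
  have hs := H.norm_le_coords_near hx
  have hbC : ‖y x‖ ≤ C := (H.y_small x).trans (by nlinarith [H.r_le])
  rw [← ha, ← hb] at hs
  rw [← hb] at hinc hbC
  rw [← hA] at hinc
  have ha0 : 0 ≤ a := ha ▸ norm_nonneg _
  have hb0 : 0 ≤ b := hb ▸ norm_nonneg _
  set z := slowCoord P k y c x with hz
  set z' := slowCoord P k y c (x + η • (e - g x))
  set n := slowNoise k y c x e
  set q := noiseForm G D k e e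
  set w := 1 + ‖e‖ with hw
  set s := ‖x‖ with hsx
  have hs0 : 0 ≤ s := norm_nonneg _
  have hw1 : 1 ≤ w := by have := norm_nonneg e; linarith
  have hew : ‖e‖ ≤ w := by linarith
  have hw1' : w ≤ w ^ 4 := le_self_pow₀ hw1 (by norm_num)
  have hw24 : w ^ 2 ≤ w ^ 4 := pow_le_pow_right₀ hw1 (by norm_num)
  have hw48 : w ^ 4 ≤ w ^ 8 := pow_le_pow_right₀ hw1 (by norm_num)
  have hC3 : C ^ 3 ≤ C ^ 12 := pow_le_pow_right₀ hC (by norm_num)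
  have hd : ‖z' - z‖ ≤ L * ((η * s + η ^ 2) * w ^ 4) := by
    have e1 : z' - z = (z' - z - η • n - η ^ 2 • q) + η • n + η ^ 2 • q := by abel
    have e2 : ‖η • n‖ ≤ A / 50 * (η * s * w ^ 4) := by
      rw [norm_smul, Real.norm_of_nonneg hη.le]
      calc η * ‖n‖ ≤ η * (8 * C ^ 3 * (s * w ^ 4)) := by
            gcongr; exact hN.trans (by gcongr; linarith)
        _ = 8 * C ^ 3 * (η * s * w ^ 4) := by ring
        _ ≤ 8 * C ^ 12 * (η * s * w ^ 4) := by gcongr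
        _ = _ := by rw [hA]; ring
    have e3 : ‖η ^ 2 • q‖ ≤ A / 200 * (η ^ 2 * w ^ 4) := by
      rw [norm_smul, Real.norm_of_nonneg (sq_nonneg η)]
      calc η ^ 2 * ‖q‖ ≤ η ^ 2 * (2 * C ^ 12 * w ^ 4) := by
            gcongr; exact hq.trans (by gcongr)
        _ = _ := by rw [hA]; ring
    have e4 : (η * s * b ^ 2 + η ^ 2 * s + η ^ 3) * w ^ 4
        ≤ (2 * C ^ 2 * (η * s) + η ^ 2) * w ^ 4 := by
      have h1 : η * s * b ^ 2 ≤ η * s * C ^ 2 := by gcongr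
      have h2 : η ^ 2 * s ≤ η * s * C ^ 2 := by
        calc η ^ 2 * s = η * s * η := by ring
          _ ≤ η * s * C ^ 2 := by gcongr; linarith
      have h3 : η ^ 3 ≤ η ^ 2 := pow_le_pow_of_le_one hη.le hη1 (by norm_num)
      gcongr; linarith
    rw [e1]
    refine (norm_add₃_le).trans ((add_le_add (add_le_add
      (hinc.trans (mul_le_mul_of_nonneg_left e4 (by linarith))) e2) e3).trans ?_)
    have p1 : 0 ≤ A * (η * s * w ^ 4) := by positivity
    have p2 : 0 ≤ A * (η ^ 2 * w ^ 4) := by positivity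
    have p3 := mul_le_mul_of_nonneg_right hC2 p1
    have p4 := mul_le_mul_of_nonneg_right hC2 p2
    rw [hL]
    linarith only [p1, p2, p3, p4]
  have hd2 : ‖z' - z‖ ≤ L * M * (η * (a + b + η)) * w ^ 4 := by
    refine hd.trans ?_
    calc L * ((η * s + η ^ 2) * w ^ 4) = L * (η * (s + η)) * w ^ 4 := by ring
      _ ≤ L * (η * (M * (a + b) + M * η)) * w ^ 4 := by
          gcongr; exact le_mul_of_one_le_left hη.le hM1
      _ = _ := by ring
  have hd3 : ‖z' - z‖ ^ 2 ≤ L ^ 2 * M ^ 2 * (η ^ 2 * (a + b + η) ^ 2) * w ^ 8 := by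
    calc ‖z' - z‖ ^ 2 ≤ (L * M * (η * (a + b + η)) * w ^ 4) ^ 2 := by gcongr
      _ = _ := by ring
  have hsq : ‖z'‖ ^ 2 = a ^ 2 + 2 * ⟪z, z' - z⟫_ℝ + ‖z' - z‖ ^ 2 := by
    have := norm_add_sq_real z (z' - z)
    rw [add_sub_cancel] at this
    rw [ha]; exact this
  have ht : (a + b + η) ^ 2 ≤ 3 * (a ^ 2 + b ^ 2 + η ^ 2) := by
    linarith only [two_mul_le_add_sq a b, two_mul_le_add_sq a η, two_mul_le_add_sq b η,
      add_sq (a + b) η, add_sq a b]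
  have hη32 : η ^ 3 ≤ η ^ 2 := pow_le_pow_of_le_one hη.le hη1 (by norm_num)
  have hη43 : η ^ 4 ≤ η ^ 3 := pow_le_pow_of_le_one hη.le hη1 (by norm_num)
  constructor
  · set S := η * (a ^ 2 * b ^ 2) + η * b ^ 4 + η ^ 2 * a ^ 2 + η ^ 2 * b ^ 2 + η ^ 3 with hS
    have hS0 : 0 ≤ S := by positivity
    have h1 : ⟪z, z' - z⟫_ℝ = η * ⟪z, n⟫_ℝ + η ^ 2 * ⟪z, q⟫_ℝ
        + ⟪z, z' - z - η • n - η ^ 2 • q⟫_ℝ := by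
      simp only [inner_sub_right, inner_smul_right]; ring
    have h2 : ⟪z, z' - z - η • n - η ^ 2 • q⟫_ℝ ≤ A * (3 * M * S) * w ^ 8 := by
      refine (real_inner_le_norm _ _).trans ?_
      rw [← ha]
      have h3 : a * (η * s * b ^ 2 + η ^ 2 * s + η ^ 3) ≤ 3 * M * S := by
        have j0 : a * (a + b) ≤ 2 * a ^ 2 + b ^ 2 := by
          linarith only [two_mul_le_add_sq a b, sq_nonneg a, sq_nonneg b]
        have i1 : η * (a * s * b ^ 2) ≤ M * (η * (2 * (a ^ 2 * b ^ 2) + b ^ 4)) := by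
          have j1 : a * (a + b) * b ^ 2 ≤ 2 * (a ^ 2 * b ^ 2) + b ^ 4 := by
            calc a * (a + b) * b ^ 2 ≤ (2 * a ^ 2 + b ^ 2) * b ^ 2 := by gcongr
              _ = _ := by ring
          calc η * (a * s * b ^ 2) ≤ η * (a * (M * (a + b)) * b ^ 2) := by gcongr
            _ = M * (η * (a * (a + b) * b ^ 2)) := by ring
            _ ≤ _ := by gcongr
        have i2 : η ^ 2 * (a * s) ≤ M * (η ^ 2 * (2 * a ^ 2 + b ^ 2)) := by
          calc η ^ 2 * (a * s) ≤ η ^ 2 * (a * (M * (a + b))) := by gcongr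
            _ = M * (η ^ 2 * (a * (a + b))) := by ring
            _ ≤ _ := by gcongr
        have i3 : η ^ 3 * a ≤ M * (η ^ 2 * a ^ 2 + η ^ 3) := by
          have j1 : η ^ 3 * a ≤ η ^ 2 * a ^ 2 + η ^ 4 := by
            calc η ^ 3 * a = η ^ 2 * (η * a) := by ring
              _ ≤ η ^ 2 * (a ^ 2 + η ^ 2) := by
                gcongr
                linarith only [two_mul_le_add_sq η a, mul_nonneg hη.le ha0]
              _ = _ := by ring
          calc η ^ 3 * a ≤ 1 * (η ^ 2 * a ^ 2 + η ^ 3) := by linarith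
            _ ≤ _ := by gcongr
        have p1 : 0 ≤ M * (η * b ^ 4) := by positivity
        have p2 : 0 ≤ M * (η ^ 2 * b ^ 2) := by positivity
        have p3 : 0 ≤ M * η ^ 3 := by positivity
        have p4 : 0 ≤ M * (η * (a ^ 2 * b ^ 2)) := by positivity
        have p5 : η ^ 3 * a ≤ M * (η ^ 2 * a ^ 2) + M * η ^ 3 := by rwa [mul_add] at i3
        have p6 : 0 ≤ η ^ 3 := by positivity
        have e1 : a * (η * s * b ^ 2 + η ^ 2 * s + η ^ 3)
            = η * (a * s * b ^ 2) + η ^ 2 * (a * s) + η ^ 3 * a := by ring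
        rw [hS, e1]
        linarith only [i1, i2, p1, p2, p3, p4, p5]
      calc _ ≤ a * (A * ((η * s * b ^ 2 + η ^ 2 * s + η ^ 3) * w ^ 4)) := by gcongr
        _ = A * (a * (η * s * b ^ 2 + η ^ 2 * s + η ^ 3)) * w ^ 4 := by ring
        _ ≤ _ := by gcongr
    have h4 : ‖z' - z‖ ^ 2 ≤ L ^ 2 * M ^ 2 * (3 * S) * w ^ 8 := by
      refine hd3.trans ?_
      gcongr L ^ 2 * M ^ 2 * ?_ * w ^ 8
      have p1 : 0 ≤ η * (a ^ 2 * b ^ 2) := by positivity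
      have p2 : 0 ≤ η * b ^ 4 := by positivity
      have p3 := mul_le_mul_of_nonneg_left ht (sq_nonneg η)
      rw [hS]
      linarith only [p1, p2, p3, hη43]
    have h5 : 0 ≤ (L ^ 2 * M ^ 2 + 2 * L * M) * S * w ^ 8 := by positivity
    rw [hsq, h1]
    linarith only [h2, h4, h5]
  · have h2 : ‖z'‖ ^ 2 - a ^ 2 = 2 * ⟪z, z' - z⟫_ℝ + ‖z' - z‖ ^ 2 := by
      rw [hsq]; ring
    have h3 : |⟪z, z' - z⟫_ℝ| ≤ L * M * (η * (a + b + η) ^ 2) * w ^ 8 := by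
      refine (abs_real_inner_le_norm _ _).trans ?_
      rw [← ha]
      calc _ ≤ (a + b + η) * (L * M * (η * (a + b + η)) * w ^ 4) := by
            gcongr; linarith
        _ = L * M * (η * (a + b + η) ^ 2) * w ^ 4 := by ring
        _ ≤ _ := by gcongr
    have h4 : ‖z' - z‖ ^ 2 ≤ L ^ 2 * M ^ 2 * (η * (a + b + η) ^ 2) * w ^ 8 := by
      refine hd3.trans ?_
      gcongr; exact pow_le_of_le_one hη.le hη1 two_ne_zero
    rw [h2]
    refine (abs_add_le _ _).trans ?_
    rw [abs_mul, abs_two, abs_of_nonneg (sq_nonneg ‖z' - z‖)]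
    have : 0 ≤ (6 * A * M + 3 * L ^ 2 * M ^ 2) * (η * (a + b + η) ^ 2) * w ^ 8 := by positivity
    linarith only [h3, h4, this]

end SlowFastForm
end SlowFast

/-! ### The Lyapunov function -/

/-- Elementary drift bound for the square of `Y = ‖y‖²`; `l` is the centred noise term, `w` stands
for `1 + ‖ε‖`. -/
theorem quartic_drift {Y Y' l b η κ K w : ℝ} (hη : 0 < η) (hη1 : η ≤ 1) (hK : 1 ≤ K)
    (hw : 1 ≤ w) (hY : Y = b ^ 2)
    (h1 : Y' ≤ Y - κ * η * Y + η * l + K * η ^ 2 * w ^ 4)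
    (h2 : |Y' - Y| ≤ K * (η * b + η ^ 2) * w ^ 4) :
    Y' ^ 2 ≤ Y ^ 2 - 2 * κ * η * Y ^ 2 + 2 * η * Y * l
      + 4 * K ^ 2 * (η ^ 2 * Y + η ^ 3) * w ^ 12 := by
  have hY0 : 0 ≤ Y := hY ▸ sq_nonneg b
  have hw8 : w ^ 8 ≤ w ^ 12 := pow_le_pow_right₀ hw (by norm_num)
  have hw4 : w ^ 4 ≤ w ^ 12 := pow_le_pow_right₀ hw (by norm_num)
  have h3 : (Y' - Y) ^ 2 ≤ K ^ 2 * (2 * (η ^ 2 * Y + η ^ 3)) * w ^ 12 := by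
    calc (Y' - Y) ^ 2 = |Y' - Y| ^ 2 := (sq_abs _).symm
      _ ≤ (K * (η * b + η ^ 2) * w ^ 4) ^ 2 := by gcongr
      _ = K ^ 2 * (η * b + η ^ 2) ^ 2 * w ^ 8 := by ring
      _ ≤ _ := by
        have h43 : η ^ 4 ≤ η ^ 3 := pow_le_pow_of_le_one hη.le hη1 (by norm_num)
        have : (η * b + η ^ 2) ^ 2 ≤ 2 * (η ^ 2 * Y + η ^ 3) := by
          rw [hY]
          linarith only [two_mul_le_add_sq (η * b) (η ^ 2), h43, add_sq (η * b) (η ^ 2)]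
        gcongr
  have h4 : 2 * Y * (Y' - Y) ≤ 2 * Y * (-(κ * η * Y) + η * l + K * η ^ 2 * w ^ 4) := by
    gcongr; linarith only [h1]
  have h5 : 2 * Y * (K * η ^ 2 * w ^ 4) ≤ 2 * K ^ 2 * (η ^ 2 * Y) * w ^ 12 := by
    calc 2 * Y * (K * η ^ 2 * w ^ 4) = 2 * K * (η ^ 2 * Y) * w ^ 4 := by ring
      _ ≤ _ := by gcongr; exact le_self_pow₀ hK two_ne_zero
  have h6 : 0 ≤ K ^ 2 * η ^ 3 * w ^ 12 := by positivity
  have h7 : Y' ^ 2 = Y ^ 2 + 2 * Y * (Y' - Y) + (Y' - Y) ^ 2 := by ring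
  rw [h7]
  linarith only [h3, h4, h5, h6]

/-- Elementary drift bound for the product of `Z = ‖z‖²` and `Y = ‖y‖²`; `l` and `l'` are the
centred noise terms and `q` the second-order one.  The error that is only of first order in `η`
carries the small factor `ρ`. -/
theorem product_drift {Y Y' Z Z' l l' q a b η κ K w ρ : ℝ} (hη : 0 < η) (hη1 : η ≤ 1) (hK : 1 ≤ K)
    (hw : 1 ≤ w) (ha : 0 ≤ a) (hb : 0 ≤ b) (hY : Y = b ^ 2) (hZ : Z = a ^ 2)
    (hYρ : Y ≤ ρ) (hb1 : b ≤ 1)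
    (h1 : Y' ≤ Y - κ * η * Y + η * l + K * η ^ 2 * w ^ 4)
    (h2 : |Y' - Y| ≤ K * (η * b + η ^ 2) * w ^ 4)
    (h3 : Z' ≤ Z + η * l' + 2 * η ^ 2 * q
      + K * (η * (Z * Y) + η * Y ^ 2 + η ^ 2 * Z + η ^ 2 * Y + η ^ 3) * w ^ 8)
    (h4 : |Z' - Z| ≤ K * (η * (a + b + η) ^ 2) * w ^ 8) (h5 : q ≤ K * a * w ^ 2) :
    Z' * Y' ≤ Z * Y - κ * η * (Z * Y) + η * Z * l + η * Y * l'
      + ρ * K * (η * (Z * Y) + η * Y ^ 2) * w ^ 12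
      + 10 * K ^ 2 * (η ^ 2 * Z + η ^ 2 * Y + η ^ 3) * w ^ 12 := by
  have hY0 : 0 ≤ Y := hY ▸ sq_nonneg b
  have hZ0 : 0 ≤ Z := hZ ▸ sq_nonneg a
  have hY1 : Y ≤ 1 := by rw [hY]; exact pow_le_one₀ hb hb1
  have hρ : 0 ≤ ρ := hY0.trans hYρ
  have hw8 : w ^ 8 ≤ w ^ 12 := pow_le_pow_right₀ hw (by norm_num)
  have hw4 : w ^ 4 ≤ w ^ 12 := pow_le_pow_right₀ hw (by norm_num)
  have hw2 : w ^ 2 ≤ w ^ 12 := pow_le_pow_right₀ hw (by norm_num)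
  have hKK : K ≤ K ^ 2 := le_self_pow₀ hK two_ne_zero
  have hη43 : η ^ 4 ≤ η ^ 3 := pow_le_pow_of_le_one hη.le hη1 (by norm_num)
  have t1 : Z * (Y' - Y) ≤ -(κ * η * (Z * Y)) + η * Z * l + K ^ 2 * (η ^ 2 * Z) * w ^ 12 := by
    have e1 : Z * (Y' - Y) ≤ Z * (-(κ * η * Y) + η * l + K * η ^ 2 * w ^ 4) := by
      gcongr; linarith only [h1]
    have e2 : Z * (K * η ^ 2 * w ^ 4) ≤ K ^ 2 * (η ^ 2 * Z) * w ^ 12 := by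
      calc Z * (K * η ^ 2 * w ^ 4) = K * (η ^ 2 * Z) * w ^ 4 := by ring
        _ ≤ _ := by gcongr
    linarith only [e1, e2]
  have t2 : Y * (Z' - Z) ≤ η * Y * l' + ρ * K * (η * (Z * Y) + η * Y ^ 2) * w ^ 12
      + 3 * K ^ 2 * (η ^ 2 * Z + η ^ 2 * Y + η ^ 3) * w ^ 12 := by
    have e1 : Y * (Z' - Z) ≤ Y * (η * l' + 2 * η ^ 2 * q
        + K * (η * (Z * Y) + η * Y ^ 2 + η ^ 2 * Z + η ^ 2 * Y + η ^ 3) * w ^ 8) := by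
      gcongr; linarith only [h3]
    have e2 : Y * (2 * η ^ 2 * q) ≤ 2 * K ^ 2 * (η ^ 2 * Z + η ^ 2 * Y + η ^ 3) * w ^ 12 := by
      have hYa : Y * a ≤ Z + Y := by
        have i1 : Y * a ≤ b * a := by
          gcongr; rw [hY]; exact pow_le_of_le_one hb hb1 two_ne_zero
        rw [hZ]
        rw [hY] at i1 ⊢
        linarith only [i1, two_mul_le_add_sq b a, mul_nonneg hb ha]
      calc Y * (2 * η ^ 2 * q) ≤ Y * (2 * η ^ 2 * (K * a * w ^ 2)) := by gcongr
        _ = 2 * K * (η ^ 2 * (Y * a)) * w ^ 2 := by ring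
        _ ≤ 2 * K ^ 2 * (η ^ 2 * (Z + Y) + η ^ 3) * w ^ 12 := by
            gcongr
            have i1 : η ^ 2 * (Y * a) ≤ η ^ 2 * (Z + Y) := by gcongr
            have i2 : 0 ≤ η ^ 3 := by positivity
            linarith only [i1, i2]
        _ = _ := by ring
    have e3 : Y * (K * (η * (Z * Y) + η * Y ^ 2 + η ^ 2 * Z + η ^ 2 * Y + η ^ 3) * w ^ 8)
        ≤ ρ * K * (η * (Z * Y) + η * Y ^ 2) * w ^ 12
          + K ^ 2 * (η ^ 2 * Z + η ^ 2 * Y + η ^ 3) * w ^ 12 := by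
      calc _ = Y * K * (η * (Z * Y) + η * Y ^ 2) * w ^ 8
            + Y * K * (η ^ 2 * Z + η ^ 2 * Y + η ^ 3) * w ^ 8 := by ring
        _ ≤ ρ * K * (η * (Z * Y) + η * Y ^ 2) * w ^ 12
            + 1 * K ^ 2 * (η ^ 2 * Z + η ^ 2 * Y + η ^ 3) * w ^ 12 := by gcongr
        _ = _ := by ring
    linarith only [e1, e2, e3]
  have t3 : (Z' - Z) * (Y' - Y) ≤ 6 * K ^ 2 * (η ^ 2 * Z + η ^ 2 * Y + η ^ 3) * w ^ 12 := by
    have e1 : (a + b + η) ^ 2 * (b + η) ≤ 3 * (Z + Y + η ^ 2) * 2 := by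
      have i1 : (a + b + η) ^ 2 ≤ 3 * (Z + Y + η ^ 2) := by
        rw [hZ, hY]
        linarith only [two_mul_le_add_sq a b, two_mul_le_add_sq a η, two_mul_le_add_sq b η,
          add_sq (a + b) η, add_sq a b]
      have i2 : b + η ≤ 2 := by linarith
      gcongr
    calc (Z' - Z) * (Y' - Y) ≤ |Z' - Z| * |Y' - Y| := by rw [← abs_mul]; exact le_abs_self _
      _ ≤ (K * (η * (a + b + η) ^ 2) * w ^ 8) * (K * (η * b + η ^ 2) * w ^ 4) := by gcongr
      _ = K ^ 2 * η ^ 2 * ((a + b + η) ^ 2 * (b + η)) * w ^ 12 := by ring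
      _ ≤ K ^ 2 * η ^ 2 * (3 * (Z + Y + η ^ 2) * 2) * w ^ 12 := by gcongr
      _ = 6 * K ^ 2 * (η ^ 2 * Z + η ^ 2 * Y + η ^ 4) * w ^ 12 := by ring
      _ ≤ _ := by gcongr
  have hK2 : 0 ≤ K ^ 2 * (η ^ 2 * Y + η ^ 3) * w ^ 12 := by positivity
  have h7 : Z' * Y' = Z * Y + Z * (Y' - Y) + Y * (Z' - Z) + (Z' - Z) * (Y' - Y) := by ring
  rw [h7]
  linarith only [t1, t2, t3, hK2]

section SlowFast

variable {E : Type*} [NormedAddCommGroup E] [InnerProductSpace ℝ E]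

/-- The Lyapunov function.  In equilibrium the fast coordinate is of order `√η`; its fourth power
absorbs the quadratic fluctuations of the slow drift, and the mixed term those that are multiplied
by the size of the slow coordinate. -/
noncomputable def lyapunov (P : E →L[ℝ] E) (k : E →L[ℝ] E →L[ℝ] E) (y : E → E)
    (c : E → E →L[ℝ] E) (α β : ℝ) (x : E) : ℝ :=
  ‖slowCoord P k y c x‖ ^ 2 + β * (‖slowCoord P k y c x‖ ^ 2 * ‖y x‖ ^ 2) + α * (‖y x‖ ^ 2) ^ 2

/-- The law `ν` is centred, has a finite moment of order `12`, and charges only the kernel of `P`.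
The twelfth moment bounds the error terms of the Lyapunov function, whose degree in the noise is
at most `12`. -/
structure IsCentredNoise [MeasurableSpace E] (P : E →L[ℝ] E) (ν : Measure E) : Prop where
  mean : ∀ l : E →L[ℝ] ℝ, ∫ e, l e ∂ν = 0
  moment : Integrable (fun e => (1 + ‖e‖) ^ 12) ν
  ker : ∀ᵐ e ∂ν, P e = 0

theorem lintegral_ofReal_le_of_pointwise {X : Type*} [MeasurableSpace X] {ν : Measure X}
    {f F : X → ℝ} (hF : Integrable F ν) (hf : ∀ x, 0 ≤ f x) (h : ∀ᵐ x ∂ν, f x ≤ F x) :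
    ∫⁻ x, ENNReal.ofReal (f x) ∂ν ≤ ENNReal.ofReal (∫ x, F x ∂ν) := by
  rw [ofReal_integral_eq_lintegral_ofReal hF (h.mono fun x hx => (hf x).trans hx)]
  exact lintegral_mono_ae (h.mono fun x hx => ENNReal.ofReal_le_ofReal hx)

namespace IsCentredNoise

variable [MeasurableSpace E] [BorelSpace E] {P : E →L[ℝ] E} {ν : Measure E}

theorem integrable_linear (hν : IsCentredNoise P ν) (l : E →L[ℝ] ℝ) :
    Integrable (fun e => l e) ν := by
  refine (hν.moment.const_mul ‖l‖).mono' l.continuous.aestronglyMeasurable ?_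
  refine Filter.Eventually.of_forall fun e => (l.le_opNorm e).trans ?_
  have : ‖e‖ ≤ (1 + ‖e‖) ^ 12 :=
    (by linarith : ‖e‖ ≤ 1 + ‖e‖).trans
      (le_self_pow₀ (by linarith [norm_nonneg e]) (by norm_num))
  gcongr

theorem integrable_quadratic [FiniteDimensional ℝ E] (hν : IsCentredNoise P ν)
    (F : E →L[ℝ] E →L[ℝ] E) :
    Integrable (fun e => F e e) ν := by
  refine (hν.moment.const_mul ‖F‖).mono' ?_ ?_
  · have : Continuous fun e => F e e := by fun_prop
    exact this.aestronglyMeasurable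
  refine Filter.Eventually.of_forall fun e => (F.le_opNorm₂ e e).trans ?_
  have h0 := norm_nonneg e
  have : ‖e‖ * ‖e‖ ≤ (1 + ‖e‖) ^ 12 := by
    calc ‖e‖ * ‖e‖ ≤ (1 + ‖e‖) ^ 2 := by nlinarith
      _ ≤ _ := pow_le_pow_right₀ (by linarith) (by norm_num)
  rw [mul_assoc]; gcongr

end IsCentredNoise

namespace SlowFastForm

variable {P G : E →L[ℝ] E} {D k : E →L[ℝ] E →L[ℝ] E} {g y : E → E}
  {c : E → E →L[ℝ] E} {r C : ℝ}

/-- The fast coordinate relaxes, in mean square, to the scale `√η`. -/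
theorem fast_drift [MeasurableSpace E] [BorelSpace E] [FiniteDimensional ℝ E]
    (H : SlowFastForm P G D k g y c r C) {κ : ℝ} (hκ0 : 0 < κ)
    (hκ : ∀ v, P v = 0 → κ * ‖v‖ ^ 2 ≤ ⟪v, G v⟫_ℝ) {ν : Measure E} [IsProbabilityMeasure ν]
    (hν : IsCentredNoise P ν) :
    ∃ L r₁ : ℝ, 0 < L ∧ 0 < r₁ ∧ ∀ η, 0 < η → η ≤ 1 → ∀ x, ‖x‖ < r₁ →
      ∫⁻ e, ENNReal.ofReal (‖y (x + η • (e - g x))‖ ^ 2) ∂ν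
        ≤ ENNReal.ofReal ((1 - κ * η) * ‖y x‖ ^ 2 + L * η ^ 2) := by
  have hC := H.one_le
  have hW1 : 1 ≤ ∫ e, (1 + ‖e‖) ^ 12 ∂ν := by
    have : ∫ _, (1 : ℝ) ∂ν ≤ ∫ e, (1 + ‖e‖) ^ 12 ∂ν := by
      refine integral_mono (integrable_const _) hν.moment fun e => ?_
      exact one_le_pow₀ (by linarith [norm_nonneg e])
    simpa using this
  refine ⟨72 * C ^ 10 * ∫ e, (1 + ‖e‖) ^ 12 ∂ν, min r (κ / (6 * C ^ 2)), by positivity,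
    lt_min H.r_pos (by positivity), fun η hη hη1 x hx => ?_⟩
  have hxr : ‖x‖ < r := hx.trans_le (min_le_left _ _)
  have hxκ : 6 * C ^ 2 * ‖x‖ ≤ κ := by
    have := hx.le.trans (min_le_right _ _)
    rwa [le_div_iff₀ (by positivity), mul_comm] at this
  let l : E →L[ℝ] ℝ := (η * 2) • (innerSL ℝ (y x) ∘L fderiv ℝ y x)
  have hint : Integrable (fun e => ((1 - κ * η) * ‖y x‖ ^ 2 + l e)
      + 72 * C ^ 10 * η ^ 2 * (1 + ‖e‖) ^ 12) ν :=
    ((integrable_const _).add (hν.integrable_linear l)).add (hν.moment.const_mul _)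
  refine (lintegral_ofReal_le_of_pointwise hint (fun _ => sq_nonneg _) ?_).trans_eq ?_
  · refine Filter.Eventually.of_forall fun e => ?_
    have h := (H.fast_sq_step hκ hxr hxκ e hη hη1).1
    have hw : (1 + ‖e‖) ^ 4 ≤ (1 + ‖e‖) ^ 12 :=
      pow_le_pow_right₀ (by linarith [norm_nonneg e]) (by norm_num)
    have h2 : 72 * C ^ 10 * η ^ 2 * (1 + ‖e‖) ^ 4 ≤ 72 * C ^ 10 * η ^ 2 * (1 + ‖e‖) ^ 12 := by
      gcongr
    have hl : l e = η * (2 * ⟪y x, fderiv ℝ y x e⟫_ℝ) := by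
      simp [l]; ring
    rw [hl]
    linarith only [h, h2]
  · have hi := (integrable_const (μ := ν) ((1 - κ * η) * ‖y x‖ ^ 2)).add (hν.integrable_linear l)
    have hval := integral_add hi (hν.moment.const_mul (72 * C ^ 10 * η ^ 2))
    have hval2 := integral_add (integrable_const (μ := ν) ((1 - κ * η) * ‖y x‖ ^ 2))
      (hν.integrable_linear l)
    simp only [integral_const, probReal_univ, one_smul, hν.mean l, integral_const_mul,
      Pi.add_apply] at hval hval2
    rw [hval, hval2]
    congr 1; ring

set_option maxHeartbeats 1000000 in
/-- One step of the noisy iteration multiplies the shifted Lyapunov function by at most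
`1 + O(η²)` in expectation. -/
theorem lyapunov_drift [MeasurableSpace E] [BorelSpace E] [FiniteDimensional ℝ E]
    (H : SlowFastForm P G D k g y c r C) {κ : ℝ} (hκ0 : 0 < κ)
    (hκ : ∀ v, P v = 0 → κ * ‖v‖ ^ 2 ≤ ⟪v, G v⟫_ℝ) {ν : Measure E} [IsProbabilityMeasure ν]
    (hν : IsCentredNoise P ν) {m : ℝ} (hm : 0 ≤ m) :
    ∃ α β L r₁ : ℝ, 1 ≤ α ∧ 0 ≤ β ∧ 0 < L ∧ 0 < r₁ ∧ ∀ η, 0 < η → η ≤ 1 →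
      ‖∫ e, noiseForm G D k e e ∂ν‖ ≤ m * η → ∀ x, ‖x‖ < r₁ →
      ∫⁻ e, ENNReal.ofReal (lyapunov P k y c α β (x + η • (e - g x)) + η) ∂ν
        ≤ ENNReal.ofReal (1 + L * η ^ 2) * ENNReal.ofReal (lyapunov P k y c α β x + η) := by
  have hC := H.one_le
  obtain ⟨K₁, hK₁, hslow⟩ := H.slow_sq_step
  have hC10 : 1 ≤ C ^ 10 := one_le_pow₀ hC
  have hC3 : 1 ≤ C ^ 3 := one_le_pow₀ hC
  obtain ⟨K, hKdef⟩ : ∃ K, K = K₁ + 80 * C ^ 10 + 2 * C ^ 3 := ⟨_, rfl⟩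
  have hK : 1 ≤ K := by linarith
  have hK0 : 0 < K := by linarith
  obtain ⟨W, hWdef⟩ : ∃ W, W = ∫ e, (1 + ‖e‖) ^ 12 ∂ν := ⟨_, rfl⟩
  have hW1 : 1 ≤ W := by
    have : ∫ _, (1 : ℝ) ∂ν ≤ ∫ e, (1 + ‖e‖) ^ 12 ∂ν := by
      refine integral_mono (integrable_const _) hν.moment fun e => ?_
      exact one_le_pow₀ (by linarith [norm_nonneg e])
    rw [hWdef]; simpa using this
  have hW0 : 0 < W := by linarith
  obtain ⟨β, hβ⟩ : ∃ β, β = 2 * K * W / κ := ⟨_, rfl⟩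
  have hβ0 : 0 < β := by rw [hβ]; positivity
  have hβκ : β * κ = 2 * K * W := by rw [hβ]; field_simp
  obtain ⟨α, hα⟩ : ∃ α, α = 1 + β := ⟨_, rfl⟩
  have hα1 : 1 ≤ α := by linarith
  have hακ : 2 * K * W ≤ α * κ := by
    rw [hα, add_mul, hβκ]; linarith
  obtain ⟨ρ, hρ⟩ : ∃ ρ, ρ = 1 / β := ⟨_, rfl⟩
  have hρ0 : 0 < ρ := by rw [hρ]; positivity
  have hβρ : β * ρ = 1 := by rw [hρ]; field_simp
  obtain ⟨J, hJ⟩ : ∃ J, J = K + 10 * K ^ 2 * β + 4 * K ^ 2 * α := ⟨_, rfl⟩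
  have hJ0 : 0 < J := by rw [hJ]; positivity
  obtain ⟨L, hL⟩ : ∃ L, L = J * W + m + (J * W) ^ 2 / (α * κ) := ⟨_, rfl⟩
  have hL0 : 0 < L := by rw [hL]; positivity
  obtain ⟨r₁, hr₁⟩ : ∃ r₁, r₁ = min (min r (κ / (6 * C ^ 2))) (min 1 (√ρ) / C) := ⟨_, rfl⟩
  refine ⟨α, β, L, r₁, hα1, hβ0.le, hL0, ?_, ?_⟩
  · rw [hr₁]
    refine lt_min (lt_min H.r_pos (by positivity)) (div_pos (lt_min one_pos ?_) (by linarith))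
    exact Real.sqrt_pos.2 hρ0
  intro η hη hη1 hmη x hx
  have hxr : ‖x‖ < r := by
    rw [hr₁] at hx
    exact hx.trans_le ((min_le_left _ _).trans (min_le_left _ _))
  have hxκ : 6 * C ^ 2 * ‖x‖ ≤ κ := by
    rw [hr₁] at hx
    have := hx.le.trans ((min_le_left _ _).trans (min_le_right _ _))
    rwa [le_div_iff₀ (by positivity), mul_comm] at this
  have hbm : ‖y x‖ ≤ min 1 (√ρ) := by
    rw [hr₁] at hx
    have h := hx.le.trans (min_le_right _ _)
    rw [le_div_iff₀ (by linarith)] at h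
    exact (H.y_small x).trans (by linarith)
  have hb1 : ‖y x‖ ≤ 1 := hbm.trans (min_le_left _ _)
  obtain ⟨a, ha⟩ : ∃ a, a = ‖slowCoord P k y c x‖ := ⟨_, rfl⟩
  obtain ⟨b, hb⟩ : ∃ b, b = ‖y x‖ := ⟨_, rfl⟩
  have ha0 : 0 ≤ a := ha ▸ norm_nonneg _
  have hb0 : 0 ≤ b := hb ▸ norm_nonneg _
  have hYρ : b ^ 2 ≤ ρ := by
    have h : b ≤ √ρ := hb ▸ hbm.trans (min_le_right _ _)
    calc b ^ 2 ≤ (√ρ) ^ 2 := by gcongr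
      _ = ρ := Real.sq_sqrt hρ0.le
  rw [← hb] at hb1
  obtain ⟨Z, hZ⟩ : ∃ Z, Z = a ^ 2 := ⟨_, rfl⟩
  obtain ⟨Y, hY⟩ : ∃ Y, Y = b ^ 2 := ⟨_, rfl⟩
  have hZ0 : 0 ≤ Z := hZ ▸ sq_nonneg a
  have hY0 : 0 ≤ Y := hY ▸ sq_nonneg b
  have hΨ : lyapunov P k y c α β x = Z + β * (Z * Y) + α * Y ^ 2 := by
    rw [lyapunov, ← ha, ← hb, hZ, hY]
  let l₁ : E →L[ℝ] ℝ := (2 : ℝ) • (innerSL ℝ (y x) ∘L fderiv ℝ y x)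
  let l₂ : E →L[ℝ] ℝ := (2 : ℝ) • (innerSL ℝ (slowCoord P k y c x) ∘L slowNoise k y c x)
  let l : E →L[ℝ] ℝ := (η * (β * Z + 2 * α * Y)) • l₁ + (η * (1 + β * Y)) • l₂
  let q : E → ℝ := fun e => ⟪slowCoord P k y c x, noiseForm G D k e e⟫_ℝ
  obtain ⟨V, hV⟩ : ∃ V, V = K * (1 + β * ρ) * (η * (Z * Y) + η * Y ^ 2)
      + J * (η ^ 2 * Z + η ^ 2 * Y + η ^ 3) := ⟨_, rfl⟩
  -- the pointwise expansion: a deterministic part, a centred part, the quadratic noise term and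
  -- a remainder with a moment of the noise
  have hpt : ∀ e, P e = 0 → lyapunov P k y c α β (x + η • (e - g x)) + η
      ≤ ((Z + β * (Z * Y) + α * Y ^ 2 + η - β * κ * (η * (Z * Y)) - 2 * α * κ * (η * Y ^ 2))
        + l e) + 2 * η ^ 2 * q e + V * (1 + ‖e‖) ^ 12 := by
    intro e he
    obtain ⟨hZ1, hZ2⟩ := hslow x hxr e he η hη hη1 a b ha hb
    obtain ⟨hY1, hY2⟩ := H.fast_sq_step hκ hxr hxκ e hη hη1
    have hq := real_inner_le_norm (slowCoord P k y c x) (noiseForm G D k e e)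
    have hq' := H.norm_noiseForm_le e
    rw [← hb] at hY1 hY2
    rw [← ha] at hq
    obtain ⟨w, hw⟩ : ∃ w, w = 1 + ‖e‖ := ⟨_, rfl⟩
    rw [← hw] at hZ1 hZ2 hY1 hY2 hq' ⊢
    have hw1 : 1 ≤ w := by rw [hw]; linarith [norm_nonneg e]
    have hl₁ : 2 * ⟪y x, fderiv ℝ y x e⟫_ℝ = l₁ e := by simp [l₁]
    have hl₂ : 2 * ⟪slowCoord P k y c x, slowNoise k y c x e⟫_ℝ = l₂ e := by simp [l₂]
    have hl : l e = η * (β * Z + 2 * α * Y) * l₁ e + η * (1 + β * Y) * l₂ e := by simp [l]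
    rw [hl₁] at hY1
    rw [hl₂] at hZ1
    have i1 : 72 * C ^ 10 ≤ K := by linarith
    have i2 : 80 * C ^ 10 ≤ K := by linarith
    have i3 : K₁ ≤ K := by linarith
    have i4 : 2 * C ^ 3 ≤ K := by linarith
    set Y' := ‖y (x + η • (e - g x))‖ ^ 2 with hY'
    set Z' := ‖slowCoord P k y c (x + η • (e - g x))‖ ^ 2 with hZ'
    have a1 : Y' ≤ Y - κ * η * Y + η * l₁ e + K * η ^ 2 * w ^ 4 := by
      rw [hY]
      refine hY1.trans ?_
      gcongr
    have a2 : |Y' - Y| ≤ K * (η * b + η ^ 2) * w ^ 4 := by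
      rw [hY]
      refine hY2.trans ?_
      gcongr
    have a3 : Z' ≤ Z + η * l₂ e + 2 * η ^ 2 * q e
        + K * (η * (Z * Y) + η * Y ^ 2 + η ^ 2 * Z + η ^ 2 * Y + η ^ 3) * w ^ 8 := by
      rw [hY, hZ, ← pow_mul]
      refine hZ1.trans ?_
      gcongr
    have a4 : |Z' - Z| ≤ K * (η * (a + b + η) ^ 2) * w ^ 8 := by
      rw [hZ]
      refine hZ2.trans ?_
      gcongr
    have a5 : q e ≤ K * a * w ^ 2 := by
      refine hq.trans ?_
      calc a * ‖noiseForm G D k e e‖ ≤ a * (K * w ^ 2) := by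
            gcongr; exact hq'.trans (by gcongr)
        _ = _ := by ring
    have b1 := quartic_drift hη hη1 hK hw1 hY a1 a2
    have b2 := product_drift hη hη1 hK hw1 ha0 hb0 hY hZ (hY ▸ hYρ) hb1 a1 a2 a3 a4 a5
    have hw812 : w ^ 8 ≤ w ^ 12 := pow_le_pow_right₀ hw1 (by norm_num)
    have b3 : K * (η * (Z * Y) + η * Y ^ 2 + η ^ 2 * Z + η ^ 2 * Y + η ^ 3) * w ^ 8
        ≤ K * (η * (Z * Y) + η * Y ^ 2 + η ^ 2 * Z + η ^ 2 * Y + η ^ 3) * w ^ 12 := by gcongr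
    have c1 := mul_le_mul_of_nonneg_left b1 (by linarith : 0 ≤ α)
    have c2 := mul_le_mul_of_nonneg_left b2 hβ0.le
    have c3 : 0 ≤ 4 * K ^ 2 * α * (η ^ 2 * Z) * w ^ 12 := by
      have : 0 ≤ α := by linarith
      positivity
    rw [lyapunov, ← hY', ← hZ', hl, hV, hJ]
    linarith only [a3, b3, c1, c2, c3]
  have hqint : Integrable q ν := (hν.integrable_quadratic (noiseForm G D k)).const_inner _
  have hi1 := (integrable_const (μ := ν)
    (Z + β * (Z * Y) + α * Y ^ 2 + η - β * κ * (η * (Z * Y)) - 2 * α * κ * (η * Y ^ 2))).add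
      (hν.integrable_linear l)
  have hi2 := hi1.add (hqint.const_mul (2 * η ^ 2))
  have hint := hi2.add (hν.moment.const_mul V)
  have hnn : ∀ x', 0 ≤ lyapunov P k y c α β x' + η := by
    intro x'
    have : 0 ≤ α := by linarith
    unfold lyapunov; positivity
  refine (lintegral_ofReal_le_of_pointwise hint (fun e => hnn _)
    (hν.ker.mono fun e he => hpt e he)).trans ?_
  rw [← ENNReal.ofReal_mul (by positivity)]
  refine ENNReal.ofReal_le_ofReal ?_
  have hqi : ∫ e, q e ∂ν ≤ a * (m * η) := by
    simp only [q]
    rw [integral_inner (hν.integrable_quadratic (noiseForm G D k))]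
    refine (real_inner_le_norm _ _).trans ?_
    rw [← ha]; gcongr
  have hval := integral_add hi2 (hν.moment.const_mul V)
  have hval2 := integral_add hi1 (hqint.const_mul (2 * η ^ 2))
  have hval3 := integral_add (integrable_const (μ := ν)
    (Z + β * (Z * Y) + α * Y ^ 2 + η - β * κ * (η * (Z * Y)) - 2 * α * κ * (η * Y ^ 2)))
      (hν.integrable_linear l)
  simp only [integral_const, probReal_univ, one_smul, hν.mean l, integral_const_mul,
    Pi.add_apply] at hval hval2 hval3
  simp only [Pi.add_apply]
  rw [hval, hval2, hval3, hΨ, ← hWdef, hV, hL]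
  -- absorb the remainders of lower order in the fast coordinate into the quartic dissipation
  have f1 : 2 * η ^ 2 * ∫ e, q e ∂ν ≤ m * (η ^ 2 * Z + η ^ 3) := by
    calc 2 * η ^ 2 * ∫ e, q e ∂ν ≤ 2 * η ^ 2 * (a * (m * η)) := by gcongr
      _ = m * η ^ 2 * (2 * a * η) := by ring
      _ ≤ m * η ^ 2 * (a ^ 2 + η ^ 2) := by gcongr; exact two_mul_le_add_sq a η
      _ ≤ m * η ^ 2 * (Z + η) := by
          rw [hZ]; gcongr; exact pow_le_of_le_one hη.le hη1 two_ne_zero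
      _ = _ := by ring
  have f2 : J * W * (η ^ 2 * Y) ≤ α * κ * (η * Y ^ 2) + (J * W) ^ 2 / (α * κ) * η ^ 3 := by
    have hακ0 : 0 < α * κ := by positivity
    have h := two_mul_le_add_sq (α * κ * Y) (J * W * η)
    have h0 : 0 ≤ α * κ * Y * (J * W * η) := by positivity
    have h2 : α * κ * Y * (J * W * η) ≤ (α * κ * Y) ^ 2 + (J * W * η) ^ 2 := by
      linarith only [h, h0]
    have h3 : J * W * (η ^ 2 * Y) = η * (α * κ * Y * (J * W * η)) / (α * κ) := by
      field_simp
    have h4 : α * κ * (η * Y ^ 2) + (J * W) ^ 2 / (α * κ) * η ^ 3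
        = η * ((α * κ * Y) ^ 2 + (J * W * η) ^ 2) / (α * κ) := by
      field_simp
    rw [h3, h4]; gcongr
  have f3 : K * (1 + β * ρ) * W = 2 * K * W := by rw [hβρ]; ring
  have f4 : K * (1 + β * ρ) * (η * (Z * Y) + η * Y ^ 2) * W
      ≤ β * κ * (η * (Z * Y)) + α * κ * (η * Y ^ 2) := by
    have e1 : K * (1 + β * ρ) * (η * (Z * Y) + η * Y ^ 2) * W
        = 2 * K * W * (η * (Z * Y)) + 2 * K * W * (η * Y ^ 2) := by rw [hβρ]; ring
    rw [e1, hβκ]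
    have e2 : 2 * K * W * (η * Y ^ 2) ≤ α * κ * (η * Y ^ 2) := by gcongr
    linarith only [e2]
  have f5 : 0 ≤ (J * W + m + (J * W) ^ 2 / (α * κ)) * η ^ 2 * (β * (Z * Y) + α * Y ^ 2) := by
    have : 0 ≤ α := by linarith
    positivity
  have f6 : 0 ≤ (J * W) ^ 2 / (α * κ) * (η ^ 2 * Z) := by
    have : 0 ≤ α := by linarith
    positivity
  linarith only [f1, f2, f4, f5, f6]

end SlowFastForm
end SlowFast

/-! ### Recursions frozen at the exit from a set -/

section Recursion

open scoped Classical in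
/-- The recursion `x ↦ F x (ε k)`, frozen from the first time it is outside `U`. -/
noncomputable def frozen {X Y : Type*} (F : X → Y → X) (U : Set X) (x₀ : X) (ε : ℕ → Y) : ℕ → X
  | 0 => x₀
  | k + 1 => if frozen F U x₀ ε k ∈ U then F (frozen F U x₀ ε k) (ε k) else frozen F U x₀ ε k

variable {X Y : Type*} {F : X → Y → X} {U : Set X} {x₀ : X}

theorem frozen_mem_of_le {ε : ℕ → Y} {k n : ℕ} (hkn : k ≤ n) (h : frozen F U x₀ ε n ∈ U) :
    frozen F U x₀ ε k ∈ U := by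
  induction n, hkn using Nat.le_induction with
  | base => exact h
  | succ n _ ih =>
    refine ih ?_
    by_contra hn
    rw [frozen, if_neg hn] at h
    exact hn h

/-- The frozen recursion agrees with the free one as long as it is inside `U`. -/
theorem frozen_eq_frozen_univ {ε : ℕ → Y} {n : ℕ} (h : frozen F U x₀ ε n ∈ U) :
    frozen F U x₀ ε n = frozen F Set.univ x₀ ε n := by
  induction n with
  | zero => rfl
  | succ n ih =>
    have hn := frozen_mem_of_le n.le_succ h
    rw [frozen, frozen, if_pos hn, if_pos (Set.mem_univ _), ih hn]

theorem frozen_congr {ε ε' : ℕ → Y} {n : ℕ} (h : ∀ j < n, ε j = ε' j) :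
    frozen F U x₀ ε n = frozen F U x₀ ε' n := by
  induction n with
  | zero => rfl
  | succ n ih =>
    have := ih fun j hj => h j (hj.trans n.lt_succ_self)
    rw [frozen, frozen, this, h n n.lt_succ_self]

variable [MeasurableSpace X] [MeasurableSpace Y]

open scoped Classical in
theorem measurable_frozen_step (hF : Measurable (Function.uncurry F)) (hU : MeasurableSet U) :
    Measurable fun p : X × Y => if p.1 ∈ U then F p.1 p.2 else p.1 :=
  Measurable.ite (measurable_fst hU) hF measurable_fst

theorem measurable_frozen (hF : Measurable (Function.uncurry F)) (hU : MeasurableSet U) (n : ℕ) :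
    Measurable fun ε : ℕ → Y => frozen F U x₀ ε n := by
  induction n with
  | zero => exact measurable_const
  | succ n ih => exact (measurable_frozen_step hF hU).comp (ih.prodMk (measurable_pi_apply n))

variable {Ω : Type*} [MeasurableSpace Ω] {μ : Measure Ω} {ε : ℕ → Ω → Y}

/-- The past of the recursion is independent of the next innovation. -/
theorem indepFun_frozen [Nonempty Y] (hF : Measurable (Function.uncurry F)) (hU : MeasurableSet U)
    (hindep : iIndepFun ε μ) (hε : ∀ k, AEMeasurable (ε k) μ) (n : ℕ) :
    IndepFun (fun w => frozen F U x₀ (fun j => ε j w) n) (ε n) μ := by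
  have h := hindep.indepFun_finset₀ (Finset.range n) {n} (by simp) hε
  let ext : ((i : Finset.range n) → Y) → ℕ → Y := fun v j =>
    if hj : j ∈ Finset.range n then v ⟨j, hj⟩ else Classical.arbitrary Y
  have hext : Measurable ext := by
    refine measurable_pi_iff.2 fun j => ?_
    by_cases hj : j ∈ Finset.range n
    · simp only [ext, dif_pos hj]
      exact measurable_pi_apply (⟨j, hj⟩ : Finset.range n)
    · simp only [ext, dif_neg hj]
      exact measurable_const
  have hlast : Measurable fun v : (({n} : Finset ℕ) → Y) => v ⟨n, by simp⟩ := by fun_prop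
  have h2 := h.comp (φ := fun v => frozen F U x₀ (ext v) n)
    (ψ := fun v : (({n} : Finset ℕ) → Y) => v ⟨n, by simp⟩)
    ((measurable_frozen hF hU n).comp hext) hlast
  convert h2 using 1
  · funext w
    refine frozen_congr fun j hj => ?_
    simp [ext, hj]
  · rfl

theorem aemeasurable_frozen (hF : Measurable (Function.uncurry F)) (hU : MeasurableSet U)
    (hε : ∀ k, AEMeasurable (ε k) μ) (n : ℕ) :
    AEMeasurable (fun w => frozen F U x₀ (fun j => ε j w) n) μ :=
  (measurable_frozen hF hU n).comp_aemeasurable (aemeasurable_pi_lambda _ hε)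

open scoped Classical in
/-- A drift inequality for the one-step kernel passes to expectations along the recursion. -/
theorem lintegral_frozen_succ_le [Nonempty Y] [IsProbabilityMeasure μ] {ν : Measure Y}
    [IsProbabilityMeasure ν]
    (hF : Measurable (Function.uncurry F)) (hU : MeasurableSet U)
    (hindep : iIndepFun ε μ) (hlaw : ∀ k, HasLaw (ε k) ν μ) {f : X → ENNReal} (hf : Measurable f)
    {q b : ENNReal} (h : ∀ x, ∫⁻ e, f (if x ∈ U then F x e else x) ∂ν ≤ q * f x + b) (n : ℕ) :
    ∫⁻ w, f (frozen F U x₀ (fun j => ε j w) (n + 1)) ∂μ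
      ≤ q * ∫⁻ w, f (frozen F U x₀ (fun j => ε j w) n) ∂μ + b := by
  have hε := fun k => (hlaw k).aemeasurable
  have hX := aemeasurable_frozen (x₀ := x₀) hF hU hε n
  have hstep := measurable_frozen_step hF hU
  have hprob : IsProbabilityMeasure (μ.map fun w => frozen F U x₀ (fun j => ε j w) n) :=
    Measure.isProbabilityMeasure_map hX
  have hmap := (indepFun_iff_map_prod_eq_prod_map_map hX (hε n)).1
    (indepFun_frozen (x₀ := x₀) hF hU hindep hε n)
  rw [(hlaw n).map_eq] at hmap
  calc ∫⁻ w, f (frozen F U x₀ (fun j => ε j w) (n + 1)) ∂μ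
      = ∫⁻ p, f (if p.1 ∈ U then F p.1 p.2 else p.1)
          ∂(μ.map fun w => (frozen F U x₀ (fun j => ε j w) n, ε n w)) :=
        (lintegral_map' (hf.comp hstep).aemeasurable (hX.prodMk (hε n))).symm
    _ = ∫⁻ x, ∫⁻ e, f (if x ∈ U then F x e else x) ∂ν
          ∂(μ.map fun w => frozen F U x₀ (fun j => ε j w) n) := by
        rw [hmap]
        exact lintegral_prod (fun p => f (if p.1 ∈ U then F p.1 p.2 else p.1))
          (hf.comp hstep).aemeasurable
    _ ≤ ∫⁻ x, q * f x + b ∂(μ.map fun w => frozen F U x₀ (fun j => ε j w) n) :=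
        lintegral_mono h
    _ = q * ∫⁻ w, f (frozen F U x₀ (fun j => ε j w) n) ∂μ + b := by
        rw [lintegral_add_right _ measurable_const, lintegral_const_mul _ hf,
          lintegral_map' hf.aemeasurable hX]
        simp

end Recursion

/-! ### Stability of slow-fast systems -/

section Stability

variable {E : Type*} [NormedAddCommGroup E] [InnerProductSpace ℝ E]

namespace SlowFastForm

variable {P G : E →L[ℝ] E} {D k : E →L[ℝ] E →L[ℝ] E} {g y : E → E}
  {c : E → E →L[ℝ] E} {r C α β : ℝ}

theorem continuous_slowCoord (H : SlowFastForm P G D k g y c r C) :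
    Continuous (slowCoord P k y c) := by
  have := H.cont_y
  have := H.cont_c
  unfold slowCoord
  fun_prop

theorem continuous_lyapunov (H : SlowFastForm P G D k g y c r C) :
    Continuous (lyapunov P k y c α β) := by
  have := H.cont_y
  have := H.continuous_slowCoord
  unfold lyapunov
  fun_prop

theorem y_zero (H : SlowFastForm P G D k g y c r C) : y 0 = 0 := by
  have := H.y_small 0
  simpa using this

theorem lyapunov_zero (H : SlowFastForm P G D k g y c r C) : lyapunov P k y c α β 0 = 0 := by
  simp [lyapunov, slowCoord, H.y_zero]

theorem sq_le_lyapunov (hα : 0 ≤ α) (hβ : 0 ≤ β) (x : E) :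
    ‖slowCoord P k y c x‖ ^ 2 ≤ lyapunov P k y c α β x := by
  unfold lyapunov
  have h1 : 0 ≤ β * (‖slowCoord P k y c x‖ ^ 2 * ‖y x‖ ^ 2) := by positivity
  have h2 : 0 ≤ α * (‖y x‖ ^ 2) ^ 2 := by positivity
  linarith

/-- The Lyapunov function is bounded below outside each ball, because `‖z‖` and `‖y‖` control `‖x‖`
globally. -/
theorem exists_lyapunov_lower (H : SlowFastForm P G D k g y c r C) (hα : 1 ≤ α) (hβ : 0 ≤ β)
    {R : ℝ} (hR : 0 < R) :
    ∃ ψ > 0, ∀ x, R ≤ ‖x‖ → ψ ≤ lyapunov P k y c α β x := by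
  have hC := H.one_le
  have hC2 : 1 ≤ C ^ 2 := one_le_pow₀ hC
  obtain ⟨t, ht⟩ : ∃ t, t = min 1 (R / (10 * C ^ 2)) := ⟨_, rfl⟩
  have ht0 : 0 < t := by rw [ht]; exact lt_min one_pos (by positivity)
  have ht1 : t ≤ 1 := by rw [ht]; exact min_le_left _ _
  have htR : 10 * C ^ 2 * t ≤ R := by
    have : t ≤ R / (10 * C ^ 2) := by rw [ht]; exact min_le_right _ _
    rwa [le_div_iff₀ (by positivity), mul_comm] at this
  refine ⟨t ^ 4, by positivity, fun x hx => ?_⟩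
  by_contra hlt
  push Not at hlt
  have ha := norm_nonneg (slowCoord P k y c x)
  have hb := norm_nonneg (y x)
  have h1 : ‖slowCoord P k y c x‖ < t := by
    refine lt_of_pow_lt_pow_left₀ 2 ht0.le ?_
    calc ‖slowCoord P k y c x‖ ^ 2 ≤ lyapunov P k y c α β x := sq_le_lyapunov (by linarith) hβ x
      _ < t ^ 4 := hlt
      _ ≤ t ^ 2 := pow_le_pow_of_le_one ht0.le ht1 (by norm_num)
  have h2 : ‖y x‖ < t := by
    refine lt_of_pow_lt_pow_left₀ 4 ht0.le ?_
    refine lt_of_le_of_lt ?_ hlt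
    unfold lyapunov
    have e1 : 0 ≤ β * (‖slowCoord P k y c x‖ ^ 2 * ‖y x‖ ^ 2) := by positivity
    have e2 : 1 * (‖y x‖ ^ 2) ^ 2 ≤ α * (‖y x‖ ^ 2) ^ 2 := by gcongr
    have e3 : 0 ≤ ‖slowCoord P k y c x‖ ^ 2 := by positivity
    calc ‖y x‖ ^ 4 = 1 * (‖y x‖ ^ 2) ^ 2 := by ring
      _ ≤ _ := by linarith
  have h3 : ‖y x‖ ^ 2 ≤ t := by
    calc ‖y x‖ ^ 2 ≤ t ^ 2 := by gcongr
      _ ≤ t := pow_le_of_le_one ht0.le ht1 two_ne_zero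
  have h4 := H.norm_le_coords x
  have h5 : 3 * C ^ 2 * (‖slowCoord P k y c x‖ + ‖y x‖ + ‖y x‖ ^ 2) ≤ 3 * C ^ 2 * (t + t + t) := by
    gcongr
  have h6 : 0 < C ^ 2 * t := by positivity
  linarith

variable [MeasurableSpace E] [BorelSpace E] [FiniteDimensional ℝ E]
variable {Ω : Type*} [MeasurableSpace Ω] {μ : Measure Ω} {ε : ℕ → Ω → E}

theorem measurable_step (H : SlowFastForm P G D k g y c r C) (η : ℝ) :
    Measurable (Function.uncurry fun x e : E => x + η • (e - g x)) := by
  have := H.cont_g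
  have h : Continuous (Function.uncurry fun x e : E => x + η • (e - g x)) := by
    unfold Function.uncurry
    fun_prop
  exact h.measurable

/-- Iterating the drift inequality over `T / η²` steps costs only a constant factor. -/
theorem lintegral_lyapunov_frozen_le [IsProbabilityMeasure μ] {ν : Measure E}
    [IsProbabilityMeasure ν] (H : SlowFastForm P G D k g y c r C)
    (hindep : iIndepFun ε μ) (hlaw : ∀ k, HasLaw (ε k) ν μ) {L R η T : ℝ} (hL : 0 ≤ L) (hη : 0 < η)
    (hdrift : ∀ x, ‖x‖ < R →
      ∫⁻ e, ENNReal.ofReal (lyapunov P k y c α β (x + η • (e - g x)) + η) ∂ν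
        ≤ ENNReal.ofReal (1 + L * η ^ 2) * ENNReal.ofReal (lyapunov P k y c α β x + η))
    (x₀ : E) (n : ℕ) (hn : n ≤ T / η ^ 2) :
    ∫⁻ w, ENNReal.ofReal (lyapunov P k y c α β (frozen (fun x e : E => x + η • (e - g x))
        (Metric.ball 0 R) x₀ (fun j => ε j w) n) + η) ∂μ
      ≤ ENNReal.ofReal (Real.exp (L * T) * (lyapunov P k y c α β x₀ + η)) := by
  have hf : Measurable fun x => ENNReal.ofReal (lyapunov P k y c α β x + η) :=
    (H.continuous_lyapunov.measurable.add_const η).ennreal_ofReal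
  have hq : 1 ≤ ENNReal.ofReal (1 + L * η ^ 2) := by
    rw [← ENNReal.ofReal_one]
    exact ENNReal.ofReal_le_ofReal (by nlinarith [sq_nonneg η])
  have hstep := lintegral_frozen_succ_le (x₀ := x₀) (H.measurable_step η)
    (Metric.isOpen_ball (x := (0 : E)) (ε := R)).measurableSet hindep hlaw hf
    (q := ENNReal.ofReal (1 + L * η ^ 2)) (b := 0) (fun x => by
      by_cases hx : x ∈ Metric.ball (0 : E) R
      · simp only [if_pos hx, add_zero]
        exact hdrift x (by simpa using hx)
      · simp only [if_neg hx, lintegral_const, measure_univ, mul_one, add_zero]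
        exact le_mul_of_one_le_left zero_le hq)
  have hpow : ∀ j : ℕ, ∫⁻ w, ENNReal.ofReal (lyapunov P k y c α β
      (frozen (fun x e : E => x + η • (e - g x)) (Metric.ball 0 R) x₀ (fun j => ε j w) j) + η) ∂μ
      ≤ ENNReal.ofReal (1 + L * η ^ 2) ^ j * ENNReal.ofReal (lyapunov P k y c α β x₀ + η) := by
    intro j
    induction j with
    | zero => simp [frozen]
    | succ j ih =>
      refine (hstep j).trans ?_
      rw [add_zero, pow_succ' (ENNReal.ofReal _), mul_assoc]
      gcongr
  refine (hpow n).trans ?_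
  rw [ENNReal.ofReal_mul (Real.exp_pos _).le, ← ENNReal.ofReal_pow (by positivity)]
  gcongr
  calc (1 + L * η ^ 2) ^ n ≤ (Real.exp (L * η ^ 2)) ^ n := by
        gcongr; linarith [Real.add_one_le_exp (L * η ^ 2)]
    _ = Real.exp (L * (n * η ^ 2)) := by rw [← Real.exp_nat_mul]; ring_nf
    _ ≤ Real.exp (L * T) := by
        gcongr
        rwa [le_div_iff₀ (by positivity)] at hn

open scoped Classical in
/-- Started at the origin, the fast coordinate is of size `√η` in mean square, uniformly in time.
Only the part of the process that is still inside the ball counts, since the frozen process does not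
contract. -/
theorem lintegral_fast_frozen_le [IsProbabilityMeasure μ] {ν : Measure E}
    [IsProbabilityMeasure ν] (H : SlowFastForm P G D k g y c r C)
    (hindep : iIndepFun ε μ) (hlaw : ∀ k, HasLaw (ε k) ν μ) {L R η κ : ℝ} (hL : 0 ≤ L) (hη : 0 < η)
    (hκ : 0 < κ) (hκη : κ * η ≤ 1)
    (hdrift : ∀ x, ‖x‖ < R → ∫⁻ e, ENNReal.ofReal (‖y (x + η • (e - g x))‖ ^ 2) ∂ν
        ≤ ENNReal.ofReal ((1 - κ * η) * ‖y x‖ ^ 2 + L * η ^ 2)) (n : ℕ) :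
    ∫⁻ w, (Metric.ball 0 R).indicator (fun x => ENNReal.ofReal (‖y x‖ ^ 2))
        (frozen (fun x e : E => x + η • (e - g x)) (Metric.ball 0 R) 0 (fun j => ε j w) n) ∂μ
      ≤ ENNReal.ofReal (L / κ * η) := by
  have hB : MeasurableSet (Metric.ball (0 : E) R) := Metric.isOpen_ball.measurableSet
  have hf : Measurable ((Metric.ball (0 : E) R).indicator
      fun x => ENNReal.ofReal (‖y x‖ ^ 2)) :=
    ((H.cont_y.measurable.norm.pow_const 2).ennreal_ofReal).indicator hB
  have hstep := lintegral_frozen_succ_le (x₀ := (0 : E)) (H.measurable_step η)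
    hB hindep hlaw hf (q := ENNReal.ofReal (1 - κ * η))
    (b := ENNReal.ofReal (L * η ^ 2)) (fun x => by
      by_cases hx : x ∈ Metric.ball (0 : E) R
      · simp only [if_pos hx, Set.indicator_of_mem hx]
        rw [← ENNReal.ofReal_mul (by linarith), ← ENNReal.ofReal_add
          (mul_nonneg (by linarith) (by positivity)) (by positivity)]
        refine le_trans (lintegral_mono fun e => ?_) (hdrift x (by simpa using hx))
        exact Set.indicator_le_self _ _ _
      · simp only [if_neg hx, Set.indicator_of_notMem hx, lintegral_const, zero_mul]
        exact zero_le)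
  induction n with
  | zero =>
    have : (Metric.ball (0 : E) R).indicator (fun x => ENNReal.ofReal (‖y x‖ ^ 2)) 0 = 0 := by
      refine le_antisymm ((Set.indicator_le_self _ _ _).trans ?_) zero_le
      simp [H.y_zero]
    simp only [frozen, this, lintegral_const, zero_mul]
    exact zero_le
  | succ n ih =>
    refine (hstep n).trans ?_
    calc _ ≤ ENNReal.ofReal (1 - κ * η) * ENNReal.ofReal (L / κ * η)
          + ENNReal.ofReal (L * η ^ 2) := by
          gcongr
      _ = ENNReal.ofReal (L / κ * η) := by
          rw [← ENNReal.ofReal_mul (by linarith), ← ENNReal.ofReal_add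
            (mul_nonneg (by linarith) (by positivity)) (by positivity)]
          congr 1; field_simp; ring

/-- Both stability assertions for the noisy iteration of a vector field in slow-fast form, provided
the mean second-order effect of the noise on the slow coordinate is `O(η)`. -/
theorem stability [IsProbabilityMeasure μ] {ν : Measure E}
    [IsProbabilityMeasure ν] (H : SlowFastForm P G D k g y c r C) {κ : ℝ} (hκ0 : 0 < κ)
    (hκ : ∀ v, P v = 0 → κ * ‖v‖ ^ 2 ≤ ⟪v, G v⟫_ℝ) (hν : IsCentredNoise P ν)
    (hindep : iIndepFun ε μ) (hlaw : ∀ k, HasLaw (ε k) ν μ) {S : Set ℝ} {m η₁ : ℝ} (hm : 0 ≤ m)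
    (hη₁ : 0 < η₁)
    (hmean : ∀ η ∈ S, 0 < η → η < η₁ → ‖∫ e, noiseForm G D k e e ∂ν‖ ≤ m * η) :
    (∀ T ρ δ : ℝ, 0 < T → 0 < ρ → 0 < δ → ∃ ρ₀ η₀ : ℝ, 0 < ρ₀ ∧ 0 < η₀ ∧
      ∀ η ∈ S, 0 < η → η < η₀ → ∀ x₀ : E, ‖x₀‖ ≤ ρ₀ →
        μ {w | ∃ n : ℕ, (n : ℝ) ≤ T / η ^ 2 ∧ ρ ≤ ‖frozen (fun x e : E => x + η • (e - g x))
          Set.univ x₀ (fun j => ε j w) n‖} ≤ ENNReal.ofReal δ) ∧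
    (∀ T δ : ℝ, 0 < T → 0 < δ → ∃ K η₀ : ℝ, 0 < K ∧ 0 < η₀ ∧
      ∀ η ∈ S, 0 < η → η < η₀ → ∀ n : ℕ, (n : ℝ) ≤ T / η ^ 2 →
        μ {w | K * √η ≤ ‖frozen (fun x e : E => x + η • (e - g x))
          Set.univ 0 (fun j => ε j w) n‖} ≤ ENNReal.ofReal δ) := by
  obtain ⟨α, β, L, r₁, hα, hβ, hL, hr₁, hlyap⟩ := H.lyapunov_drift hκ0 hκ hν hm
  obtain ⟨L', r₂, hL', hr₂, hfast⟩ := H.fast_drift hκ0 hκ hν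
  have hC := H.one_le
  have hnn : ∀ x, 0 ≤ lyapunov P k y c α β x := fun x =>
    (sq_nonneg _).trans (sq_le_lyapunov (by linarith) hβ x)
  -- the exit probability from a small ball, by Markov's inequality for the frozen process
  have hexit : ∀ R, 0 < R → R ≤ r₁ → ∃ ψ > 0, ∀ T, ∀ η ∈ S, 0 < η → η < η₁ → η ≤ 1 → ∀ x₀ : E,
      ∀ n : ℕ, (n : ℝ) ≤ T / η ^ 2 →
        μ {w | frozen (fun x e : E => x + η • (e - g x)) (Metric.ball 0 R) x₀ (fun j => ε j w) n
          ∉ Metric.ball 0 R}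
        ≤ ENNReal.ofReal (Real.exp (L * T) * (lyapunov P k y c α β x₀ + η) / ψ) := by
    intro R hR hRr
    obtain ⟨ψ, hψ, hlow⟩ := H.exists_lyapunov_lower (α := α) (β := β) hα hβ hR
    refine ⟨ψ, hψ, fun T η hηS hη hηη₁ hη1 x₀ n hn => ?_⟩
    have h := H.lintegral_lyapunov_frozen_le (α := α) (β := β) (R := R) (μ := μ) (ν := ν)
      hindep hlaw hL.le hη (fun x hx => hlyap η hη hη1 (hmean η hηS hη hηη₁) x (hx.trans_le hRr)) x₀ n hn
    rw [ENNReal.ofReal_div_of_pos hψ, ENNReal.le_div_iff_mul_le (by simp [hψ]) (by simp), mul_comm]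
    refine le_trans ?_ h
    refine le_trans ?_ (mul_meas_ge_le_lintegral₀ ?_ (ENNReal.ofReal ψ))
    · gcongr
      rename_i w
      intro hw
      simp only [Metric.mem_ball, dist_zero_right, not_lt] at hw
      exact ENNReal.ofReal_le_ofReal ((hlow _ hw).trans (by linarith))
    · exact ((H.continuous_lyapunov.measurable.add_const η).ennreal_ofReal).comp_aemeasurable
        (aemeasurable_frozen (H.measurable_step η) Metric.isOpen_ball.measurableSet
          (fun k => (hlaw k).aemeasurable) n)
  refine ⟨fun T ρ δ hT hρ hδ => ?_, fun T δ hT hδ => ?_⟩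
  · obtain ⟨ψ, hψ, hex⟩ := hexit (min ρ r₁) (lt_min hρ hr₁) (min_le_right _ _)
    obtain ⟨A, hA⟩ : ∃ A, A = δ * ψ / Real.exp (L * T) / 2 := ⟨_, rfl⟩
    have hA0 : 0 < A := by rw [hA]; positivity
    have hcont := (H.continuous_lyapunov (α := α) (β := β)).tendsto 0
    rw [H.lyapunov_zero] at hcont
    obtain ⟨ρ₀, hρ₀, hball⟩ := Metric.eventually_nhds_iff.1 (hcont.eventually (gt_mem_nhds hA0))
    refine ⟨ρ₀ / 2, min (min η₁ 1) A, by positivity, by positivity,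
      fun η hηS hη hη₀ x₀ hx₀ => ?_⟩
    have i1 : η < η₁ := hη₀.trans_le ((min_le_left _ _).trans (min_le_left _ _))
    have i2 : η ≤ 1 := hη₀.le.trans ((min_le_left _ _).trans (min_le_right _ _))
    have i3 : η ≤ A := hη₀.le.trans (min_le_right _ _)
    have i4 : lyapunov P k y c α β x₀ < A := hball (by rw [dist_zero_right]; linarith)
    have hfl : ((⌊T / η ^ 2⌋₊ : ℕ) : ℝ) ≤ T / η ^ 2 := Nat.floor_le (by positivity)
    refine (measure_mono ?_).trans ((hex T η hηS hη i1 i2 x₀ _ hfl).trans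
      (ENNReal.ofReal_le_ofReal ?_))
    · rintro w ⟨n, hn, hw⟩ hmem
      have h1 := frozen_mem_of_le (Nat.le_floor hn) hmem
      rw [frozen_eq_frozen_univ h1] at h1
      have h2 : ‖frozen (fun x e : E => x + η • (e - g x)) Set.univ x₀ (fun j => ε j w) n‖
          < min ρ r₁ := by simpa using h1
      exact absurd hw (not_le.2 (h2.trans_le (min_le_left _ _)))
    · rw [div_le_iff₀ hψ]
      have : Real.exp (L * T) * (A + A) = δ * ψ := by rw [hA]; field_simp; ring
      calc _ ≤ Real.exp (L * T) * (A + A) := by gcongr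
        _ = _ := this
  · obtain ⟨R, hR⟩ : ∃ R, R = min r (min r₁ r₂) := ⟨_, rfl⟩
    have hR0 : 0 < R := by rw [hR]; exact lt_min H.r_pos (lt_min hr₁ hr₂)
    have hRr : R ≤ r := by rw [hR]; exact min_le_left _ _
    have hRr₁ : R ≤ r₁ := by rw [hR]; exact (min_le_right _ _).trans (min_le_left _ _)
    have hRr₂ : R ≤ r₂ := by rw [hR]; exact (min_le_right _ _).trans (min_le_right _ _)
    obtain ⟨ψ, hψ, hex⟩ := hexit R hR0 hRr₁
    obtain ⟨A, hA⟩ : ∃ A, A = δ * ψ / Real.exp (L * T) / 3 := ⟨_, rfl⟩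
    have hA0 : 0 < A := by rw [hA]; positivity
    -- each coordinate is below `t √η` with probability at least `1 - δ / 3`
    obtain ⟨t, ht⟩ : ∃ t, t = √(3 * (Real.exp (L * T) + L' / κ) / δ) := ⟨_, rfl⟩
    have ht0 : 0 < t := by rw [ht]; exact Real.sqrt_pos.2 (by positivity)
    have ht2 : t ^ 2 * δ = 3 * (Real.exp (L * T) + L' / κ) := by
      rw [ht, Real.sq_sqrt (by positivity)]; field_simp
    refine ⟨12 * C ^ 3 * t, min (min η₁ 1) (min A (1 / κ)), by positivity, by positivity,
      fun η hηS hη hη₀ n hn => ?_⟩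
    have i1 : η < η₁ := hη₀.trans_le ((min_le_left _ _).trans (min_le_left _ _))
    have i2 : η ≤ 1 := hη₀.le.trans ((min_le_left _ _).trans (min_le_right _ _))
    have i3 : η ≤ A := hη₀.le.trans ((min_le_right _ _).trans (min_le_left _ _))
    have i4 : κ * η ≤ 1 := by
      have := hη₀.le.trans ((min_le_right _ _).trans (min_le_right _ _))
      rwa [le_div_iff₀ hκ0, mul_comm] at this
    let Xn : Ω → E := fun w => frozen (fun x e : E => x + η • (e - g x)) (Metric.ball 0 R) 0
      (fun j => ε j w) n
    have hXn : AEMeasurable Xn μ := aemeasurable_frozen (H.measurable_step η)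
      Metric.isOpen_ball.measurableSet (fun k => (hlaw k).aemeasurable) n
    have p1 : μ {w | Xn w ∉ Metric.ball 0 R} ≤ ENNReal.ofReal (δ / 3) := by
      refine (hex T η hηS hη i1 i2 0 n hn).trans (ENNReal.ofReal_le_ofReal ?_)
      rw [H.lyapunov_zero, zero_add, div_le_iff₀ hψ]
      calc Real.exp (L * T) * η ≤ Real.exp (L * T) * A := by gcongr
        _ = _ := by rw [hA]; field_simp
    have htη : 0 < t ^ 2 * η := by positivity
    have p2 : μ {w | t ^ 2 * η ≤ ‖slowCoord P k y c (Xn w)‖ ^ 2} ≤ ENNReal.ofReal (δ / 3) := by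
      have h := H.lintegral_lyapunov_frozen_le (α := α) (β := β) (R := R) (μ := μ) (ν := ν) hindep
        hlaw hL.le hη (fun x hx => hlyap η hη i2 (hmean η hηS hη i1) x (hx.trans_le hRr₁)) 0 n hn
      rw [H.lyapunov_zero, zero_add] at h
      have hle : ENNReal.ofReal (t ^ 2 * η) * μ {w | t ^ 2 * η ≤ ‖slowCoord P k y c (Xn w)‖ ^ 2}
          ≤ ENNReal.ofReal (t ^ 2 * η) * ENNReal.ofReal (δ / 3) := by
        calc _ ≤ ENNReal.ofReal (Real.exp (L * T) * η) := by
              refine le_trans ?_ h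
              refine le_trans ?_ (mul_meas_ge_le_lintegral₀ ?_ (ENNReal.ofReal (t ^ 2 * η)))
              · gcongr
                rename_i w
                intro hw
                have hw' : t ^ 2 * η ≤ ‖slowCoord P k y c (Xn w)‖ ^ 2 := hw
                exact ENNReal.ofReal_le_ofReal
                  (hw'.trans ((sq_le_lyapunov (by linarith) hβ _).trans
                    (le_add_of_nonneg_right hη.le)))
              · exact (H.continuous_lyapunov.measurable.add_const η).ennreal_ofReal.comp_aemeasurable
                  hXn
          _ ≤ _ := by
              rw [← ENNReal.ofReal_mul htη.le]
              refine ENNReal.ofReal_le_ofReal ?_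
              have : 0 ≤ L' / κ := by positivity
              have e1 : t ^ 2 * η * (δ / 3) = (Real.exp (L * T) + L' / κ) * η := by
                calc _ = (t ^ 2 * δ) * η / 3 := by ring
                  _ = _ := by rw [ht2]; ring
              rw [e1]; gcongr; linarith
      exact (ENNReal.mul_le_mul_iff_right (by simp [htη]) (by simp)).1 hle
    have p3 : μ {w | Xn w ∈ Metric.ball 0 R ∧ t ^ 2 * η ≤ ‖y (Xn w)‖ ^ 2}
        ≤ ENNReal.ofReal (δ / 3) := by
      have h := H.lintegral_fast_frozen_le (R := R) (μ := μ) (ν := ν) hindep hlaw hL'.le hη hκ0 i4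
        (fun x hx => hfast η hη i2 x (hx.trans_le hRr₂)) n
      have hle : ENNReal.ofReal (t ^ 2 * η)
            * μ {w | Xn w ∈ Metric.ball 0 R ∧ t ^ 2 * η ≤ ‖y (Xn w)‖ ^ 2}
          ≤ ENNReal.ofReal (t ^ 2 * η) * ENNReal.ofReal (δ / 3) := by
        calc _ ≤ ENNReal.ofReal (L' / κ * η) := by
              refine le_trans ?_ h
              refine le_trans ?_ (mul_meas_ge_le_lintegral₀ ?_ (ENNReal.ofReal (t ^ 2 * η)))
              · gcongr
                rename_i w
                rintro ⟨hw1, hw2⟩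
                change _ ≤ (Metric.ball 0 R).indicator _ (Xn w)
                rw [Set.indicator_of_mem hw1]
                exact ENNReal.ofReal_le_ofReal hw2
              · exact (((H.cont_y.measurable.norm.pow_const 2).ennreal_ofReal).indicator
                  Metric.isOpen_ball.measurableSet).comp_aemeasurable hXn
          _ ≤ _ := by
              rw [← ENNReal.ofReal_mul htη.le]
              refine ENNReal.ofReal_le_ofReal ?_
              have : 0 ≤ Real.exp (L * T) := (Real.exp_pos _).le
              have e1 : t ^ 2 * η * (δ / 3) = (Real.exp (L * T) + L' / κ) * η := by
                calc _ = (t ^ 2 * δ) * η / 3 := by ring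
                  _ = _ := by rw [ht2]; ring
              rw [e1]; gcongr; linarith
      exact (ENNReal.mul_le_mul_iff_right (by simp [htη]) (by simp)).1 hle
    have hsub : {w | 12 * C ^ 3 * t * √η ≤ ‖frozen (fun x e : E => x + η • (e - g x))
          Set.univ 0 (fun j => ε j w) n‖} ⊆ {w | Xn w ∉ Metric.ball 0 R}
        ∪ ({w | t ^ 2 * η ≤ ‖slowCoord P k y c (Xn w)‖ ^ 2}
          ∪ {w | Xn w ∈ Metric.ball 0 R ∧ t ^ 2 * η ≤ ‖y (Xn w)‖ ^ 2}) := by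
      intro w hw
      by_cases hmem : Xn w ∈ Metric.ball 0 R
      swap
      · exact Or.inl hmem
      have heq : Xn w = _ := frozen_eq_frozen_univ hmem
      have hw' : 12 * C ^ 3 * t * √η ≤ ‖Xn w‖ := by rw [heq]; exact hw
      have hlt : ‖Xn w‖ < r := lt_of_lt_of_le (by simpa using hmem) hRr
      have hco := H.norm_le_coords_near hlt
      have hsq : t ^ 2 * η = (t * √η) ^ 2 := by rw [mul_pow, Real.sq_sqrt hη.le]
      have hts : 0 ≤ t * √η := by positivity
      rcases le_total (t * √η) ‖slowCoord P k y c (Xn w)‖ with h | h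
      · exact Or.inr (Or.inl (by rw [Set.mem_ofPred_eq, hsq]; gcongr))
      · refine Or.inr (Or.inr ⟨hmem, ?_⟩)
        rw [hsq]
        refine pow_le_pow_left₀ hts ?_ 2
        by_contra hlt'
        push Not at hlt'
        have : 6 * C ^ 3 * (‖slowCoord P k y c (Xn w)‖ + ‖y (Xn w)‖)
            < 6 * C ^ 3 * (t * √η + t * √η) := by
          have : 0 < 6 * C ^ 3 := by positivity
          exact mul_lt_mul_of_pos_left (by linarith) this
        linarith
    calc _ ≤ _ := measure_mono hsub
      _ ≤ ENNReal.ofReal (δ / 3) + (ENNReal.ofReal (δ / 3) + ENNReal.ofReal (δ / 3)) :=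
          (measure_union_le _ _).trans (add_le_add p1 ((measure_union_le _ _).trans
            (add_le_add p2 p3)))
      _ = ENNReal.ofReal δ := by
          rw [← ENNReal.ofReal_add (by positivity) (by positivity),
            ← ENNReal.ofReal_add (by positivity) (by positivity)]
          congr 1; ring

end SlowFastForm

end Stability

/-! ### Existence of slow-fast coordinates -/

section Construction

open Topology

theorem exists_taylor_bound_of_hasCompactSupport {E F : Type*} [NormedAddCommGroup E]
    [NormedSpace ℝ E] [NormedAddCommGroup F] [NormedSpace ℝ F] {f : E → F} (hf : ContDiff ℝ 2 f)
    (hs : HasCompactSupport f) :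
    ∃ C : ℝ, 0 ≤ C ∧ (∀ x h, ‖f (x + h) - f x - fderiv ℝ f x h‖ ≤ C * ‖h‖ ^ 2) ∧
      (∀ x, ‖fderiv ℝ f x - fderiv ℝ f 0‖ ≤ C * ‖x‖) ∧
      (∀ x, ‖f x - f 0‖ ≤ C * ‖x‖) ∧ ∀ x, ‖f x‖ ≤ C := by
  have hd : Differentiable ℝ f := hf.differentiable (by norm_num)
  obtain ⟨K₁, hK₁⟩ := ContDiff.lipschitzWith_of_hasCompactSupport hs hf (by norm_num)
  have hf' : ContDiff ℝ 1 (fderiv ℝ f) := hf.fderiv_right (by norm_num)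
  obtain ⟨K₂, hK₂⟩ := ContDiff.lipschitzWith_of_hasCompactSupport (hs.fderiv (𝕜 := ℝ)) hf'
    (by norm_num)
  obtain ⟨K₃, hK₃⟩ := hs.exists_bound_of_continuous hf.continuous
  have hK₃0 : 0 ≤ K₃ := (norm_nonneg _).trans (hK₃ 0)
  refine ⟨K₁ + K₂ + K₃, by positivity, fun x h => ?_, fun x => ?_, fun x => ?_, fun x => ?_⟩
  · have h1 := (convex_closedBall x ‖h‖).norm_image_sub_le_of_norm_fderiv_le' (𝕜 := ℝ) (f := f)
      (φ := fderiv ℝ f x) (C := K₂ * ‖h‖) (x := x) (y := x + h) (fun z _ => hd z)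
      (fun z hz => by
        refine (hK₂.norm_sub_le z x).trans ?_
        gcongr
        simpa [dist_eq_norm] using hz) (by simp) (by simp)
    rw [add_sub_cancel_left] at h1
    refine h1.trans ?_
    have : 0 ≤ (K₁ + K₃) * ‖h‖ ^ 2 := by positivity
    nlinarith
  · have := hK₂.norm_sub_le x 0
    rw [sub_zero] at this
    refine this.trans ?_
    gcongr
    linarith [K₁.coe_nonneg]
  · have := hK₁.norm_sub_le x 0
    rw [sub_zero] at this
    refine this.trans ?_
    gcongr
    linarith [K₂.coe_nonneg]
  · exact (hK₃ x).trans (by linarith [K₁.coe_nonneg, K₂.coe_nonneg])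

variable {E : Type*} [NormedAddCommGroup E] [InnerProductSpace ℝ E] [FiniteDimensional ℝ E]

theorem isInvertible_of_coercive {A : E →L[ℝ] E} {κ : ℝ} (hκ : 0 < κ)
    (hA : ∀ v, κ * ‖v‖ ^ 2 ≤ ⟪v, A v⟫_ℝ) : A.IsInvertible := by
  have hinj : Function.Injective A.toLinearMap := by
    rw [injective_iff_map_eq_zero]
    intro v hv
    have h := hA v
    have hv' : A v = 0 := hv
    rw [hv', inner_zero_right] at h
    have : ‖v‖ ^ 2 ≤ 0 := by nlinarith
    exact norm_eq_zero.1 (pow_eq_zero_iff two_ne_zero |>.1 (le_antisymm this (sq_nonneg _)))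
  exact ⟨(LinearEquiv.ofInjectiveEndo A.toLinearMap hinj).toContinuousLinearEquiv, by ext; rfl⟩

/-- A vector field `x ↦ L x (Y x)`, with `Y` a submersion onto the range of its derivative `G` at
its zero `0`, has slow-fast coordinates.  The slow coordinate is straightened by
`c x = P L(x) (Y'(x) L(x) + P)⁻¹`; a bump function makes the coordinates global. -/
theorem exists_slowFastForm {P G : E →L[ℝ] E} {Y : E → E} {L : E → E →L[ℝ] E} {κ : ℝ} (hκ : 0 < κ)
    (hA : ∀ v, κ * ‖v‖ ^ 2 ≤ ⟪v, (G + P) v⟫_ℝ) (hPP : ∀ x, P (P x) = P x)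
    (hPG : ∀ x, P (G x) = 0) (hGP : ∀ x, G (P x) = 0) (hY : ContDiff ℝ 3 Y) (hY0 : Y 0 = 0)
    (hYG : fderiv ℝ Y 0 = G) (hPY : ∀ x, P (Y x) = 0) (hL : ContDiff ℝ 2 L)
    (hL0 : L 0 = ContinuousLinearMap.id ℝ E - P) :
    ∃ (D k : E →L[ℝ] E →L[ℝ] E) (y : E → E) (c : E → E →L[ℝ] E) (r C : ℝ),
      SlowFastForm P G D k (fun x => L x (Y x)) y c r C ∧
      ∀ p q, D p ((G + P) q) = P (fderiv ℝ L 0 p q) := by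
  have hYd : ∀ x, DifferentiableAt ℝ Y x := fun x => hY.differentiable (by norm_num) x
  have hLd : ∀ x, DifferentiableAt ℝ L x := fun x => hL.differentiable (by norm_num) x
  have hY' : ContDiff ℝ 2 (fderiv ℝ Y) := hY.fderiv_right (by norm_num)
  let M : E → E →L[ℝ] E := fun x => fderiv ℝ Y x ∘L L x + P
  have hM : ContDiff ℝ 2 M := (hY'.clm_comp hL).add contDiff_const
  have hM0 : M 0 = G + P := by
    ext v; simp [M, hYG, hL0, hGP]
  have hinv0 : (M 0).IsInvertible := hM0 ▸ isInvertible_of_coercive hκ hA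
  -- on a small ball the straightening matrix exists and the linearizations are accurate
  have hev1 : ∀ᶠ x in 𝓝 (0 : E), (M x).IsInvertible := by
    obtain ⟨e, he⟩ := hinv0
    have := hM.continuous.continuousAt.preimage_mem_nhds (he ▸ ContinuousLinearEquiv.nhds e)
    exact this
  have hev2 : ∀ᶠ x in 𝓝 (0 : E), ‖Y x - G x‖ ≤ κ / 2 * ‖x‖ := by
    have := (hYd 0).hasFDerivAt.isLittleO.def (half_pos hκ)
    simpa [hY0, hYG] using this
  obtain ⟨K₁, hK₁⟩ := (hLd 0).hasFDerivAt.isBigO_sub.bound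
  simp only [sub_zero] at hK₁
  obtain ⟨R, hR, hball⟩ := Metric.eventually_nhds_iff_ball.1 (hev1.and (hev2.and hK₁))
  let φ : ContDiffBump (0 : E) := ⟨R / 4, R / 2, by positivity, by linarith⟩
  have hφ : ContDiff ℝ 2 φ := φ.contDiff
  have hφs : HasCompactSupport φ := φ.hasCompactSupport
  have hφ1 : ∀ x, ‖x‖ < R / 4 → φ x = 1 := fun x hx =>
    φ.one_of_mem_closedBall (by simpa using hx.le)
  have hφ0 : ∀ x, R / 2 ≤ ‖x‖ → φ x = 0 := fun x hx =>
    φ.zero_of_le_dist (by simpa using hx)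
  have htsupp : ∀ x, x ∈ tsupport φ → ‖x‖ < R := fun x hx => by
    rw [φ.tsupport_eq] at hx
    have : ‖x‖ ≤ R / 2 := by simpa using hx
    linarith
  let c₀ : E → E →L[ℝ] E := fun x => (P ∘L L x) ∘L (M x).inverse
  have hc₀ : ∀ x, ‖x‖ < R → ContDiffAt ℝ 2 c₀ x := fun x hx => by
    have hi := (hball x (by simpa using hx)).1
    exact (contDiffAt_const.clm_comp hL.contDiffAt).clm_comp
      (hi.contDiffAt_map_inverse.comp x hM.contDiffAt)
  let c : E → E →L[ℝ] E := fun x => φ x • c₀ x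
  let u : E → E := fun x => φ x • (Y x - G x)
  let y : E → E := fun x => G x + u x
  have hc : ContDiff ℝ 2 c := by
    rw [contDiff_iff_contDiffAt]
    intro x
    by_cases hx : x ∈ tsupport φ
    · exact hφ.contDiffAt.smul (hc₀ x (htsupp x hx))
    · have h0 := notMem_tsupport_iff_eventuallyEq.1 hx
      refine (contDiffAt_const (c := (0 : E →L[ℝ] E))).congr_of_eventuallyEq ?_
      filter_upwards [h0] with z hz
      simp [c, hz]
  have hu : ContDiff ℝ 2 u := hφ.smul ((hY.of_le (by norm_num)).sub G.contDiff)
  have hcs : HasCompactSupport c := hφs.smul_right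
  have hus : HasCompactSupport u := hφs.smul_right
  obtain ⟨K₂, hK₂0, hc1, hc2, hc3, hc4⟩ := exists_taylor_bound_of_hasCompactSupport hc hcs
  obtain ⟨K₃, hK₃0, hu1, hu2, hu3, hu4⟩ := exists_taylor_bound_of_hasCompactSupport hu hus
  have hyd : ∀ x, fderiv ℝ y x = G + fderiv ℝ u x := fun x => by
    have h1 : DifferentiableAt ℝ u x := hu.differentiable (by norm_num) x
    exact (G.hasFDerivAt.add h1.hasFDerivAt).fderiv
  have hyY : ∀ x, ‖x‖ < R / 4 → y x = Y x := fun x hx => by simp [y, u, hφ1 x hx]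
  have hyY' : ∀ x, ‖x‖ < R / 4 → fderiv ℝ y x = fderiv ℝ Y x := fun x hx => by
    refine Filter.EventuallyEq.fderiv_eq ?_
    have : Metric.ball (0 : E) (R / 4) ∈ 𝓝 x := Metric.isOpen_ball.mem_nhds (by simpa using hx)
    filter_upwards [this] with z hz
    exact hyY z (by simpa using hz)
  have hcc : ∀ x, ‖x‖ < R / 4 → c x = c₀ x := fun x hx => by simp [c, hφ1 x hx]
  have hcM : ∀ x, ‖x‖ < R / 4 → c x ∘L M x = P ∘L L x := fun x hx => by
    obtain ⟨e, he⟩ := (hball x (by simp only [Metric.mem_ball, dist_zero_right]; linarith)).1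
    rw [hcc x hx]
    ext v
    simp only [c₀, ContinuousLinearMap.comp_apply, ← he, ContinuousLinearMap.inverse_equiv,
      ContinuousLinearEquiv.coe_coe, ContinuousLinearEquiv.symm_apply_apply]
  have hR4 : (0 : ℝ) < R / 4 := by positivity
  have hc0 : c 0 = 0 := by
    rw [hcc 0 (by simpa using hR4)]
    ext v
    simp [c₀, hL0, hPP]
  have hu0 : u 0 = 0 := by simp [u, hY0]
  have hu'0 : fderiv ℝ u 0 = 0 := by
    have := hyd 0
    rw [hyY' 0 (by simpa using hR4), hYG] at this
    simpa using this
  set D := fderiv ℝ c 0 with hD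
  have hDrel : ∀ p q, D p ((G + P) q) = P (fderiv ℝ L 0 p q) := by
    have hcd : HasFDerivAt c D 0 := (hc.differentiable (by norm_num) 0).hasFDerivAt
    have hMd : HasFDerivAt M (fderiv ℝ M 0) 0 := (hM.differentiable (by norm_num) 0).hasFDerivAt
    have h1 := hcd.clm_comp hMd
    have h2 := (hasFDerivAt_const P (0 : E)).clm_comp (hLd 0).hasFDerivAt
    have heq : (fun x => c x ∘L M x) =ᶠ[𝓝 0] fun x => P ∘L L x := by
      filter_upwards [Metric.ball_mem_nhds (0 : E) hR4] with z hz
      exact hcM z (by simpa using hz)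
    have h3 := (h1.congr_of_eventuallyEq heq.symm).unique h2
    intro p q
    have h4 := congrArg (fun F => F p q) h3
    simpa [hc0, hM0] using h4
  obtain ⟨k, hk⟩ := exists_bilinear_sylvester hκ hA D
  have hlow : ∀ x, ‖x‖ ≤ 1 / κ * (‖P x‖ + ‖G x‖) := fun x => by
    have h1 := (hA x).trans (real_inner_le_norm _ _)
    have h2 : ‖(G + P) x‖ ≤ ‖G x‖ + ‖P x‖ := norm_add_le _ _
    by_cases hx : ‖x‖ = 0
    · rw [hx]; positivity
    have hx0 : 0 < ‖x‖ := lt_of_le_of_ne (norm_nonneg _) (Ne.symm hx)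
    rw [div_mul_eq_mul_div, one_mul, le_div_iff₀ hκ]
    have : ‖x‖ * (‖x‖ * κ) ≤ ‖x‖ * (‖P x‖ + ‖G x‖) := by nlinarith
    exact le_of_mul_le_mul_left this hx0
  have hyG : ∀ x, ‖y x - G x‖ ≤ κ / 2 * ‖x‖ := fun x => by
    have e1 : y x - G x = φ x • (Y x - G x) := by simp [y, u]
    rw [e1, norm_smul, Real.norm_of_nonneg φ.nonneg]
    rcases lt_or_ge ‖x‖ R with hx | hx
    · calc φ x * ‖Y x - G x‖ ≤ 1 * (κ / 2 * ‖x‖) := by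
            gcongr
            · exact φ.le_one
            · exact (hball x (by simpa using hx)).2.1
        _ = _ := one_mul _
    · rw [hφ0 x (by linarith), zero_mul]; positivity
  obtain ⟨C, hC⟩ : ∃ C, C = 1 + ‖P‖ + ‖G‖ + ‖D‖ + ‖k‖ + |K₁| + K₂ + K₃ + 2 / κ := ⟨_, rfl⟩
  have nP := norm_nonneg P
  have nG := norm_nonneg G
  have nD : 0 ≤ ‖D‖ := norm_nonneg D
  have nk : 0 ≤ ‖k‖ := norm_nonneg k
  have nK := abs_nonneg K₁
  have nκ : 0 < 2 / κ := by positivity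
  refine ⟨D, k, y, c, min 1 (R / 4), C, ?_, hDrel⟩
  exact
  { one_le := by linarith
    r_pos := lt_min one_pos hR4
    r_le := min_le_left _ _
    norm_P := by linarith
    norm_G := by linarith
    norm_D := by linarith
    norm_k := by linarith
    cont_y := G.continuous.add hu.continuous
    cont_c := hc.continuous
    cont_g := hL.continuous.clm_apply hY.continuous
    y_taylor := fun x h => by
      have e1 : y (x + h) - y x - fderiv ℝ y x h = u (x + h) - u x - fderiv ℝ u x h := by
        rw [hyd]; simp only [y, map_add, _root_.add_apply]; abel
      rw [e1]
      refine (hu1 x h).trans ?_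
      gcongr; linarith
    c_taylor := fun x h => by
      refine (hc1 x h).trans ?_
      gcongr; linarith
    fderiv_y := fun x => by
      have := hu2 x
      rw [hu'0, sub_zero] at this
      rw [hyd, add_sub_cancel_left]
      refine this.trans ?_
      gcongr; linarith
    fderiv_c := fun x => by
      refine (hc2 x).trans ?_
      gcongr; linarith
    c_small := fun x => by
      have := hc3 x
      rw [hc0, sub_zero] at this
      refine this.trans ?_
      gcongr; linarith
    c_bdd := fun x => (hc4 x).trans (by linarith)
    y_small := fun x => by
      have h1 := hu3 x
      rw [hu0, sub_zero] at h1
      have h2 : ‖y x‖ ≤ ‖G‖ * ‖x‖ + K₃ * ‖x‖ :=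
        (norm_add_le _ _).trans (add_le_add (G.le_opNorm x) h1)
      refine h2.trans ?_
      rw [← add_mul]; gcongr; linarith
    lower := fun x => by
      have h1 := hlow x
      have h2 : ‖G x‖ ≤ ‖y x‖ + κ / 2 * ‖x‖ := by
        have : G x = y x - (y x - G x) := by abel
        calc ‖G x‖ = ‖y x - (y x - G x)‖ := by rw [← this]
          _ ≤ _ := (norm_sub_le _ _).trans (by gcongr; exact hyG x)
      have h3 : ‖x‖ ≤ 1 / κ * (‖P x‖ + (‖y x‖ + κ / 2 * ‖x‖)) := h1.trans (by gcongr)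
      have h4 : 1 / κ * (‖P x‖ + (‖y x‖ + κ / 2 * ‖x‖))
          = 1 / κ * (‖P x‖ + ‖y x‖) + ‖x‖ / 2 := by field_simp; ring
      rw [h4] at h3
      have h5 : ‖x‖ ≤ 2 / κ * (‖P x‖ + ‖y x‖) := by
        have : 2 / κ * (‖P x‖ + ‖y x‖) = 2 * (1 / κ * (‖P x‖ + ‖y x‖)) := by ring
        linarith
      refine h5.trans ?_
      gcongr; linarith
    P_y := fun x => by simp [y, u, hPG, hPY]
    g_near := fun x hx => by
      have hxR : ‖x‖ < R / 4 := hx.trans_le (min_le_right _ _)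
      have h1 := (hball x (by simp only [Metric.mem_ball, dist_zero_right]; linarith)).2.2
      have e1 : L x (Y x) - y x = (L x - L 0) (y x) := by
        rw [hyY x hxR, _root_.sub_apply, hL0]; simp [hPY]
      rw [e1]
      refine norm_apply_le (h1.trans ?_) le_rfl
      gcongr
      linarith [le_abs_self K₁]
    slow := fun x hx => by
      have hxR : ‖x‖ < R / 4 := hx.trans_le (min_le_right _ _)
      have h1 := congrArg (fun F => F (Y x)) (hcM x hxR)
      rw [hyY' x hxR]
      simpa [M, hPY] using h1
    sylvester := fun a b ha hb => by
      have := hk a b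
      simpa [ha, hb] using this }

end Construction

/-! ### The mean second-order effect of the noise -/

section MeanEffect

variable {E : Type*} [NormedAddCommGroup E] [InnerProductSpace ℝ E] [FiniteDimensional ℝ E]
  {ι : Type*} [Fintype ι]

theorem OrthonormalBasis.sum_bilinear_star (b : OrthonormalBasis ι ℝ E) (F : E →L[ℝ] E →L[ℝ] E)
    (A : E →L[ℝ] E) : ∑ j, F (star A (b j)) (b j) = ∑ j, F (b j) (A (b j)) := by
  have h1 : ∀ j, F (star A (b j)) (b j) = ∑ i, ⟪b j, A (b i)⟫_ℝ • F (b i) (b j) := fun j => by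
    conv_lhs => rw [← b.sum_repr' (star A (b j))]
    simp only [map_sum, map_smul, _root_.sum_apply, _root_.smul_apply]
    refine Finset.sum_congr rfl fun i _ => ?_
    rw [ContinuousLinearMap.star_eq_adjoint, ContinuousLinearMap.adjoint_inner_right,
      real_inner_comm]
  have h2 : ∀ i, F (b i) (A (b i)) = ∑ j, ⟪b j, A (b i)⟫_ℝ • F (b i) (b j) := fun i => by
    conv_lhs => rw [← b.sum_repr' (A (b i))]
    simp only [map_sum, map_smul]
  simp_rw [h1, h2]
  exact Finset.sum_comm

variable {P G X N : E →L[ℝ] E} {D k : E →L[ℝ] E →L[ℝ] E} {η : ℝ}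

/-- The contraction of the noise form with the noise covariance `N` is of order `η` when the
stationary covariance `X` of the linearized fast dynamics satisfies the stationarity condition
`hstat`. -/
theorem sum_noiseForm_eq (b : OrthonormalBasis ι ℝ E) (hPG : ∀ x, P (G x) = 0)
    (hk : ∀ a b, P a = 0 → P b = 0 → k a (G b) + k (G a) b = D a b)
    (hX : G * X + X * star G = N + η • (G * X * star G))
    (hstat : ∑ j, D (X (b j)) (G (G (b j))) = 0) :
    ∑ j, noiseForm G D k (N (b j)) (b j)
      = -(η • ∑ j, noiseForm G D k ((G * X * star G) (b j)) (b j)) := by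
  have hN : N = G * X + X * star G - η • (G * X * star G) := by rw [hX]; abel
  have h1 : ∀ j, noiseForm G D k (N (b j)) (b j) = noiseForm G D k (G (X (b j))) (b j)
      + (noiseForm G D k ∘L X) (star G (b j)) (b j)
      - η • noiseForm G D k ((G * X * star G) (b j)) (b j) := fun j => by
    conv_lhs => rw [hN]
    simp
  simp_rw [h1]
  rw [Finset.sum_sub_distrib, Finset.sum_add_distrib, b.sum_bilinear_star, ← Finset.sum_add_distrib,
    ← Finset.smul_sum]
  have h2 : ∑ j, (noiseForm G D k (G (X (b j))) (b j)
      + (noiseForm G D k ∘L X) (b j) (G (b j))) = 0 := by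
    rw [← neg_eq_zero, ← Finset.sum_neg_distrib, ← hstat]
    refine Finset.sum_congr rfl fun j _ => ?_
    have := hk (G (X (b j))) (G (b j)) (hPG _) (hPG _)
    simp only [noiseForm, _root_.sub_apply, ContinuousLinearMap.bilinearComp_apply,
      ContinuousLinearMap.id_apply, ContinuousLinearMap.comp_apply]
    rw [← this]; abel
  rw [h2, zero_sub]

/-- The Lyapunov equation conjugated by `G`, which moves it to the range of `G`, where its solutions
are bounded uniformly in `η`. -/
theorem lyapunov_conj_fixed (hX : G * X + X * star G = N + η • (G * X * star G)) :
    G * X * star G = (1 - η • G) * (G * X * star G) * star (1 - η • G)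
      + η • (G * N * star G) := by
  have h : G * N * star G = G * (G * X * star G) + (G * X * star G) * star G
      - η • (G * (G * X * star G) * star G) := by
    have hN : N = G * X + X * star G - η • (G * X * star G) := by rw [hX]; abel
    rw [hN]
    simp only [mul_sub, mul_add, sub_mul, add_mul, mul_smul_comm, smul_mul_assoc, mul_assoc]
  rw [h, star_sub, star_one, star_smul, star_trivial η]
  simp only [mul_sub, sub_mul, one_mul, mul_one, mul_smul_comm, smul_mul_assoc, smul_sub, smul_add,
    smul_smul, mul_assoc]
  abel

/-- The mean second-order effect of noise with covariance `N` on the slow coordinate is `O(η)`. -/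
theorem norm_sum_noiseForm_le (b : OrthonormalBasis ι ℝ E) {κ : ℝ} (hκ : 0 < κ) (hη : 0 < η)
    (hηG : η * ‖G‖ ^ 2 ≤ κ) (hηκ : η * κ ≤ 1) (hPn : ∀ x, ‖x - P x‖ ≤ ‖x‖)
    (hPP : ∀ x, P (P x) = P x)
    (hG : ∀ v, P v = 0 → κ * ‖v‖ ^ 2 ≤ ⟪v, G v⟫_ℝ)
    (hPG : ∀ x, P (G x) = 0) (hGP : ∀ x, G (P x) = 0)
    (hk : ∀ a b, P a = 0 → P b = 0 → k a (G b) + k (G a) b = D a b)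
    (hX : G * X + X * star G = N + η • (G * X * star G))
    (hstat : ∑ j, D (X (b j)) (G (G (b j))) = 0) :
    ‖∑ j, noiseForm G D k (N (b j)) (b j)‖
      ≤ Fintype.card ι * ‖noiseForm G D k‖ * (‖G * N * star G‖ / κ) * η := by
  have hPG' : P * G = 0 := by ext x; simp [hPG]
  have hZ : κ * ‖G * X * star G‖ ≤ ‖G * N * star G‖ := by
    refine norm_le_of_discrete_lyapunov hη hηG hηκ hPn hGP (fun v => hG _ (by simp [hPP])) ?_ ?_
      (lyapunov_conj_fixed hX)
    · rw [← mul_assoc, ← mul_assoc, hPG', zero_mul, zero_mul]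
    · rw [mul_assoc, ← star_mul, hPG', star_zero, mul_zero]
  have hZ' : ‖G * X * star G‖ ≤ ‖G * N * star G‖ / κ := by
    rw [le_div_iff₀ hκ]; linarith
  rw [sum_noiseForm_eq b hPG hk hX hstat, norm_neg, norm_smul, Real.norm_of_nonneg hη.le, mul_comm]
  gcongr
  refine (norm_sum_le _ _).trans ?_
  have : ∀ j, ‖noiseForm G D k ((G * X * star G) (b j)) (b j)‖
      ≤ ‖noiseForm G D k‖ * (‖G * N * star G‖ / κ) := fun j => by
    have hb : ‖b j‖ ≤ 1 := by simp
    have h1 : ‖(G * X * star G) (b j)‖ ≤ ‖G * N * star G‖ / κ := by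
      simpa using norm_apply_le hZ' hb
    simpa using norm_apply₂_le (F := noiseForm G D k) le_rfl h1 hb
  refine (Finset.sum_le_sum fun j _ => this j).trans_eq ?_
  simp [Finset.card_univ, mul_assoc]

/-- A solution of the discrete Lyapunov equation is symmetric on the contracted directions.  The
skew part `W` solves the homogeneous equation, so `G W Gᵀ = 0` by the uniform bound, while
applying `P` from the left gives `P W Gᵀ = 0`; hence `W` vanishes on the range of `Gᵀ`. -/
theorem lyapunov_symm_on_ker {C : E →L[ℝ] E} {κ : ℝ} (hη : 0 < η)
    (hηG : η * ‖G‖ ^ 2 ≤ κ) (hκ : 0 < κ) (hηκ : η * κ ≤ 1) (hPn : ∀ x, ‖x - P x‖ ≤ ‖x‖)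
    (hPs : star P = P) (hPP : ∀ x, P (P x) = P x)
    (hA : ∀ v, κ * ‖v‖ ^ 2 ≤ ⟪v, (G + P) v⟫_ℝ)
    (hPG : ∀ x, P (G x) = 0) (hGP : ∀ x, G (P x) = 0) (hN : star N = N)
    (hC : C = (1 - η • G) * C * star (1 - η • G) + η ^ 2 • N) {z : E} (hz : P z = 0) :
    C z = star C z := by
  have hPG' : P * G = 0 := by ext x; simp [hPG]
  have hGP' : G * P = 0 := by ext x; simp [hGP]
  have hPGs : P * star G = 0 := by
    have := congrArg star hGP'
    rwa [star_mul, hPs, star_zero] at this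
  have hG : ∀ v, P v = 0 → κ * ‖v‖ ^ 2 ≤ ⟪v, G v⟫_ℝ := fun v hv => by simpa [hv] using hA v
  set W := C - star C with hW
  have hCs := congrArg star hC
  rw [star_add, star_mul, star_mul, star_star, star_smul, hN, star_trivial (η ^ 2),
    ← mul_assoc] at hCs
  have hWT : W = (1 - η • G) * W * star (1 - η • G) := by
    calc W = ((1 - η • G) * C * star (1 - η • G) + η ^ 2 • N)
          - ((1 - η • G) * star C * star (1 - η • G) + η ^ 2 • N) := by rw [← hC, ← hCs]
      _ = _ := by rw [add_sub_add_right_eq_sub, ← sub_mul, ← mul_sub]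
  have hcommG : G * (1 - η • G) = (1 - η • G) * G := by
    simp [mul_sub, sub_mul]
  have hZ : G * W * star G = (1 - η • G) * (G * W * star G) * star (1 - η • G)
      + η • (0 : E →L[ℝ] E) := by
    rw [smul_zero, add_zero]
    have hs : star (1 - η • G) * star G = star G * star (1 - η • G) := by
      rw [← star_mul, ← star_mul, hcommG]
    calc G * W * star G = (G * (1 - η • G)) * W * (star (1 - η • G) * star G) := by
          conv_lhs => rw [hWT]
          simp only [mul_assoc]
      _ = _ := by rw [hcommG, hs]; simp only [mul_assoc]
  have hGWG : G * W * star G = 0 := by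
    have := norm_le_of_discrete_lyapunov hη hηG hηκ hPn hGP (fun v => hG _ (by simp [hPP]))
      (by rw [← mul_assoc, ← mul_assoc, hPG', zero_mul, zero_mul])
      (by rw [mul_assoc, ← star_mul, hPG', star_zero, mul_zero]) hZ
    rw [norm_zero] at this
    have h0 := norm_nonneg (G * W * star G)
    exact norm_eq_zero.1 (by nlinarith)
  have hPWG : P * W * star G = 0 := by
    have h1 : P * (1 - η • G) = P := by rw [mul_sub, mul_one, mul_smul_comm, hPG']; simp
    have h2 : P * W = P * W - η • (P * W * star G) := by
      calc P * W = (P * (1 - η • G)) * W * star (1 - η • G) := by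
            conv_lhs => rw [hWT]
            simp only [mul_assoc]
        _ = _ := by
            rw [h1, star_sub, star_one, star_smul, star_trivial η, mul_sub, mul_one, mul_smul_comm]
    have h3 : η • (P * W * star G) = 0 := by
      have := sub_eq_self.1 h2.symm
      exact this
    exact (smul_eq_zero.1 h3).resolve_left hη.ne'
  obtain ⟨e, he⟩ := isInvertible_of_coercive hκ hA
  have hWG : ∀ x, W (star G x) = 0 := fun x => by
    have h1 : (G + P) (W (star G x)) = 0 := by
      have a1 : G (W (star G x)) = 0 := DFunLike.congr_fun hGWG x
      have a2 : P (W (star G x)) = 0 := DFunLike.congr_fun hPWG x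
      rw [_root_.add_apply, a1, a2, add_zero]
    rw [← he] at h1
    simpa using h1
  have hA' : ∀ v, κ * ‖v‖ ^ 2 ≤ ⟪v, star (G + P) v⟫_ℝ := fun v => by
    rw [ContinuousLinearMap.star_eq_adjoint, ContinuousLinearMap.adjoint_inner_right,
      real_inner_comm]
    exact hA v
  obtain ⟨e', he'⟩ := isInvertible_of_coercive hκ hA'
  have hsurj : star (G + P) (e'.symm z) = z := by rw [← he']; simp
  rw [star_add, hPs, _root_.add_apply] at hsurj
  have hPy : P (e'.symm z) = 0 := by
    have h1 := congrArg P hsurj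
    have h2 : P (star G (e'.symm z)) = 0 := DFunLike.congr_fun hPGs (e'.symm z)
    rwa [map_add, h2, zero_add, hPP, hz] at h1
  rw [hPy, add_zero] at hsurj
  have h0 := hWG (e'.symm z)
  rw [hsurj, hW, _root_.sub_apply] at h0
  exact sub_eq_zero.1 h0

end MeanEffect

/-! ### Gaussian noise -/

section Gaussian

variable {d : ℕ} {M : Matrix (Fin d) (Fin d) ℝ}

theorem integral_eval_mul_eval_multivariateGaussian (hM : M.PosSemidef) (i j : Fin d) :
    ∫ e, e i * e j ∂(multivariateGaussian (0 : EuclideanSpace ℝ (Fin d)) M) = M i j := by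
  have h := covariance_eval_multivariateGaussian (μ := (0 : EuclideanSpace ℝ (Fin d))) hM i j
  have hmean : ∀ i : Fin d,
      ∫ e, e i ∂(multivariateGaussian (0 : EuclideanSpace ℝ (Fin d)) M) = 0 := fun i => by
    have := IsGaussian.integral_dual (μ := multivariateGaussian (0 : EuclideanSpace ℝ (Fin d)) M)
      (EuclideanSpace.proj i)
    simpa using this
  rw [covariance] at h
  simpa [hmean] using h

theorem integral_bilinear_multivariateGaussian (hM : M.PosSemidef)
    (F : EuclideanSpace ℝ (Fin d) →L[ℝ] EuclideanSpace ℝ (Fin d) →L[ℝ] EuclideanSpace ℝ (Fin d)) :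
    ∫ e, F e e ∂(multivariateGaussian (0 : EuclideanSpace ℝ (Fin d)) M)
      = ∑ j, F (Matrix.toEuclideanCLM (𝕜 := ℝ) M (EuclideanSpace.basisFun (Fin d) ℝ j))
          (EuclideanSpace.basisFun (Fin d) ℝ j) := by
  set b := EuclideanSpace.basisFun (Fin d) ℝ with hb
  set ν := multivariateGaussian (0 : EuclideanSpace ℝ (Fin d)) M
  have hexp : ∀ e, F e e = ∑ j, ∑ i, (e i * e j) • F (b i) (b j) := fun e => by
    have he : e = ∑ i, e i • b i := by
      conv_lhs => rw [← b.sum_repr e]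
      simp [hb]
    conv_lhs => rw [he]
    simp only [map_sum, map_smul, _root_.sum_apply, _root_.smul_apply,
      Finset.smul_sum, smul_smul]
    refine Finset.sum_congr rfl fun j _ => Finset.sum_congr rfl fun i _ => ?_
    rw [mul_comm]
  have hint : ∀ i j, Integrable (fun e : EuclideanSpace ℝ (Fin d) => e i * e j) ν := fun i j => by
    have h2 : ∀ i : Fin d, MemLp (fun e : EuclideanSpace ℝ (Fin d) => e i) 2 ν := fun i =>
      (EuclideanSpace.proj (𝕜 := ℝ) i).comp_memLp' (IsGaussian.memLp_two_id (μ := ν))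
    exact (h2 i).integrable_mul (h2 j)
  simp_rw [hexp]
  rw [integral_finsetSum _ fun j _ => integrable_finsetSum _ fun i _ => (hint i j).smul_const _]
  refine Finset.sum_congr rfl fun j _ => ?_
  rw [integral_finsetSum _ fun i _ => (hint i j).smul_const _]
  simp_rw [integral_smul_const, ν, integral_eval_mul_eval_multivariateGaussian hM]
  have hMb : Matrix.toEuclideanCLM (𝕜 := ℝ) M (b j) = ∑ i, M i j • b i := by
    ext l
    simp [hb, Pi.single_apply]
  rw [hMb]
  simp

theorem integrable_one_add_norm_pow_of_isGaussian {E : Type*} [NormedAddCommGroup E]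
    [NormedSpace ℝ E] [CompleteSpace E] [SecondCountableTopology E] [MeasurableSpace E]
    [BorelSpace E] (ν : Measure E) [IsGaussian ν] (n : ℕ) :
    Integrable (fun e => (1 + ‖e‖) ^ n) ν := by
  rcases eq_or_ne n 0 with rfl | hn
  · simp
  have h1 : MemLp (fun e : E => ‖e‖) n ν :=
    (IsGaussian.memLp_id ν n (ENNReal.natCast_ne_top n)).norm
  have h2 : MemLp (fun e : E => 1 + ‖e‖) n ν := (memLp_const (1 : ℝ)).add h1
  have h3 := h2.integrable_norm_pow hn
  refine h3.congr (Filter.Eventually.of_forall fun e => ?_)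
  have he : ‖1 + ‖e‖‖ = 1 + ‖e‖ := Real.norm_of_nonneg (by positivity)
  exact congrArg (fun t : ℝ => t ^ n) he

theorem isCentredNoise_multivariateGaussian (hM : M.PosSemidef)
    {P : EuclideanSpace ℝ (Fin d) →L[ℝ] EuclideanSpace ℝ (Fin d)} (hPs : star P = P)
    (hMP : ∀ x, M *ᵥ (WithLp.ofLp (P x)) = 0) :
    IsCentredNoise P (multivariateGaussian (0 : EuclideanSpace ℝ (Fin d)) M) := by
  set ν := multivariateGaussian (0 : EuclideanSpace ℝ (Fin d)) M with hν
  have hmean : ∀ l : EuclideanSpace ℝ (Fin d) →L[ℝ] ℝ, ∫ e, l e ∂ν = 0 := fun l => by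
    rw [IsGaussian.integral_dual]; simp [hν]
  refine ⟨hmean, ?_, ?_⟩
  · exact integrable_one_add_norm_pow_of_isGaussian ν 12
  · have hcoord : ∀ j : Fin d, ∀ᵐ e ∂ν, ⟪P (EuclideanSpace.basisFun (Fin d) ℝ j), e⟫_ℝ = 0 := by
      intro j
      set v := P (EuclideanSpace.basisFun (Fin d) ℝ j) with hv
      have hcov := covarianceBilin_multivariateGaussian
        (μ := (0 : EuclideanSpace ℝ (Fin d))) hM v v
      rw [covarianceBilin_apply_eq_cov (IsGaussian.memLp_two_id), hMP, dotProduct_zero,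
        covariance_self (by fun_prop)] at hcov
      have hmem : MemLp (fun u => ⟪v, u⟫_ℝ) 2 ν :=
        (innerSL ℝ v).comp_memLp' (IsGaussian.memLp_two_id (μ := ν))
      have h := ae_eq_integral_of_variance_eq_zero hmem hcov
      have h0 : ∫ u, ⟪v, u⟫_ℝ ∂ν = 0 := hmean (innerSL ℝ v)
      filter_upwards [h] with e he
      rw [he, h0]
    filter_upwards [ae_all_iff.2 hcoord] with e he
    ext j
    have h : ⟪EuclideanSpace.basisFun (Fin d) ℝ j, P e⟫_ℝ = 0 := by
      rw [← he j]
      conv_lhs => rw [← hPs, ContinuousLinearMap.star_eq_adjoint,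
        ContinuousLinearMap.adjoint_inner_right]
    simpa [EuclideanSpace.inner_single_left] using h

end Gaussian

/-! ### Linear algebra of the Jacobian -/

section Algebra

variable {E : Type*} [NormedAddCommGroup E] [InnerProductSpace ℝ E] [FiniteDimensional ℝ E]

/-- If `‖G x‖²` is controlled by `⟪x, G x⟫` and `G` is normal, then `G` becomes coercive after
adding the orthogonal projection onto its kernel. -/
theorem exists_kernel_projection {G : E →L[ℝ] E} {c : ℝ} (hc : 0 < c)
    (hG : ∀ x, c * ‖G x‖ ^ 2 ≤ ⟪x, G x⟫_ℝ) (hGn : ∀ x, ‖star G x‖ = ‖G x‖) :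
    ∃ P : E →L[ℝ] E, star P = P ∧ (∀ x, P (P x) = P x) ∧ (∀ x, P (G x) = 0) ∧
      (∀ x, G (P x) = 0) ∧ (∀ x, ‖x - P x‖ ≤ ‖x‖) ∧
      ∃ κ > 0, ∀ v, κ * ‖v‖ ^ 2 ≤ ⟪v, (G + P) v⟫_ℝ := by
  let K : Submodule ℝ E := LinearMap.ker G.toLinearMap
  let P : E →L[ℝ] E := K.starProjection
  have hs : star P = P := isSelfAdjoint_starProjection K
  have hin : ∀ x y, ⟪P x, y⟫_ℝ = ⟪x, P y⟫_ℝ := fun x y =>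
    K.inner_starProjection_left_eq_right x y
  have hfix : ∀ x, G x = 0 → P x = x := fun x hx =>
    Submodule.starProjection_eq_self_iff.2 hx
  have hGP : ∀ x, G (P x) = 0 := fun x => K.starProjection_apply_mem x
  have hPP : ∀ x, P (P x) = P x := fun x => hfix _ (hGP x)
  have hPG : ∀ x, P (G x) = 0 := fun x => by
    refine ext_inner_left ℝ fun w => ?_
    have : star G (P w) = 0 := norm_eq_zero.1 (by rw [hGn, hGP, norm_zero])
    rw [inner_zero_right, ← hin, ← ContinuousLinearMap.adjoint_inner_left,
      ← ContinuousLinearMap.star_eq_adjoint, this, inner_zero_left]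
  have hPsq : ∀ x, ⟪x, P x⟫_ℝ = ‖P x‖ ^ 2 := fun x => by
    rw [← real_inner_self_eq_norm_sq, hin, hPP]
  refine ⟨P, hs, hPP, hPG, hGP, fun x => ?_, ?_⟩
  · have h : ‖x - P x‖ ^ 2 = ‖x‖ ^ 2 - ‖P x‖ ^ 2 := by
      rw [norm_sub_sq_real, hPsq]; ring
    exact abs_le_of_sq_le_sq' (by nlinarith [sq_nonneg ‖P x‖]) (norm_nonneg _) |>.2
  · have hinj : Function.Injective (G + P).toLinearMap := by
      rw [injective_iff_map_eq_zero]
      intro v hv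
      have hv' : G v + P v = 0 := hv
      have h1 : P v = 0 := by simpa [hPG, hPP] using congrArg P hv'
      rw [h1, add_zero] at hv'
      rw [← hfix v hv', h1]
    obtain ⟨B, hB0, hB⟩ := LinearMap.exists_antilipschitzWith (G + P).toLinearMap
      (LinearMap.ker_eq_bot.2 hinj)
    have hBp : (0 : ℝ) < B := hB0
    have hle : ∀ v, ‖v‖ ≤ B * ‖G v + P v‖ := fun v => by
      simpa using ZeroHomClass.bound_of_antilipschitz (G + P).toLinearMap hB v
    refine ⟨min c 1 / B ^ 2, by positivity, fun v => ?_⟩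
    have h0 : ‖G v + P v‖ ^ 2 = ‖G v‖ ^ 2 + ‖P v‖ ^ 2 := by
      rw [norm_add_sq_real, ← hin, hPG, inner_zero_left]; ring
    have h1 : ‖v‖ ^ 2 ≤ B ^ 2 * (‖G v‖ ^ 2 + ‖P v‖ ^ 2) := by
      rw [← h0, ← mul_pow]
      exact pow_le_pow_left₀ (norm_nonneg _) (hle v) 2
    rw [_root_.add_apply, inner_add_right, hPsq]
    calc min c 1 / B ^ 2 * ‖v‖ ^ 2 ≤ min c 1 / B ^ 2 * (B ^ 2 * (‖G v‖ ^ 2 + ‖P v‖ ^ 2)) := by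
          gcongr
      _ = min c 1 * ‖G v‖ ^ 2 + min c 1 * ‖P v‖ ^ 2 := by field_simp
      _ ≤ c * ‖G v‖ ^ 2 + 1 * ‖P v‖ ^ 2 := by gcongr <;> simp
      _ ≤ _ := by linarith [hG v]

/-- When `G = ∑ i, q i ⊗ a i` has full rank `n`, the vectors `q i` form a basis of the
complement of its kernel; `ψ` is the dual basis. -/
theorem exists_dual_functionals {n : ℕ} {G P : E →L[ℝ] E} {a q : Fin n → E} {κ : ℝ} (hκ : 0 < κ)
    (hA : ∀ v, κ * ‖v‖ ^ 2 ≤ ⟪v, (G + P) v⟫_ℝ) (hPP : ∀ x, P (P x) = P x)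
    (hPG : ∀ x, P (G x) = 0) (hGq : ∀ x, G x = ∑ i, ⟪a i, x⟫_ℝ • q i)
    (hrank : Module.finrank ℝ (LinearMap.range G.toLinearMap) = n) :
    (∀ i, P (q i) = 0) ∧ ∃ ψ : Fin n → E →L[ℝ] ℝ, (∀ i x, ψ i (G x) = ⟪a i, x⟫_ℝ) ∧
      (∀ (c : Fin n → ℝ) i, ψ i (∑ j, c j • q j) = c i) ∧ ∀ v, ∑ i, ψ i v • q i = v - P v := by
  have hle : LinearMap.range G.toLinearMap ≤ Submodule.span ℝ (Set.range q) := by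
    rintro _ ⟨x, rfl⟩
    have : G x ∈ Submodule.span ℝ (Set.range q) := by
      rw [hGq]
      exact Submodule.sum_mem _ fun i _ =>
        Submodule.smul_mem _ _ (Submodule.subset_span (Set.mem_range_self i))
    exact this
  have hcard : Module.finrank ℝ (Submodule.span ℝ (Set.range q)) ≤ n := by
    simpa [Set.finrank] using finrank_range_le_card (R := ℝ) q
  have hli : LinearIndependent ℝ q := by
    rw [linearIndependent_iff_card_le_finrank_span, Fintype.card_fin]
    exact hrank.symm.le.trans (Submodule.finrank_mono hle)
  have heq := Submodule.eq_of_le_of_finrank_le hle (hcard.trans hrank.ge)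
  have hPq : ∀ i, P (q i) = 0 := fun i => by
    have : q i ∈ LinearMap.range G.toLinearMap := by
      rw [heq]; exact Submodule.subset_span (Set.mem_range_self i)
    obtain ⟨x, hx⟩ := this
    rw [← hx]; exact hPG x
  have hinj : LinearMap.ker (Fintype.linearCombination ℝ q) = ⊥ :=
    LinearMap.ker_eq_bot.2 (linearIndependent_iff_injective_fintypeLinearCombination.1 hli)
  obtain ⟨l, hl⟩ := LinearMap.exists_leftInverse_of_injective _ hinj
  have hl' : ∀ c : Fin n → ℝ, l (∑ j, c j • q j) = c := fun c => by
    simpa [Fintype.linearCombination_apply] using LinearMap.congr_fun hl c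
  let ψ : Fin n → E →L[ℝ] ℝ := fun i =>
    (LinearMap.proj i ∘ₗ l).toContinuousLinearMap ∘L (ContinuousLinearMap.id ℝ E - P)
  have hψ : ∀ i x, ψ i x = l (x - P x) i := fun i x => by simp [ψ]
  have hψc : ∀ (c : Fin n → ℝ) i, ψ i (∑ j, c j • q j) = c i := fun c i => by
    have hP0 : P (∑ j, c j • q j) = 0 := by simp [hPq]
    rw [hψ, hP0, sub_zero, hl']
  refine ⟨hPq, ψ, fun i x => by rw [hGq, hψc], hψc, fun v => ?_⟩
  obtain ⟨e, he⟩ := isInvertible_of_coercive hκ hA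
  have hsurj : (G + P) (e.symm (v - P v)) = v - P v := by rw [← he]; simp
  rw [_root_.add_apply] at hsurj
  have h1 : P (e.symm (v - P v)) = 0 := by
    have := congrArg P hsurj
    simpa [hPG, hPP] using this
  rw [h1, add_zero] at hsurj
  have h2 : ∀ i, ψ i v = ⟪a i, e.symm (v - P v)⟫_ℝ := fun i => by
    rw [hψ]
    conv_lhs => rw [← hsurj, hGq, hl']
  simp_rw [h2]
  rw [← hGq, hsurj]

/-- Slow-fast coordinates for a field `∑ i, h i • φ i` whose scalar factors `h i` vanish at `0`.
The stationary condition on the quadratic coupling only involves the derivatives of the `φ i`. -/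
theorem exists_slowFastForm_sum_smul {n : ℕ} {ι : Type*} [Fintype ι] {G P : E →L[ℝ] E}
    {h : Fin n → E → ℝ} {φ : Fin n → E → E} {a : Fin n → E} {κ : ℝ} (hκ : 0 < κ)
    (hA : ∀ v, κ * ‖v‖ ^ 2 ≤ ⟪v, (G + P) v⟫_ℝ) (hPP : ∀ x, P (P x) = P x)
    (hPG : ∀ x, P (G x) = 0) (hGP : ∀ x, G (P x) = 0)
    (hh : ∀ i, ContDiff ℝ 3 (h i)) (hh0 : ∀ i, h i 0 = 0)
    (hha : ∀ i v, fderiv ℝ (h i) 0 v = ⟪a i, v⟫_ℝ) (hφ : ∀ i, ContDiff ℝ 2 (φ i))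
    (hGq : ∀ x, G x = ∑ i, ⟪a i, x⟫_ℝ • φ i 0)
    (hrank : Module.finrank ℝ (LinearMap.range G.toLinearMap) = n) (b : OrthonormalBasis ι ℝ E) :
    ∃ (D k : E →L[ℝ] E →L[ℝ] E) (y : E → E) (c : E → E →L[ℝ] E) (r C : ℝ),
      SlowFastForm P G D k (fun x => ∑ i, h i x • φ i x) y c r C ∧
      ∀ X : E →L[ℝ] E, ∑ j, D (X (b j)) (G (G (b j))) = P (∑ i, fderiv ℝ (φ i) 0 (X (a i))) := by
  obtain ⟨hPq, ψ, hψG, hψc, hψs⟩ := exists_dual_functionals hκ hA hPP hPG hGq hrank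
  let Y : E → E := fun x => ∑ i, h i x • φ i 0
  let L : E → E →L[ℝ] E := fun x => ∑ i, ContinuousLinearMap.smulRightL ℝ E E (ψ i) (φ i x)
  have hL_apply : ∀ x v, L x v = ∑ i, ψ i v • φ i x := fun x v => by
    simp [L]
  have hY : ContDiff ℝ 3 Y := ContDiff.sum fun i _ => (hh i).smul contDiff_const
  have hL : ContDiff ℝ 2 L := ContDiff.sum fun i _ =>
    (ContinuousLinearMap.contDiff _).comp (hφ i)
  have hYG : fderiv ℝ Y 0 = G := by
    have h1 : HasFDerivAt Y (∑ i, (fderiv ℝ (h i) 0).smulRight (φ i 0)) 0 :=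
      HasFDerivAt.fun_sum fun i _ =>
        (((hh i).differentiable (by norm_num) 0).hasFDerivAt).smul_const (φ i 0)
    rw [h1.fderiv]
    ext v
    simp [hGq, hha]
  have hLd : ∀ p v, fderiv ℝ L 0 p v = ∑ i, ψ i v • fderiv ℝ (φ i) 0 p := fun p v => by
    have h1 : HasFDerivAt L
        (∑ i, (ContinuousLinearMap.smulRightL ℝ E E (ψ i)).comp (fderiv ℝ (φ i) 0)) 0 :=
      HasFDerivAt.fun_sum fun i _ => (ContinuousLinearMap.hasFDerivAt _).comp (0 : E)
        ((hφ i).differentiable (by norm_num) 0).hasFDerivAt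
    rw [h1.fderiv]
    simp
  obtain ⟨D, k, y, c, r, C, hform, hD⟩ := exists_slowFastForm (Y := Y) (L := L) hκ hA hPP hPG hGP hY
    (by simp [Y, hh0]) hYG (fun x => by simp [Y, hPq]) hL
    (by ext v; simp only [hL_apply, hψs]; simp)
  refine ⟨D, k, y, c, r, C, ?_, fun X => ?_⟩
  · convert hform using 2 with x
    rw [hL_apply]
    exact Finset.sum_congr rfl fun i _ => by rw [hψc]
  · have h1 : ∀ j, D (X (b j)) (G (G (b j)))
        = P (∑ i, ⟪b j, a i⟫_ℝ • fderiv ℝ (φ i) 0 (X (b j))) := fun j => by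
      have h2 := hD (X (b j)) (G (b j))
      rw [_root_.add_apply, hPG, add_zero] at h2
      rw [h2, hLd]
      simp_rw [hψG, real_inner_comm]
    simp_rw [h1]
    rw [← map_sum, Finset.sum_comm]
    congr 1
    refine Finset.sum_congr rfl fun i _ => ?_
    conv_rhs => rw [← b.sum_repr' (a i)]
    simp [map_sum, map_smul]

end Algebra

/-! ### The covariance and its rescaling -/

section Lyapunov

variable {E : Type*} [NormedAddCommGroup E] [InnerProductSpace ℝ E] [FiniteDimensional ℝ E]
  {G N C : E →L[ℝ] E} {η : ℝ}

theorem lyapunov_star (hN : star N = N)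
    (hC : C = (1 - η • G) * C * star (1 - η • G) + η ^ 2 • N) :
    star C = (1 - η • G) * star C * star (1 - η • G) + η ^ 2 • N := by
  have hCs := congrArg star hC
  rwa [star_add, star_mul, star_mul, star_star, star_smul, hN, star_trivial (η ^ 2),
    ← mul_assoc] at hCs

/-- The Lyapunov equation for the covariance `C`, written for the rescaled covariance `η⁻¹ C`. -/
theorem lyapunov_rescaled (hη : η ≠ 0)
    (hC : C = (1 - η • G) * C * star (1 - η • G) + η ^ 2 • N) :
    G * (η⁻¹ • C) + (η⁻¹ • C) * star G = N + η • (G * (η⁻¹ • C) * star G) := by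
  have h : η • (G * C + C * star G) = η • (η • N + η • (G * C * star G)) := by
    rw [star_sub, star_one, star_smul, star_trivial η] at hC
    simp only [mul_sub, sub_mul, one_mul, mul_one, mul_smul_comm, smul_mul_assoc, smul_sub] at hC
    rw [smul_add, smul_add, smul_smul, ← pow_two]
    have h2 := sub_eq_zero.2 hC
    rw [← sub_eq_zero, ← h2]
    abel
  have h' := smul_right_injective _ hη h
  have h2 := congrArg (fun F : E →L[ℝ] E => η⁻¹ • F) h'
  simp only [smul_add, smul_smul, inv_mul_cancel₀ hη, one_smul] at h2
  simp only [mul_smul_comm, smul_mul_assoc, smul_smul, mul_inv_cancel₀ hη, one_smul]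
  exact h2

end Lyapunov

/-! ### Gradients of smooth functions -/

section Gradient

variable {d : ℕ} {f : Param d → ℝ}

theorem contDiff_gradient (hf : ContDiff ℝ 3 f) : ContDiff ℝ 2 (gradient f) := by
  have h' : ContDiff ℝ 2 (fderiv ℝ f) := hf.fderiv_right (by norm_num)
  rw [contDiff_euclidean]
  intro i
  have h : (fun x => gradient f x i) = fun x => fderiv ℝ f x (EuclideanSpace.single i 1) := by
    funext x
    rw [← inner_gradient_left, EuclideanSpace.inner_single_right]
    simp
  rw [h]
  exact h'.clm_apply contDiff_const

theorem inner_fderiv_gradient_comm (hf : ContDiff ℝ 3 f) (x u v : Param d) :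
    ⟪fderiv ℝ (gradient f) x u, v⟫_ℝ = ⟪u, fderiv ℝ (gradient f) x v⟫_ℝ := by
  have h' : ContDiff ℝ 2 (fderiv ℝ f) := hf.fderiv_right (by norm_num)
  have h2 : ∀ u v, ⟪fderiv ℝ (gradient f) x u, v⟫_ℝ = fderiv ℝ (fderiv ℝ f) x u v := fun u v => by
    have hd : HasFDerivAt (gradient f) (fderiv ℝ (gradient f) x) x :=
      ((contDiff_gradient hf).differentiable (by norm_num) x).hasFDerivAt
    have h3 := (hd.inner ℝ (hasFDerivAt_const v x)).fderiv
    have h4 := (((h'.differentiable (by norm_num) x).hasFDerivAt).clm_apply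
      (hasFDerivAt_const v x)).fderiv
    have h5 : (fun y => ⟪gradient f y, v⟫_ℝ) = fun y => fderiv ℝ f y v := by
      funext y; exact inner_gradient_left
    rw [h5, h4] at h3
    have := congrArg (fun F : Param d →L[ℝ] ℝ => F u) h3
    simpa [fderivInnerCLM_apply] using this.symm
  have hsymm : IsSymmSndFDerivAt ℝ f x := hf.contDiffAt.isSymmSndFDerivAt (by simp; norm_num)
  rw [h2, real_inner_comm, h2]
  exact hsymm u v

end Gradient

/-! ### Calculus of the TD errors and of the regularizer -/

section TD

variable {d n : ℕ} {S A : Type*} {Q : Param d → S → A → ℝ} {π : S → A} {γ : ℝ}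
  {D : Fin n → Transition S A} {θstar : Param d}

theorem contDiff_tdError (hcur : ∀ i, ContDiff ℝ 3 (qCur Q D i))
    (hnext : ∀ i, ContDiff ℝ 3 (qNext Q π D i)) (i : Fin n) :
    ContDiff ℝ 3 (tdError Q π γ D i) :=
  (hcur i).sub (contDiff_const.add (contDiff_const.mul (hnext i)))

theorem fderiv_tdError (hcur : ∀ i, ContDiff ℝ 3 (qCur Q D i))
    (hnext : ∀ i, ContDiff ℝ 3 (qNext Q π D i)) (i : Fin n) (θ v : Param d) :
    fderiv ℝ (tdError Q π γ D i) θ v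
      = ⟪gradient (qCur Q D i) θ - γ • gradient (qNext Q π D i) θ, v⟫_ℝ := by
  have h1 := ((hcur i).differentiable (by norm_num) θ).hasFDerivAt
  have h2 := ((hnext i).differentiable (by norm_num) θ).hasFDerivAt
  have h : HasFDerivAt (tdError Q π γ D i) _ θ := h1.sub ((h2.const_mul γ).const_add (D i).reward)
  rw [h.fderiv, inner_sub_left, real_inner_smul_left, inner_gradient_left, inner_gradient_left]
  rfl

/-- At a fixed point only the derivatives of the TD errors contribute to the Jacobian. -/
theorem toEuclideanCLM_pseudoHessian_apply (hcur : ∀ i, ContDiff ℝ 3 (qCur Q D i))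
    (hnext : ∀ i, ContDiff ℝ 3 (qNext Q π D i)) (hfix : ∀ i, tdError Q π γ D i θstar = 0)
    (v : Param d) :
    Matrix.toEuclideanCLM (𝕜 := ℝ) (pseudoHessian Q π γ D θstar) v
      = ∑ i, ⟪gradient (qCur Q D i) θstar - γ • gradient (qNext Q π D i) θstar, v⟫_ℝ
          • gradient (qCur Q D i) θstar := by
  have h1 : Matrix.toEuclideanCLM (𝕜 := ℝ) (pseudoHessian Q π γ D θstar)
      = fderiv ℝ (semiGradient Q π γ D) θstar := by
    refine ContinuousLinearMap.coe_injective
      ((EuclideanSpace.basisFun (Fin d) ℝ).toBasis.ext fun j => ?_)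
    ext i
    simp [pseudoHessian]
  have h2 : HasFDerivAt (semiGradient Q π γ D) (∑ i, (tdError Q π γ D i θstar •
      fderiv ℝ (gradient (qCur Q D i)) θstar + (fderiv ℝ (tdError Q π γ D i) θstar).smulRight
        (gradient (qCur Q D i) θstar))) θstar :=
    HasFDerivAt.fun_sum fun i _ =>
      (((contDiff_tdError hcur hnext i).differentiable (by norm_num) θstar).hasFDerivAt).smul
        ((contDiff_gradient (hcur i)).differentiable (by norm_num) θstar).hasFDerivAt
  rw [h1, h2.fderiv]
  simp [hfix, fderiv_tdError hcur hnext]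

theorem bilin_eq_inner (B : Matrix (Fin d) (Fin d) ℝ) (u v : Param d) :
    bilin B u v = ⟪u, Matrix.toEuclideanCLM (𝕜 := ℝ) B v⟫_ℝ := by
  rw [bilin, EuclideanSpace.inner_eq_star_dotProduct, Matrix.ofLp_toEuclideanCLM, star_trivial,
    dotProduct_comm]

theorem fderiv_tdRegularizer (hcur : ∀ i, ContDiff ℝ 3 (qCur Q D i)) (η : ℝ)
    (C : Matrix (Fin d) (Fin d) ℝ) (v : Param d) :
    fderiv ℝ (tdRegularizer Q π γ D η C θstar) θstar v = η * ∑ i,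
      ((1 / 2) * ⟪star (Matrix.toEuclideanCLM (𝕜 := ℝ) C) (gradient (qCur Q D i) θstar)
          + Matrix.toEuclideanCLM (𝕜 := ℝ) C (gradient (qCur Q D i) θstar),
          fderiv ℝ (gradient (qCur Q D i)) θstar v⟫_ℝ
        - γ * ⟪star (Matrix.toEuclideanCLM (𝕜 := ℝ) C) (gradient (qNext Q π D i) θstar),
          fderiv ℝ (gradient (qCur Q D i)) θstar v⟫_ℝ) := by
  set T := Matrix.toEuclideanCLM (𝕜 := ℝ) C
  have hd : ∀ i, HasFDerivAt (gradient (qCur Q D i))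
      (fderiv ℝ (gradient (qCur Q D i)) θstar) θstar := fun i => ((contDiff_gradient (hcur i)).differentiable (by norm_num) θstar).hasFDerivAt
  have hTd : ∀ i, HasFDerivAt (fun θ => T (gradient (qCur Q D i) θ))
      (T.comp (fderiv ℝ (gradient (qCur Q D i)) θstar)) θstar := fun i =>
    T.hasFDerivAt.comp θstar (hd i)
  have hfun : tdRegularizer Q π γ D η C θstar = fun θ =>
      η * (1 / 2) * ∑ i, ⟪gradient (qCur Q D i) θ, T (gradient (qCur Q D i) θ)⟫_ℝ
      - η * γ * ∑ i, ⟪gradient (qNext Q π D i) θstar, T (gradient (qCur Q D i) θ)⟫_ℝ := by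
    funext θ
    simp [tdRegularizer, bilin_eq_inner, T]
  have h1 := (HasFDerivAt.fun_sum fun (i : Fin n) (_ : i ∈ Finset.univ) =>
    (hd i).inner ℝ (hTd i)).const_mul (η * (1 / 2))
  have h2 := (HasFDerivAt.fun_sum fun (i : Fin n) (_ : i ∈ Finset.univ) =>
    (hasFDerivAt_const (gradient (qNext Q π D i) θstar) θstar).inner ℝ (hTd i)).const_mul (η * γ)
  rw [hfun, (h1.fun_sub h2).fderiv]
  simp only [_root_.sub_apply, _root_.smul_apply, _root_.sum_apply, smul_eq_mul,
    ContinuousLinearMap.comp_apply, ContinuousLinearMap.prod_apply, fderivInnerCLM_apply,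
    _root_.zero_apply, inner_zero_left, add_zero, ContinuousLinearMap.star_eq_adjoint,
    inner_add_left, ContinuousLinearMap.adjoint_inner_left]
  rw [Finset.sum_sub_distrib, mul_sub, ← Finset.mul_sum, ← Finset.mul_sum, mul_assoc, mul_assoc]
  congr 3
  refine Finset.sum_congr rfl fun i _ => ?_
  rw [real_inner_comm (T (gradient (qCur Q D i) θstar))]

theorem noisyTD_sub_eq_frozen (η : ℝ) (θ₀ : Param d) (ε : ℕ → Param d) (k : ℕ) :
    noisyTD Q π γ D η θ₀ ε k - θstar
      = frozen (fun x e : Param d => x + η • (e - semiGradient Q π γ D (θstar + x))) Set.univ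
          (θ₀ - θstar) ε k := by
  induction k with
  | zero => rfl
  | succ k ih =>
    rw [frozen, if_pos (Set.mem_univ _), ← ih, noisyTD]
    simp only [add_sub_cancel, smul_sub]
    abel

end TD

/-! ### Stability of TD fixed points -/

section TDStability

variable {d n : ℕ} {S A : Type*} {Q : Param d → S → A → ℝ} {π : S → A} {γ : ℝ}
  {D : Fin n → Transition S A} {θstar : Param d}

theorem star_toEuclideanCLM (B : Matrix (Fin d) (Fin d) ℝ) :
    star (Matrix.toEuclideanCLM (𝕜 := ℝ) B) = Matrix.toEuclideanCLM (𝕜 := ℝ) Bᵀ := by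
  rw [← map_star, star_eq_conjTranspose, conjTranspose_eq_transpose_of_trivial]

theorem norm_toEuclideanCLM_sq (B : Matrix (Fin d) (Fin d) ℝ) (x : Param d) :
    ‖Matrix.toEuclideanCLM (𝕜 := ℝ) B x‖ ^ 2
      = (B *ᵥ WithLp.ofLp x) ⬝ᵥ (B *ᵥ WithLp.ofLp x) := by
  rw [← real_inner_self_eq_norm_sq, EuclideanSpace.inner_eq_star_dotProduct,
    Matrix.ofLp_toEuclideanCLM, star_trivial]

theorem finrank_range_toEuclideanCLM (B : Matrix (Fin d) (Fin d) ℝ) :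
    Module.finrank ℝ (LinearMap.range (Matrix.toEuclideanCLM (𝕜 := ℝ) B).toLinearMap) = B.rank := by
  have := B.rank_eq_finrank_range_toLin (EuclideanSpace.basisFun (Fin d) ℝ).toBasis
    (EuclideanSpace.basisFun (Fin d) ℝ).toBasis
  rw [this, ← Matrix.toEuclideanLin_eq_toLin_orthonormal]
  rfl

theorem IsLyapunovFixedPoint.toEuclideanCLM {η : ℝ} {G M C : Matrix (Fin d) (Fin d) ℝ}
    (h : IsLyapunovFixedPoint η G M C) :
    Matrix.toEuclideanCLM (𝕜 := ℝ) C = (1 - η • Matrix.toEuclideanCLM (𝕜 := ℝ) G)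
        * Matrix.toEuclideanCLM (𝕜 := ℝ) C * star (1 - η • Matrix.toEuclideanCLM (𝕜 := ℝ) G)
      + η ^ 2 • Matrix.toEuclideanCLM (𝕜 := ℝ) M := by
  have h1 : (1 - η • Matrix.toEuclideanCLM (𝕜 := ℝ) G)
      = Matrix.toEuclideanCLM (𝕜 := ℝ) (1 - η • G) := by simp
  rw [h1, star_toEuclideanCLM, ← map_mul, ← map_mul, ← map_smul, ← map_add]
  exact congrArg _ h

/-- Stationarity of the regularizer along the kernel of the Jacobian, in the form in which it
enters the slow drift: the covariance may be moved onto `∇Q_i - γ ∇Q'_i` because it is symmetric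
on the contracted directions. -/
theorem projection_sum_hessian_eq_zero {G P T : Param d →L[ℝ] Param d}
    (hcur : ∀ i, ContDiff ℝ 3 (qCur Q D i)) {η : ℝ} (hη : η ≠ 0)
    {C : Matrix (Fin d) (Fin d) ℝ} (hT : T = Matrix.toEuclideanCLM (𝕜 := ℝ) C)
    (hPs : star P = P) (hGP : ∀ x, G (P x) = 0)
    (hsymm : ∀ i, T (gradient (qCur Q D i) θstar) = star T (gradient (qCur Q D i) θstar))
    (hstat : ∀ v, G v = 0 → fderiv ℝ (tdRegularizer Q π γ D η C θstar) θstar v = 0) :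
    P (∑ i, fderiv ℝ (gradient (qCur Q D i)) θstar
      (star T (gradient (qCur Q D i) θstar - γ • gradient (qNext Q π D i) θstar))) = 0 := by
  refine ext_inner_left ℝ fun w => ?_
  have h := hstat (P w) (hGP w)
  rw [fderiv_tdRegularizer hcur, ← hT] at h
  have h' := (mul_eq_zero.1 h).resolve_left hη
  rw [inner_zero_right, ← h', ← ContinuousLinearMap.adjoint_inner_left,
    ← ContinuousLinearMap.star_eq_adjoint, hPs, inner_sum]
  refine Finset.sum_congr rfl fun i _ => ?_
  rw [hsymm, ← inner_fderiv_gradient_comm (hcur i), map_sub, map_smul, inner_sub_right,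
    real_inner_smul_right, inner_add_left, real_inner_comm, ← real_inner_comm _ (star T _)]
  ring

end TDStability

theorem theorem1 {d n : ℕ} {S A : Type*} (Q : Param d → S → A → ℝ) (π : S → A) (γ : ℝ)
    (D : Fin n → Transition S A) (M : Matrix (Fin d) (Fin d) ℝ) (θstar : Param d)
    (L₂ L₃ : NNReal) (ω C₀ : ℝ) {Ω : Type*} [MeasurableSpace Ω] (μ : Measure Ω)
    [IsProbabilityMeasure μ] (ε : ℕ → Ω → Param d) (H : Set ℝ)
    -- regularity: three derivatives, the second and third of them Lipschitz
    (hcur : ∀ i, ContDiff ℝ 3 (qCur Q D i))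
    (hcur₂ : ∀ i, LipschitzWith L₂ (iteratedFDeriv ℝ 2 (qCur Q D i)))
    (hcur₃ : ∀ i, LipschitzWith L₃ (iteratedFDeriv ℝ 3 (qCur Q D i)))
    (hnext : ∀ i, ContDiff ℝ 3 (qNext Q π D i))
    (hnext₂ : ∀ i, LipschitzWith L₂ (iteratedFDeriv ℝ 2 (qNext Q π D i)))
    (hnext₃ : ∀ i, LipschitzWith L₃ (iteratedFDeriv ℝ 3 (qNext Q π D i)))
    -- the noise: independent centred Gaussians with covariance `M`
    (hM : M.PosSemidef) (hindep : iIndepFun ε μ)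
    (hlaw : ∀ k, HasLaw (ε k) (multivariateGaussian 0 M) μ)
    -- `θstar` is a fixed point of TD-learning
    (hfix : ∀ i, tdError Q π γ D i θstar = 0)
    -- `G`, `∑ i, ∇Q_i ∇Q_iᵀ` and `M` span the same `n`-dimensional subspace
    (hrank : (pseudoHessian Q π γ D θstar).rank = n)
    (hspan : LinearMap.range (gradGram Q D θstar).mulVecLin
      = LinearMap.range (pseudoHessian Q π γ D θstar).mulVecLin)
    (hspanM : LinearMap.range M.mulVecLin
      = LinearMap.range (pseudoHessian Q π γ D θstar).mulVecLin)
    -- alignment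
    (halign : IsAligned ω C₀ (gradGram Q D θstar) (pseudoHessian Q π γ D θstar))
    (halignM : IsAligned ω C₀ M (pseudoHessian Q π γ D θstar))
    -- condition (1)
    (h1 : ∀ z ∈ spectrum ℂ ((pseudoHessian Q π γ D θstar).map Complex.ofReal),
      0 ≤ z.re ∧ (0 < |z.im| → 0 < z.re))
    -- condition (2)
    (h2 : ∀ η ∈ H, ∃ C : Matrix (Fin d) (Fin d) ℝ,
      IsLyapunovFixedPoint η (pseudoHessian Q π γ D θstar) M C ∧
      ∀ v : Param d, pseudoHessian Q π γ D θstar *ᵥ WithLp.ofLp v = 0 →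
        fderiv ℝ (tdRegularizer Q π γ D η C θstar) θstar v = 0) :
    IsStableTD Q π γ D μ ε H θstar := by
  set G := Matrix.toEuclideanCLM (𝕜 := ℝ) (pseudoHessian Q π γ D θstar) with hGdef
  set N := Matrix.toEuclideanCLM (𝕜 := ℝ) M with hNdef
  set a : Fin n → Param d := fun i =>
    gradient (qCur Q D i) θstar - γ • gradient (qNext Q π D i) θstar with ha
  have hGq : ∀ x, G x = ∑ i, ⟪a i, x⟫_ℝ • gradient (qCur Q D i) θstar :=
    toEuclideanCLM_pseudoHessian_apply hcur hnext hfix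
  have hGker : ∀ v : Param d, G v = 0 → pseudoHessian Q π γ D θstar *ᵥ WithLp.ofLp v = 0 :=
    fun v hv => by rw [← Matrix.ofLp_toEuclideanCLM, ← hGdef, hv]; rfl
  have hNs : star N = N := by
    rw [hNdef, star_toEuclideanCLM, ← conjTranspose_eq_transpose_of_trivial, hM.isHermitian.eq]
  -- normality of the Jacobian, from its unitary diagonalization
  obtain ⟨-, UB, -, b, -, hUB, -, hB, -⟩ := halign
  obtain ⟨⟨c, hc, hcG⟩, hnormal⟩ := normal_matrix_quadratic_forms hUB hB h1
  obtain ⟨P, hPs, hPP, hPG, hGP, hPn, κ, hκ, hcoer⟩ := exists_kernel_projection (G := G) hc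
    (fun x => by
      rw [norm_toEuclideanCLM_sq, ← bilin_eq_inner]
      exact hcG _)
    (fun x => by
      rw [← sq_eq_sq₀ (norm_nonneg _) (norm_nonneg _), star_toEuclideanCLM, norm_toEuclideanCLM_sq,
        norm_toEuclideanCLM_sq]
      exact hnormal _)
  have hcoerG : ∀ v, P v = 0 → κ * ‖v‖ ^ 2 ≤ ⟪v, G v⟫_ℝ := fun v hv => by simpa [hv] using hcoer v
  have hrankG : Module.finrank ℝ (LinearMap.range G.toLinearMap) = n := by
    rw [finrank_range_toEuclideanCLM, hrank]
  have hPq := (exists_dual_functionals hκ hcoer hPP hPG hGq hrankG).1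
  have hPN : ∀ x, P (N x) = 0 := fun x => by
    have h : M *ᵥ WithLp.ofLp x ∈ LinearMap.range (pseudoHessian Q π γ D θstar).mulVecLin :=
      hspanM ▸ ⟨WithLp.ofLp x, rfl⟩
    obtain ⟨z, hz⟩ := h
    have : N x = G (WithLp.toLp 2 z) := by
      refine WithLp.ofLp_injective 2 ?_
      rw [hGdef, hNdef, Matrix.ofLp_toEuclideanCLM, Matrix.ofLp_toEuclideanCLM]
      exact hz.symm
    rw [this, hPG]
  have hNP : ∀ x, N (P x) = 0 := fun x => by
    have : N * P = 0 := by
      have h : P * N = 0 := ContinuousLinearMap.ext hPN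
      have := congrArg star h
      rwa [star_mul, hPs, hNs, star_zero] at this
    exact DFunLike.congr_fun this x
  -- slow-fast coordinates at the fixed point
  obtain ⟨F, k, y, cor, r, C, hform, hF⟩ := exists_slowFastForm_sum_smul
    (h := fun i x => tdError Q π γ D i (θstar + x))
    (φ := fun i x => gradient (qCur Q D i) (θstar + x)) (a := a) hκ hcoer hPP hPG hGP
    (fun i => (contDiff_tdError hcur hnext i).comp (contDiff_const.add contDiff_id))
    (fun i => by simpa using hfix i)
    (fun i v => by rw [fderiv_comp_add_left, add_zero, fderiv_tdError hcur hnext])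
    (fun i => (contDiff_gradient (hcur i)).comp (contDiff_const.add contDiff_id))
    (by simpa using hGq) hrankG (EuclideanSpace.basisFun (Fin d) ℝ)
  simp only [fderiv_comp_add_left, add_zero] at hF
  -- below `η₁` the discrete Lyapunov equation is uniformly solvable on the range of `G`
  let η₁ : ℝ := min (κ / (‖G‖ ^ 2 + 1)) κ⁻¹
  have hη₁ : 0 < η₁ := by positivity
  have hmean : ∀ η ∈ H, 0 < η → η < η₁ →
      ‖∫ e, noiseForm G F k e e ∂(multivariateGaussian (0 : Param d) M)‖
        ≤ (Fintype.card (Fin d) * ‖noiseForm G F k‖ * (‖G * N * star G‖ / κ)) * η := by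
    intro η hηH hη hηη
    have hηG : η * ‖G‖ ^ 2 ≤ κ := by
      have h := (lt_div_iff₀ (by positivity)).1 (hηη.trans_le (min_le_left _ _))
      nlinarith
    have hηκ : η * κ ≤ 1 := by
      have h := hηη.le.trans (min_le_right _ _)
      rwa [← one_div, le_div_iff₀ hκ] at h
    obtain ⟨B, hL, hstat⟩ := h2 η hηH
    have hL' := hL.toEuclideanCLM
    rw [← hGdef, ← hNdef] at hL'
    set T := Matrix.toEuclideanCLM (𝕜 := ℝ) B with hT
    have hsymm : ∀ i, T (gradient (qCur Q D i) θstar) = star T (gradient (qCur Q D i) θstar) :=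
      fun i => lyapunov_symm_on_ker hη hηG hκ hηκ hPn hPs hPP hcoer hPG hGP hNs hL' (hPq i)
    have hzero := projection_sum_hessian_eq_zero (π := π) (γ := γ) hcur hη.ne' hT hPs hGP hsymm
      fun v hv => hstat v (hGker v hv)
    rw [integral_bilinear_multivariateGaussian hM]
    -- `star T` is a Lyapunov fixed point as well, and it is the one that meets the stationarity
    refine norm_sum_noiseForm_le _ hκ hη hηG hηκ hPn hPP hcoerG hPG hGP hform.sylvester
      (lyapunov_rescaled hη.ne' (lyapunov_star hNs hL')) ?_
    rw [hF]
    simp only [_root_.smul_apply, map_smul]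
    rw [← Finset.smul_sum, map_smul, hzero, smul_zero]
  have hν := isCentredNoise_multivariateGaussian hM hPs fun x => by
    rw [← Matrix.ofLp_toEuclideanCLM, ← hNdef, hNP]; rfl
  obtain ⟨hs1, hs2⟩ := hform.stability hκ hcoerG hν hindep hlaw (by positivity) hη₁ hmean
  refine ⟨fun T r δ hT hr hδ => ?_, fun T δ hT hδ => ?_⟩
  · obtain ⟨ρ, η₀, hρ, hη₀, h⟩ := hs1 T r δ hT hr hδ
    refine ⟨ρ, η₀, hρ, hη₀, fun η hη hη0 hηη θ₀ hθ => ?_⟩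
    simp only [noisyTD_sub_eq_frozen]
    exact h η hη hη0 hηη _ hθ
  · obtain ⟨K, η₀, hK, hη₀, h⟩ := hs2 T δ hT hδ
    refine ⟨K, η₀, hK, hη₀, fun η hη hη0 hηη k hk => ?_⟩
    simp only [noisyTD_sub_eq_frozen, sub_self]
    exact h η hη hη0 hηη k hk
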